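/- Let $k$ be a field of characteristic $0$. All objects are $\mathbb Z$-graded $k$-vector spaces in homological grading (differentials have degree $-1$), with the Koszul sign rule. *Categories.* $\mathrm{DGLA}$ is the category of dg Lie algebras over $k$: the bracket has degree $0$, is graded antisymmetric, satisfies the graded Jacobi identity, and $d$ is a derivation with $d^2=0$. $\mathrm{coCDGA}$ is the category of non-counital dg coalgebras $(C,\Delta,d)$ that are coassociative, cocommutative (with respect to the braiding $x\otimes y\mapsto(-1)^{|x||y|}y\otimes x$) and conilpotent (every $x\in C$ is killed by some iterated comultiplication $\Delta^n\colon C\to C^{\otimes(n+1)}$), with $d$ a coderivation and $d^2=0$. Morphisms in both categories are the linear maps of degree $0$ compatible with all the structure. *Convolution.* For $C\in\mathrm{coCDGA}$ and $\mathfrak h\in\mathrm{DGLA}$, let $\{C,\mathfrak h\}$ be the dg Lie algebra whose degree $p$ part is the space of linear maps $C\to\mathfrak h$ of degree $p$, with $[f,g]=[-,-]\circ(f\otimes g)\circ\Delta$ and $df=d_{\mathfrak h}\circ f-(-1)^{|f|}f\circ d_C$. This is a functor $\{-,-\}\colon\mathrm{coCDGA}^{\mathrm{op}}\times\mathrm{DGLA}\to\mathrm{DGLA}$.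 *Tensoring and enrichment.* A tensoring functor is a bifunctor $\rhd\colon\mathrm{coCDGA}\times\mathrm{DGLA}\to\mathrm{DGLA}$ together with bijections $$\mathrm{DGLA}(C\rhd\mathfrak g,\mathfrak h)\cong\mathrm{DGLA}(\mathfrak g,\{C,\mathfrak h\})$$ natural in $C,\mathfrak g,\mathfrak h$ (so $C\rhd-$ is left adjoint to $\{C,-\}$). An enrichment functor is a bifunctor $\overline{\mathrm{DGLA}}\colon\mathrm{DGLA}^{\mathrm{op}}\times\mathrm{DGLA}\to\mathrm{coCDGA}$ together with bijections $$\mathrm{DGLA}(\mathfrak g,\{C,\mathfrak h\})\cong\mathrm{coCDGA}(C,\overline{\mathrm{DGLA}}(\mathfrak g,\mathfrak h))$$ natural in $C,\mathfrak g,\mathfrak h$ (so $\overline{\mathrm{DGLA}}(-,\mathfrak h)$ is right adjoint to $\{-,\mathfrak h\}^{\mathrm{op}}$). *Universal Maurer–Cartan Lie algebra.* $\mathbf{mc}_{\mathrm{Lie}}$ is the free graded Lie algebra on one generator $x$ of degree $-1$, with differential determined by $dx=-\tfrac12[x,x]$. *Cobar construction.* For $C\in\mathrm{coCDGA}$, let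 $(\Sigma C)_n=C_{n+1}$, and let $\Omega C\in\mathrm{DGLA}$ be the free graded Lie algebra on $\Sigma C$, with the differential determined on generators by $$d(\Sigma c)=-\Sigma(d_Cc)-\tfrac12\sum(-1)^{|c'|}[\Sigma c',\Sigma c''],\qquad \Delta c=\sum c'\otimes c'' .$$ *Bar construction.* For $\mathfrak g\in\mathrm{DGLA}$, let $(\Sigma^{-1}\mathfrak g)_n=\mathfrak g_{n-1}$, and let $B\mathfrak g\in\mathrm{coCDGA}$ be the cofree conilpotent cocommutative coalgebra $S^{\mathrm{co}}(\Sigma^{-1}\mathfrak g)=\bigoplus_{n\ge1}S^n(\Sigma^{-1}\mathfrak g)$ (graded symmetric powers, with the reduced unshuffle comultiplication), with the unique coderivation $d$ of degree $-1$ whose component in $\Sigma^{-1}\mathfrak g$ is $\Sigma^{-1}x\mapsto-\Sigma^{-1}(d_{\mathfrak g}x)$ on $S^1$, is $\Sigma^{-1}x\cdot\Sigma^{-1}y\mapsto(-1)^{|x|}\Sigma^{-1}[x,y]$ on $S^2$, and is $0$ on $S^n$ for $n\ge3$. **Proposition.** A tensoring functor $\rhd$ and an enrichment functor $\overline{\mathrm{DGLA}}$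 exist, and for every tensoring functor and every enrichment functor there are isomorphisms $$\Omega C\;\cong\;C\rhd\mathbf{mc}_{\mathrm{Lie}}\qquad\text{and}\qquad B\mathfrak g\;\cong\;\overline{\mathrm{DGLA}}(\mathbf{mc}_{\mathrm{Lie}},\mathfrak g),$$ natural in $C\in\mathrm{coCDGA}$ and in $\mathfrak g\in\mathrm{DGLA}$, respectively. -/

import Mathlib

open CategoryTheory TensorProduct

universe u

namespace ComLie

/-! ### Graded vector spaces, signs and braiding -/

/-- The sign `(-1)^n` as an element of `k`. -/
def sg {k : Type u} [Field k] (n : ℤ) : k := ((n.negOnePow : ℤˣ) : ℤ)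

section sign
variable {k : Type u} [Field k]

theorem sg_add (m n : ℤ) : (sg (m + n) : k) = sg m * sg n := by
  simp [sg, Int.negOnePow_add]

theorem sg_congr {m n : ℤ} (h : Even (m - n)) : (sg m : k) = sg n := by
  simp only [sg, (Int.negOnePow_eq_iff m n).2 h]

theorem sg_even {m : ℤ} (h : Even m) : (sg m : k) = 1 := by
  simp [sg, Int.negOnePow_even m h]

theorem sg_odd {m : ℤ} (h : Odd m) : (sg m : k) = -1 := by
  simp [sg, Int.negOnePow_odd m h]

theorem sg_mul_self (m : ℤ) : (sg m * sg m : k) = 1 := by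
  rw [← sg_add, sg_even (by simp)]

theorem sg_neg_one : (sg (-1) : k) = -1 := sg_odd (by decide)

theorem neg_sg (m : ℤ) : (-sg m : k) = sg (m + 1) := by
  rw [sg_add, sg_odd (m := 1) (by decide)]; ring

end sign

/-- A `ℤ`-graded vector space: a vector space with an internal direct sum decomposition. -/
structure GrMod (k : Type u) [Field k] where
  carrier : Type u
  [addCommGroup : AddCommGroup carrier]
  [module : Module k carrier]
  gr : ℤ → Submodule k carrier
  isInternal : DirectSum.IsInternal gr

attribute [instance] GrMod.addCommGroup GrMod.module

namespace GrMod
variable {k : Type u} [Field k]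

instance : CoeSort (GrMod k) (Type u) := ⟨GrMod.carrier⟩

theorem iSup_gr (V : GrMod k) : ⨆ n, V.gr n = ⊤ :=
  V.isInternal.submodule_iSup_eq_top

theorem ext_gr (V : GrMod k) {M : Type*} [AddCommGroup M] [Module k M] {f g : V →ₗ[k] M}
    (h : ∀ n, ∀ x ∈ V.gr n, f x = g x) : f = g := by
  have : LinearMap.eqLocus f g = ⊤ := by
    rw [eq_top_iff, ← V.iSup_gr]
    exact iSup_le fun n x hx => h n x hx
  ext x
  exact (this ▸ Submodule.mem_top : x ∈ LinearMap.eqLocus f g)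

theorem ext_gr₂ (V W : GrMod k) {M : Type*} [AddCommGroup M] [Module k M]
    {f g : (V ⊗[k] W) →ₗ[k] M}
    (h : ∀ m n, ∀ x ∈ V.gr m, ∀ y ∈ W.gr n, f (x ⊗ₜ y) = g (x ⊗ₜ y)) : f = g := by
  apply TensorProduct.ext
  refine V.ext_gr fun m x hx => W.ext_gr fun n y hy => ?_
  exact h m n x hx y hy

theorem ext_gr₃ (U V W : GrMod k) {M : Type*} [AddCommGroup M] [Module k M]
    {f g : (U ⊗[k] (V ⊗[k] W)) →ₗ[k] M}
    (h : ∀ l m n, ∀ x ∈ U.gr l, ∀ y ∈ V.gr m, ∀ z ∈ W.gr n,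
      f (x ⊗ₜ (y ⊗ₜ z)) = g (x ⊗ₜ (y ⊗ₜ z))) : f = g := by
  apply TensorProduct.ext
  refine U.ext_gr fun l x hx => ?_
  exact V.ext_gr₂ W fun m n y hy z hz => h l m n x hx y hy z hz

theorem bijective_coe (V : GrMod k) : Function.Bijective (DirectSum.coeLinearMap V.gr) :=
  V.isInternal

/-- The linear map that is given by `φ n` on the degree `n` part. -/
noncomputable def desc (V : GrMod k) {M : Type*} [AddCommGroup M] [Module k M]
    (φ : ∀ n, V.gr n →ₗ[k] M) : V →ₗ[k] M :=
  DirectSum.toModule k ℤ M φ ∘ₗ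
    (LinearEquiv.ofBijective (DirectSum.coeLinearMap V.gr) V.bijective_coe).symm.toLinearMap

theorem desc_apply (V : GrMod k) {M : Type*} [AddCommGroup M] [Module k M]
    (φ : ∀ n, V.gr n →ₗ[k] M) {n : ℤ} {x : V} (hx : x ∈ V.gr n) : V.desc φ x = φ n ⟨x, hx⟩ := by
  have h : (LinearEquiv.ofBijective (DirectSum.coeLinearMap V.gr) V.bijective_coe).symm x =
      DirectSum.lof k ℤ (fun n => V.gr n) n ⟨x, hx⟩ := by
    rw [LinearEquiv.symm_apply_eq]
    simp
  simp [desc, h]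

/-- The linear map that acts on the degree `n` part as multiplication by `c n`. -/
noncomputable def scale (V : GrMod k) (c : ℤ → k) : V →ₗ[k] V :=
  V.desc fun n => c n • (V.gr n).subtype

theorem scale_apply (V : GrMod k) (c : ℤ → k) {n : ℤ} {x : V} (hx : x ∈ V.gr n) :
    V.scale c x = c n • x := by
  simp [scale, V.desc_apply _ hx]

theorem scale_mem (V : GrMod k) (c : ℤ → k) {n : ℤ} {x : V} (hx : x ∈ V.gr n) :
    V.scale c x ∈ V.gr n := by
  rw [V.scale_apply c hx]; exact Submodule.smul_mem _ _ hx

/-- The sign involution `x ↦ (-1)^|x| x`. -/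
noncomputable def sigma (V : GrMod k) : V →ₗ[k] V := V.scale sg

/-- The projection to the sum of the even degree parts. -/
noncomputable def even (V : GrMod k) : V →ₗ[k] V := V.scale fun n => if Even n then 1 else 0

/-- The projection to the sum of the odd degree parts. -/
noncomputable def odd (V : GrMod k) : V →ₗ[k] V := V.scale fun n => if Even n then 0 else 1

theorem sigma_apply (V : GrMod k) {n : ℤ} {x : V} (hx : x ∈ V.gr n) :
    V.sigma x = (sg n : k) • x := V.scale_apply _ hx

theorem sigma_sigma (V : GrMod k) (x : V) : V.sigma (V.sigma x) = x := by
  have : V.sigma ∘ₗ V.sigma = LinearMap.id := V.ext_gr fun n x hx => by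
    simp [V.sigma_apply hx, smul_smul, sg_mul_self]
  exact LinearMap.congr_fun this x

theorem parity_apply (V : GrMod k) {M : Type*} [AddCommGroup M] [Module k M]
    (f g : V →ₗ[k] M) {n : ℤ} {x : V} (hx : x ∈ V.gr n) :
    f (V.even x) + g (V.odd x) = if Even n then f x else g x := by
  simp only [even, odd, V.scale_apply _ hx]
  split_ifs <;> simp

/-- A linear map of degree `p`. -/
def IsHom (V W : GrMod k) (p : ℤ) (f : V →ₗ[k] W) : Prop :=
  ∀ n, ∀ x ∈ V.gr n, f x ∈ W.gr (n + p)

theorem IsHom.sigma_comm {V W : GrMod k} {p : ℤ} {f : V →ₗ[k] W} (hf : IsHom V W p f) (x : V) :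
    W.sigma (f x) = (sg p : k) • f (V.sigma x) := by
  have : W.sigma ∘ₗ f = (sg p : k) • f ∘ₗ V.sigma := V.ext_gr fun n x hx => by
    simp [V.sigma_apply hx, W.sigma_apply (hf n x hx), smul_smul, sg_add, mul_comm]
  exact LinearMap.congr_fun this x

/-- The shift: the degree `n` part of `V.shift p` is the degree `n + p` part of `V`. In homological
grading `ΣV = V.shift 1` and `Σ⁻¹V = V.shift (-1)`. -/
def shift (V : GrMod k) (p : ℤ) : GrMod k where
  carrier := V.carrier
  gr n := V.gr (n + p)
  isInternal := by
    have h := (DirectSum.isInternal_submodule_iff_iSupIndep_and_iSup_eq_top _).1 V.isInternal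
    refine DirectSum.isInternal_submodule_of_iSupIndep_of_iSup_eq_top
      (h.1.comp (add_left_injective p)) ?_
    rw [← h.2]
    exact (Equiv.addRight p).iSup_comp (g := V.gr)

/-- The degree `n` part of the tensor product of graded vector spaces. -/
def tensorGr (V W : GrMod k) (n : ℤ) : Submodule k (V ⊗[k] W) :=
  Submodule.span k {t | ∃ i j x y, x ∈ V.gr i ∧ y ∈ W.gr j ∧ i + j = n ∧ t = x ⊗ₜ[k] y}

theorem tmul_mem (V W : GrMod k) {i j n : ℤ} {x : V} {y : W} (hx : x ∈ V.gr i) (hy : y ∈ W.gr j)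
    (h : i + j = n) : x ⊗ₜ[k] y ∈ tensorGr V W n :=
  Submodule.subset_span ⟨i, j, x, y, hx, hy, h, rfl⟩

/-- The braiding `x ⊗ y ↦ (-1)^{|x||y|} y ⊗ x`. -/
noncomputable def braid (V W : GrMod k) : (V ⊗[k] W) →ₗ[k] (W ⊗[k] V) :=
  (TensorProduct.comm k V W).toLinearMap ∘ₗ
    (TensorProduct.map V.even LinearMap.id + TensorProduct.map V.odd W.sigma)

theorem braid_apply (V W : GrMod k) {i j : ℤ} {x : V} {y : W} (hx : x ∈ V.gr i)
    (hy : y ∈ W.gr j) : braid V W (x ⊗ₜ y) = (sg (i * j) : k) • (y ⊗ₜ[k] x) := by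
  have := V.parity_apply ((TensorProduct.mk k V W).flip y)
    ((TensorProduct.mk k V W).flip (W.sigma y)) hx
  simp only [LinearMap.flip_apply, TensorProduct.mk_apply, W.sigma_apply hy] at this
  simp only [braid, LinearMap.comp_apply, LinearMap.add_apply, TensorProduct.map_tmul,
    LinearMap.id_apply, W.sigma_apply hy, this]
  split_ifs with h
  · simp [sg_even (h.mul_right j)]
  · simp only [tmul_smul, map_smul, LinearEquiv.coe_coe, comm_tmul]
    congr 1
    apply sg_congr
    simp only [Int.even_sub, Int.even_mul]
    tauto

/-- A family of subspaces with a diagonal operator whose eigenvalue on the `n`-th one is `n`. -/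
theorem isInternal_of_euler [CharZero k] {M : Type*} [AddCommGroup M] [Module k M]
    {gr : ℤ → Submodule k M} (E : Module.End k M)
    (hE : ∀ n, ∀ x ∈ gr n, E x = (n : k) • x) (htop : ⨆ n, gr n = ⊤) :
    DirectSum.IsInternal gr := by
  refine DirectSum.isInternal_submodule_of_iSupIndep_of_iSup_eq_top ?_ htop
  refine iSupIndep.mono (E.eigenspaces_iSupIndep.comp (Int.cast_injective (α := k))) fun n x hx => ?_
  exact Module.End.mem_eigenspace_iff.2 (hE n x hx)

theorem scale_cast (V : GrMod k) {n : ℤ} {x : V} (hx : x ∈ V.gr n) :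
    V.scale (fun n => (n : k)) x = (n : k) • x := V.scale_apply _ hx

end GrMod

/-! ### Graded and differential graded Lie algebras -/

/-- A graded Lie algebra (over a field of characteristic zero). -/
structure GrLie (k : Type u) [Field k] extends GrMod k where
  bracket : carrier →ₗ[k] carrier →ₗ[k] carrier
  bracket_mem : ∀ {m n x y}, x ∈ gr m → y ∈ gr n → bracket x y ∈ gr (m + n)
  bracket_anti : ∀ {m n x y}, x ∈ gr m → y ∈ gr n →
    bracket x y = -((sg (m * n) : k) • bracket y x)
  jacobi : ∀ {m n p x y z}, x ∈ gr m → y ∈ gr n → z ∈ gr p →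
    bracket x (bracket y z) = bracket (bracket x y) z + (sg (m * n) : k) • bracket y (bracket x z)

/-- A differential graded Lie algebra, in homological grading (the differential has degree `-1`). -/
structure DGLie (k : Type u) [Field k] extends GrLie k where
  d : carrier →ₗ[k] carrier
  d_mem : ∀ {n x}, x ∈ gr n → d x ∈ gr (n - 1)
  d_d : ∀ x, d (d x) = 0
  leibniz : ∀ {m x}, x ∈ gr m → ∀ y,
    d (bracket x y) = bracket (d x) y + (sg m : k) • bracket x (d y)

/-- A morphism of dg Lie algebras: a linear map of degree `0` that commutes with the brackets and
with the differentials. -/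
@[ext]
structure DGLie.Hom {k : Type u} [Field k] (g h : DGLie k) where
  map : g.carrier →ₗ[k] h.carrier
  map_mem : ∀ {n x}, x ∈ g.gr n → map x ∈ h.gr n
  map_bracket : ∀ x y, map (g.bracket x y) = h.bracket (map x) (map y)
  map_d : ∀ x, map (g.d x) = h.d (map x)

/-- The category of dg Lie algebras. -/
instance DGLie.category (k : Type u) [Field k] : Category (DGLie k) where
  Hom := DGLie.Hom
  id g := { map := LinearMap.id
            map_mem := fun h => h
            map_bracket := fun _ _ => rfl
            map_d := fun _ => rfl }
  comp f g := { map := g.map ∘ₗ f.map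
                map_mem := fun h => g.map_mem (f.map_mem h)
                map_bracket := fun x y => by simp [f.map_bracket, g.map_bracket]
                map_d := fun x => by simp [f.map_d, g.map_d] }

/-! ### Conilpotent cocommutative coalgebras -/

/-- `tensorTower V n` is the tensor power `V ⊗ (V ⊗ (⋯ ⊗ V))` with `n + 1` factors. -/
noncomputable def tensorTower {k : Type u} [Field k] (V : GrMod k) : ℕ → ModuleCat.{u} k
  | 0 => ModuleCat.of k V
  | n + 1 => ModuleCat.of k (V ⊗[k] (tensorTower V n))

/-- The iterated comultiplication `Δⁿ : V → V^{⊗ (n + 1)}`, with `Δ⁰ = id` and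
`Δⁿ⁺¹ = (id ⊗ Δⁿ) ∘ Δ`. -/
noncomputable def iterComul {k : Type u} [Field k] (V : GrMod k) (Δ : V →ₗ[k] (V ⊗[k] V)) :
    (n : ℕ) → V →ₗ[k] (tensorTower V n)
  | 0 => LinearMap.id
  | n + 1 => (LinearMap.lTensor V (iterComul V Δ n)) ∘ₗ Δ

/-- A non-counital, coassociative, cocommutative, conilpotent graded coalgebra. -/
structure GrCoalg (k : Type u) [Field k] extends GrMod k where
  comul : carrier →ₗ[k] (carrier ⊗[k] carrier)
  comul_mem : ∀ {n x}, x ∈ gr n → comul x ∈ GrMod.tensorGr toGrMod toGrMod n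
  coassoc : (TensorProduct.assoc k carrier carrier carrier).toLinearMap ∘ₗ
    comul.rTensor carrier ∘ₗ comul = comul.lTensor carrier ∘ₗ comul
  cocomm : GrMod.braid toGrMod toGrMod ∘ₗ comul = comul
  conilpotent : ∀ x, ∃ n, iterComul toGrMod comul n x = 0

/-- A non-counital, coassociative, cocommutative, conilpotent dg coalgebra, in homological grading;
the differential is a coderivation of degree `-1`. -/
structure DGCoalg (k : Type u) [Field k] extends GrCoalg k where
  d : carrier →ₗ[k] carrier
  d_mem : ∀ {n x}, x ∈ gr n → d x ∈ gr (n - 1)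
  d_d : ∀ x, d (d x) = 0
  coder : comul ∘ₗ d = (TensorProduct.map d LinearMap.id + TensorProduct.map toGrMod.sigma d) ∘ₗ comul

/-- A morphism of dg coalgebras: a linear map of degree `0` that commutes with the
comultiplications and with the differentials. -/
@[ext]
structure DGCoalg.Hom {k : Type u} [Field k] (C D : DGCoalg k) where
  map : C.carrier →ₗ[k] D.carrier
  map_mem : ∀ {n x}, x ∈ C.gr n → map x ∈ D.gr n
  map_comul : ∀ x, D.comul (map x) = TensorProduct.map map map (C.comul x)
  map_d : ∀ x, map (C.d x) = D.d (map x)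

/-- The category of conilpotent cocommutative dg coalgebras. -/
instance DGCoalg.category (k : Type u) [Field k] : Category (DGCoalg k) where
  Hom := DGCoalg.Hom
  id C := { map := LinearMap.id
            map_mem := fun h => h
            map_comul := fun _ => by simp
            map_d := fun _ => rfl }
  comp f g := { map := g.map ∘ₗ f.map
                map_mem := fun h => g.map_mem (f.map_mem h)
                map_comul := fun x => by
                  simp [f.map_comul, g.map_comul, TensorProduct.map_comp]
                map_d := fun x => by simp [f.map_d, g.map_d] }

/-! ### The convolution dg Lie algebra -/

namespace GrMod
variable {k : Type u} [Field k]

/-- The subspace of linear maps of degree `p`. -/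
def homGr (V W : GrMod k) (p : ℤ) : Submodule k (V →ₗ[k] W) where
  carrier := {f | IsHom V W p f}
  add_mem' hf hg n x hx := Submodule.add_mem _ (hf n x hx) (hg n x hx)
  zero_mem' _ _ _ := Submodule.zero_mem _
  smul_mem' c _ hf n x hx := Submodule.smul_mem _ c (hf n x hx)

theorem mem_homGr {V W : GrMod k} {p : ℤ} {f : V →ₗ[k] W} : f ∈ homGr V W p ↔ IsHom V W p f :=
  Iff.rfl

/-- The space of finite sums of homogeneous linear maps. -/
def homTotal (V W : GrMod k) : Submodule k (V →ₗ[k] W) := ⨆ p, homGr V W p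

theorem homTotal_le {V W : GrMod k} {P : Submodule k (V →ₗ[k] W)}
    (h : ∀ p, ∀ f, IsHom V W p f → f ∈ P) : homTotal V W ≤ P :=
  iSup_le fun p f hf => h p f hf

theorem IsHom.mem_homTotal {V W : GrMod k} {p : ℤ} {f : V →ₗ[k] W} (hf : IsHom V W p f) :
    f ∈ homTotal V W := Submodule.mem_iSup_of_mem p hf

/-- The commutator with the degree operators. -/
noncomputable def homEuler (V W : GrMod k) : (V →ₗ[k] W) →ₗ[k] (V →ₗ[k] W) :=
  LinearMap.llcomp k V W W (W.scale fun n => (n : k)) -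
    (LinearMap.llcomp k V V W).flip (V.scale fun n => (n : k))

theorem homEuler_apply {V W : GrMod k} {p : ℤ} {f : V →ₗ[k] W} (hf : IsHom V W p f) :
    homEuler V W f = (p : k) • f := by
  refine V.ext_gr fun n x hx => ?_
  simp [homEuler, V.scale_apply _ hx, W.scale_apply _ (hf n x hx), ← sub_smul]

/-- The internal hom of graded vector spaces: the degree `p` part consists of the linear maps of
degree `p`. -/
def hom [CharZero k] (V W : GrMod k) : GrMod k where
  carrier := homTotal V W
  gr p := (homGr V W p).comap (homTotal V W).subtype
  isInternal := by
    have hE : ∀ f ∈ homTotal V W, homEuler V W f ∈ homTotal V W := by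
      change homTotal V W ≤ (homTotal V W).comap (homEuler V W)
      refine homTotal_le fun p f hf => ?_
      rw [Submodule.mem_comap, homEuler_apply hf]
      exact Submodule.smul_mem _ _ hf.mem_homTotal
    refine isInternal_of_euler ((homEuler V W).restrict hE) ?_ ?_
    · intro n f hf
      ext1
      exact homEuler_apply hf
    · rw [eq_top_iff]
      rintro ⟨f, hf⟩ -
      have : homTotal V W ≤ (⨆ p, (homGr V W p).comap (homTotal V W).subtype).map
          (homTotal V W).subtype := by
        refine homTotal_le fun p f hf => ?_
        exact ⟨⟨f, hf.mem_homTotal⟩, Submodule.mem_iSup_of_mem p hf, rfl⟩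
      obtain ⟨g, hg, h⟩ := this hf
      have : g = ⟨f, hf⟩ := Subtype.ext h
      exact this ▸ hg

/-- The tensor product of linear maps with the Koszul sign rule
`(f ⊗ h)(x ⊗ y) = (-1)^{|h||x|} f(x) ⊗ h(y)`. Here `σ ∘ h ∘ σ` is `(-1)^{|h|} h`. -/
noncomputable def koszulMap {V V' W W' : GrMod k} (f : V →ₗ[k] V') (h : W →ₗ[k] W') :
    (V ⊗[k] W) →ₗ[k] (V' ⊗[k] W') :=
  TensorProduct.map (f ∘ₗ V.even) h + TensorProduct.map (f ∘ₗ V.odd) (W'.sigma ∘ₗ h ∘ₗ W.sigma)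

theorem sigma_conj {V W : GrMod k} {p : ℤ} {f : V →ₗ[k] W} (hf : IsHom V W p f) :
    W.sigma ∘ₗ f ∘ₗ V.sigma = (sg p : k) • f := by
  ext x
  simp [hf.sigma_comm, sigma_sigma]

theorem koszulMap_eq {V V' W W' : GrMod k} (f : V →ₗ[k] V') {h : W →ₗ[k] W'} {p : ℤ}
    (hh : IsHom W W' p h) :
    koszulMap f h = TensorProduct.map (f ∘ₗ V.scale fun n => sg (p * n)) h := by
  apply TensorProduct.ext
  refine V.ext_gr fun n x hx => ?_
  ext y
  have := V.parity_apply ((TensorProduct.mk k V' W').flip (h y) ∘ₗ f)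
    ((TensorProduct.mk k V' W').flip ((sg p : k) • h y) ∘ₗ f) hx
  simp only [LinearMap.comp_apply, LinearMap.flip_apply, TensorProduct.mk_apply] at this
  rw [koszulMap, sigma_conj hh]
  change f (V.even x) ⊗ₜ[k] h y + f (V.odd x) ⊗ₜ[k] ((sg p : k) • h y) =
    f (V.scale (fun n => sg (p * n)) x) ⊗ₜ[k] h y
  rw [this, V.scale_apply _ hx, map_smul]
  split_ifs with h
  · rw [sg_even (h.mul_left p), one_smul]
  · rw [← TensorProduct.smul_tmul]
    congr 2
    apply sg_congr
    simp only [Int.even_sub, Int.even_mul]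
    tauto

theorem koszulMap_apply {V V' W W' : GrMod k} (f : V →ₗ[k] V') {h : W →ₗ[k] W'} {p n : ℤ}
    (hh : IsHom W W' p h) {x : V} (hx : x ∈ V.gr n) (y : W) :
    koszulMap f h (x ⊗ₜ y) = (sg (p * n) : k) • (f x ⊗ₜ[k] h y) := by
  simp [koszulMap_eq f hh, V.scale_apply _ hx, TensorProduct.smul_tmul']

end GrMod

section convolution
variable {k : Type u} [Field k]

/-- The convolution bracket `[f, h] = [-,-] ∘ (f ⊗ h) ∘ Δ`, with the Koszul sign rule. -/
noncomputable def convBracket (C : GrCoalg k) (g : GrLie k) :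
    (C.carrier →ₗ[k] g.carrier) →ₗ[k] (C.carrier →ₗ[k] g.carrier) →ₗ[k]
      (C.carrier →ₗ[k] g.carrier) :=
  LinearMap.mk₂ k
    (fun f h => TensorProduct.lift g.bracket ∘ₗ
      GrMod.koszulMap (V := C.toGrMod) (V' := g.toGrMod) (W := C.toGrMod) (W' := g.toGrMod) f h ∘ₗ
        C.comul)
    (fun f f' h => by
      simp only [GrMod.koszulMap, LinearMap.add_comp, LinearMap.comp_add, TensorProduct.map_add_left]
      abel)
    (fun c f h => by
      simp only [GrMod.koszulMap, LinearMap.smul_comp, LinearMap.comp_smul,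
        TensorProduct.map_smul_left, LinearMap.add_comp, LinearMap.comp_add, smul_add])
    (fun f h h' => by
      simp only [GrMod.koszulMap, LinearMap.add_comp, LinearMap.comp_add,
        TensorProduct.map_add_right]
      abel)
    (fun c f h => by
      simp only [GrMod.koszulMap, LinearMap.smul_comp, LinearMap.comp_smul,
        TensorProduct.map_smul_right, LinearMap.add_comp, LinearMap.comp_add, smul_add])

/-- The bracket after the tensor product of two maps. -/
noncomputable def convAux (C : GrCoalg k) (g : GrLie k) (f h : C.carrier →ₗ[k] g.carrier) :
    (C.carrier ⊗[k] C.carrier) →ₗ[k] g.carrier :=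
  TensorProduct.lift g.bracket ∘ₗ
      GrMod.koszulMap (V := C.toGrMod) (V' := g.toGrMod) (W := C.toGrMod) (W' := g.toGrMod) f h

theorem convBracket_eq (C : GrCoalg k) (g : GrLie k) (f h : C.carrier →ₗ[k] g.carrier) :
    convBracket C g f h = convAux C g f h ∘ₗ C.comul := rfl

variable {C : GrCoalg k} {g : GrLie k}

theorem convAux_eq (f : C.carrier →ₗ[k] g.carrier) {h : C.carrier →ₗ[k] g.carrier} {p : ℤ}
    (hh : GrMod.IsHom C.toGrMod g.toGrMod p h) :
    convAux C g f h = TensorProduct.lift g.bracket ∘ₗ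
      TensorProduct.map (f ∘ₗ C.scale fun n => sg (p * n)) h := by
  rw [convAux, GrMod.koszulMap_eq f hh]

theorem convAux_apply (f : C.carrier →ₗ[k] g.carrier) {h : C.carrier →ₗ[k] g.carrier} {p n : ℤ}
    (hh : GrMod.IsHom C.toGrMod g.toGrMod p h) {x : C.carrier} (hx : x ∈ C.gr n) (y : C.carrier) :
    convAux C g f h (x ⊗ₜ y) = (sg (p * n) : k) • g.bracket (f x) (h y) := by
  simp [convAux, GrMod.koszulMap_apply f hh hx]

theorem convBracket_mem {f h : C.carrier →ₗ[k] g.carrier} {m n : ℤ}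
    (hf : GrMod.IsHom C.toGrMod g.toGrMod m f) (hh : GrMod.IsHom C.toGrMod g.toGrMod n h) :
    GrMod.IsHom C.toGrMod g.toGrMod (m + n) (convBracket C g f h) := by
  intro i c hc
  have : GrMod.tensorGr C.toGrMod C.toGrMod i ≤ (g.gr (i + (m + n))).comap (convAux C g f h) := by
    refine Submodule.span_le.2 ?_
    rintro _ ⟨a, b, x, y, hx, hy, rfl, rfl⟩
    simp only [SetLike.mem_coe, Submodule.mem_comap]
    rw [convAux_apply f hh hx]
    have := g.bracket_mem (hf _ _ hx) (hh _ _ hy)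
    rw [show a + m + (b + n) = a + b + (m + n) by ring] at this
    exact Submodule.smul_mem _ _ this
  exact this (C.comul_mem hc)

theorem convBracket_anti {f h : C.carrier →ₗ[k] g.carrier} {m n : ℤ}
    (hf : GrMod.IsHom C.toGrMod g.toGrMod m f) (hh : GrMod.IsHom C.toGrMod g.toGrMod n h) :
    convBracket C g f h = -((sg (m * n) : k) • convBracket C g h f) := by
  have key : convAux C g f h =
      -((sg (m * n) : k) • convAux C g h f ∘ₗ GrMod.braid C.toGrMod C.toGrMod) := by
    refine GrMod.ext_gr₂ C.toGrMod C.toGrMod fun i j x hx y hy => ?_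
    simp only [LinearMap.neg_apply, LinearMap.smul_apply, LinearMap.comp_apply,
      GrMod.braid_apply _ _ hx hy, map_smul, convAux_apply f hh hx, convAux_apply h hf hy]
    rw [g.bracket_anti (hf _ _ hx) (hh _ _ hy)]
    simp only [smul_neg, smul_smul, ← sg_add]
    congr 2
    apply sg_congr
    simp only [Int.even_sub, Int.even_add, Int.even_mul]
    tauto
  rw [convBracket_eq, convBracket_eq, key]
  conv_rhs => rw [← C.cocomm]
  rfl

theorem comul_scale (C : GrCoalg k) (p : ℤ) :
    C.comul ∘ₗ C.scale (fun n => sg (p * n)) =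
      TensorProduct.map (C.scale fun n => sg (p * n)) (C.scale fun n => sg (p * n)) ∘ₗ C.comul := by
  refine C.ext_gr fun n c hc => ?_
  simp only [LinearMap.comp_apply, C.scale_apply _ hc, map_smul]
  have : GrMod.tensorGr C.toGrMod C.toGrMod n ≤ LinearMap.eqLocus
      ((sg (p * n) : k) • LinearMap.id)
      (TensorProduct.map (C.scale fun n => sg (p * n)) (C.scale fun n => sg (p * n))) := by
    refine Submodule.span_le.2 ?_
    rintro _ ⟨a, b, x, y, hx, hy, rfl, rfl⟩
    change (sg (p * (a + b)) : k) • (x ⊗ₜ[k] y) = (C.scale _ x) ⊗ₜ[k] (C.scale _ y)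
    rw [C.scale_apply _ hx, C.scale_apply _ hy, TensorProduct.smul_tmul_smul, mul_add, sg_add]
  exact this (C.comul_mem hc)

/-- The exchange of the first two factors, with signs. -/
noncomputable def braid₁₂ (V : GrMod k) : (V ⊗[k] (V ⊗[k] V)) →ₗ[k] (V ⊗[k] (V ⊗[k] V)) :=
  (TensorProduct.assoc k V V V).toLinearMap ∘ₗ (GrMod.braid V V).rTensor V ∘ₗ
    (TensorProduct.assoc k V V V).symm.toLinearMap

theorem braid₁₂_comul (C : GrCoalg k) (c : C.carrier) :
    braid₁₂ C.toGrMod (C.comul.lTensor C.carrier (C.comul c)) =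
      C.comul.lTensor C.carrier (C.comul c) := by
  have h := LinearMap.congr_fun C.coassoc c
  simp only [LinearMap.comp_apply, LinearEquiv.coe_coe] at h
  rw [← h]
  simp only [braid₁₂, LinearMap.comp_apply, LinearEquiv.coe_coe, LinearEquiv.symm_apply_apply]
  rw [← LinearMap.rTensor_comp_apply, C.cocomm]

theorem convBracket_right (a : C.carrier →ₗ[k] g.carrier) {b c : C.carrier →ₗ[k] g.carrier}
    {q r : ℤ} (hb : GrMod.IsHom C.toGrMod g.toGrMod q b)
    (hc : GrMod.IsHom C.toGrMod g.toGrMod r c) (x : C.carrier) :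
    convBracket C g a (convBracket C g b c) x = TensorProduct.lift g.bracket
      (TensorProduct.map (a ∘ₗ C.scale fun n => sg ((q + r) * n)) (convAux C g b c)
        (C.comul.lTensor C.carrier (C.comul x))) := by
  rw [convBracket_eq C g a, convAux_eq a (convBracket_mem hb hc), convBracket_eq C g b,
    ← LinearMap.map_comp_lTensor]
  rfl

theorem convBracket_left (a b : C.carrier →ₗ[k] g.carrier) {c : C.carrier →ₗ[k] g.carrier}
    {p : ℤ} (hc : GrMod.IsHom C.toGrMod g.toGrMod p c) (x : C.carrier) :
    convBracket C g (convBracket C g a b) c x = TensorProduct.lift g.bracket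
      (TensorProduct.map (convAux C g a b ∘ₗ TensorProduct.map (C.scale fun n => sg (p * n))
          (C.scale fun n => sg (p * n))) c
        ((TensorProduct.assoc k C.carrier C.carrier C.carrier).symm
          (C.comul.lTensor C.carrier (C.comul x)))) := by
  have h := LinearMap.congr_fun C.coassoc x
  simp only [LinearMap.comp_apply, LinearEquiv.coe_coe] at h
  have e : (convAux C g a b ∘ₗ TensorProduct.map (C.scale fun n => sg (p * n))
      (C.scale fun n => sg (p * n))) ∘ₗ C.comul =
      (convAux C g a b ∘ₗ C.comul) ∘ₗ C.scale fun n => sg (p * n) := by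
    rw [LinearMap.comp_assoc, LinearMap.comp_assoc, comul_scale]
  rw [convBracket_eq C g _ c, convAux_eq _ hc, ← h, convBracket_eq C g a,
    LinearEquiv.symm_apply_apply, ← LinearMap.comp_apply (TensorProduct.map _ _),
    LinearMap.map_comp_rTensor, e]
  rfl

theorem convBracket_jacobi_aux {f₁ f₂ f₃ : C.carrier →ₗ[k] g.carrier} {m n p : ℤ}
    (h₁ : GrMod.IsHom C.toGrMod g.toGrMod m f₁) (h₂ : GrMod.IsHom C.toGrMod g.toGrMod n f₂)
    (h₃ : GrMod.IsHom C.toGrMod g.toGrMod p f₃) :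
    TensorProduct.lift g.bracket ∘ₗ
      TensorProduct.map (f₁ ∘ₗ C.scale fun i => sg ((n + p) * i)) (convAux C g f₂ f₃) =
    TensorProduct.lift g.bracket ∘ₗ
      TensorProduct.map (convAux C g f₁ f₂ ∘ₗ TensorProduct.map (C.scale fun i => sg (p * i))
          (C.scale fun i => sg (p * i))) f₃ ∘ₗ
        (TensorProduct.assoc k C.carrier C.carrier C.carrier).symm.toLinearMap +
    (sg (m * n) : k) • (TensorProduct.lift g.bracket ∘ₗ
      TensorProduct.map (f₂ ∘ₗ C.scale fun i => sg ((m + p) * i)) (convAux C g f₁ f₃)) ∘ₗ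
        braid₁₂ C.toGrMod := by
  refine GrMod.ext_gr₃ C.toGrMod C.toGrMod C.toGrMod fun i j l x hx y hy z hz => ?_
  have e₁ : convAux C g f₂ f₃ (y ⊗ₜ z) = _ := convAux_apply f₂ h₃ hy z
  have e₂ : convAux C g f₁ f₃ (x ⊗ₜ z) = _ := convAux_apply f₁ h₃ hx z
  have e₃ : convAux C g f₁ f₂ (x ⊗ₜ y) = _ := convAux_apply f₁ h₂ hx y
  have e₄ : braid₁₂ C.toGrMod (x ⊗ₜ (y ⊗ₜ z)) = (sg (i * j) : k) • (y ⊗ₜ (x ⊗ₜ z)) := by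
    simp only [braid₁₂, LinearMap.comp_apply, LinearEquiv.coe_coe, TensorProduct.assoc_symm_tmul,
      LinearMap.rTensor_tmul, GrMod.braid_apply _ _ hx hy, ← TensorProduct.smul_tmul', map_smul,
      TensorProduct.assoc_tmul]
  simp only [LinearMap.comp_apply, LinearMap.add_apply, LinearMap.smul_apply, e₄, map_smul,
    LinearEquiv.coe_coe, TensorProduct.assoc_symm_tmul, TensorProduct.map_tmul,
    TensorProduct.lift.tmul, C.scale_apply _ hx, C.scale_apply _ hy, e₁, e₂,
    TensorProduct.smul_tmul_smul, e₃]
  rw [g.jacobi (h₁ _ _ hx) (h₂ _ _ hy) (h₃ _ _ hz)]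
  simp only [smul_add, smul_smul, ← sg_add]
  refine congrArg₂ (· + ·) (congrArg (· • _) (sg_congr ?_)) (congrArg (· • _) (sg_congr ?_))
  · clear e₁ e₂ e₃ e₄
    simp only [Int.even_sub, Int.even_add, Int.even_mul]
    grind
  · clear e₁ e₂ e₃ e₄
    simp only [Int.even_sub, Int.even_add, Int.even_mul]
    grind

theorem convBracket_jacobi {f₁ f₂ f₃ : C.carrier →ₗ[k] g.carrier} {m n p : ℤ}
    (h₁ : GrMod.IsHom C.toGrMod g.toGrMod m f₁) (h₂ : GrMod.IsHom C.toGrMod g.toGrMod n f₂)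
    (h₃ : GrMod.IsHom C.toGrMod g.toGrMod p f₃) :
    convBracket C g f₁ (convBracket C g f₂ f₃) =
      convBracket C g (convBracket C g f₁ f₂) f₃ +
        (sg (m * n) : k) • convBracket C g f₂ (convBracket C g f₁ f₃) := by
  ext x
  have h := LinearMap.congr_fun (convBracket_jacobi_aux h₁ h₂ h₃)
    (C.comul.lTensor C.carrier (C.comul x))
  rw [LinearMap.add_apply, LinearMap.smul_apply, convBracket_right _ h₂ h₃,
    convBracket_left _ _ h₃, convBracket_right _ h₁ h₃]
  simpa only [LinearMap.add_apply, LinearMap.smul_apply, LinearMap.comp_apply,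
    braid₁₂_comul, LinearEquiv.coe_coe] using h

end convolution

section convolutionLie
variable {k : Type u} [Field k]

theorem convBracket_mem_homTotal {C : GrCoalg k} {g : GrLie k} {f h : C.carrier →ₗ[k] g.carrier}
    (hf : f ∈ GrMod.homTotal C.toGrMod g.toGrMod) (hh : h ∈ GrMod.homTotal C.toGrMod g.toGrMod) :
    convBracket C g f h ∈ GrMod.homTotal C.toGrMod g.toGrMod := by
  have h₁ : GrMod.homTotal C.toGrMod g.toGrMod ≤
      (GrMod.homTotal C.toGrMod g.toGrMod).comap ((convBracket C g).flip h) := by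
    refine GrMod.homTotal_le fun m f hf => ?_
    have h₂ : GrMod.homTotal C.toGrMod g.toGrMod ≤
        (GrMod.homTotal C.toGrMod g.toGrMod).comap (convBracket C g f) :=
      GrMod.homTotal_le fun n h hh => (convBracket_mem hf hh).mem_homTotal
    exact h₂ hh
  exact h₁ hf

/-- The convolution bracket on the internal hom. -/
noncomputable def convBracketTotal (C : GrCoalg k) (g : GrLie k) :
    GrMod.homTotal C.toGrMod g.toGrMod →ₗ[k] GrMod.homTotal C.toGrMod g.toGrMod →ₗ[k]
      GrMod.homTotal C.toGrMod g.toGrMod :=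
  LinearMap.mk₂ k
    (fun f h => ⟨convBracket C g f.1 h.1, convBracket_mem_homTotal f.2 h.2⟩)
    (fun f f' h => by ext1; simp) (fun c f h => by ext1; simp)
    (fun f h h' => by ext1; simp) (fun c f h => by ext1; simp)

/-- The graded convolution Lie algebra. -/
noncomputable def convGrLie [CharZero k] (C : GrCoalg k) (g : GrLie k) : GrLie k where
  toGrMod := GrMod.hom C.toGrMod g.toGrMod
  bracket := convBracketTotal C g
  bracket_mem hf hh := convBracket_mem hf hh
  bracket_anti hf hh := Subtype.ext (convBracket_anti hf hh)
  jacobi h₁ h₂ h₃ := Subtype.ext (convBracket_jacobi h₁ h₂ h₃)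

/-- The differential `f ↦ d f - (-1)^|f| f d` of the internal hom. -/
noncomputable def convD (C : DGCoalg k) (g : DGLie k) :
    (C.carrier →ₗ[k] g.carrier) →ₗ[k] (C.carrier →ₗ[k] g.carrier) where
  toFun f := g.d ∘ₗ f - (g.sigma ∘ₗ f ∘ₗ C.sigma) ∘ₗ C.d
  map_add' f f' := by
    simp only [LinearMap.comp_add, LinearMap.add_comp]
    abel
  map_smul' c f := by
    simp only [LinearMap.comp_smul, LinearMap.smul_comp, smul_sub, RingHom.id_apply]

variable {C : DGCoalg k} {g : DGLie k}

theorem convD_eq {f : C.carrier →ₗ[k] g.carrier} {p : ℤ}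
    (hf : GrMod.IsHom C.toGrMod g.toGrMod p f) :
    convD C g f = g.d ∘ₗ f - (sg p : k) • f ∘ₗ C.d := by
  change g.d ∘ₗ f - (g.sigma ∘ₗ f ∘ₗ C.sigma) ∘ₗ C.d = _
  rw [GrMod.sigma_conj hf, LinearMap.smul_comp]

theorem convD_mem {f : C.carrier →ₗ[k] g.carrier} {p : ℤ}
    (hf : GrMod.IsHom C.toGrMod g.toGrMod p f) :
    GrMod.IsHom C.toGrMod g.toGrMod (p - 1) (convD C g f) := by
  intro n x hx
  rw [convD_eq hf]
  have h₁ := g.d_mem (hf _ _ hx)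
  have h₂ := hf _ _ (C.d_mem hx)
  rw [show n + p - 1 = n + (p - 1) by ring] at h₁
  rw [show n - 1 + p = n + (p - 1) by ring] at h₂
  exact Submodule.sub_mem _ h₁ (Submodule.smul_mem _ _ h₂)

theorem convD_mem_homTotal {f : C.carrier →ₗ[k] g.carrier}
    (hf : f ∈ GrMod.homTotal C.toGrMod g.toGrMod) :
    convD C g f ∈ GrMod.homTotal C.toGrMod g.toGrMod := by
  have h : GrMod.homTotal C.toGrMod g.toGrMod ≤
      (GrMod.homTotal C.toGrMod g.toGrMod).comap (convD C g) :=
    GrMod.homTotal_le fun n h hh => (convD_mem hh).mem_homTotal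
  exact h hf

theorem convD_convD {f : C.carrier →ₗ[k] g.carrier}
    (hf : f ∈ GrMod.homTotal C.toGrMod g.toGrMod) : convD C g (convD C g f) = 0 := by
  have h : GrMod.homTotal C.toGrMod g.toGrMod ≤ LinearMap.ker (convD C g ∘ₗ convD C g) := by
    refine GrMod.homTotal_le fun p f hf => ?_
    rw [LinearMap.mem_ker, LinearMap.comp_apply, convD_eq (convD_mem hf), convD_eq hf]
    ext x
    simp [g.d_d, C.d_d, sg_add, sub_eq_add_neg, sg_neg_one]
  exact h hf

theorem convD_leibniz_aux {f h : C.carrier →ₗ[k] g.carrier} {m n : ℤ}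
    (hf : GrMod.IsHom C.toGrMod g.toGrMod m f) (hh : GrMod.IsHom C.toGrMod g.toGrMod n h) :
    g.d ∘ₗ convAux C.toGrCoalg g.toGrLie f h - (sg (m + n) : k) •
      convAux C.toGrCoalg g.toGrLie f h ∘ₗ
        (TensorProduct.map C.d LinearMap.id + TensorProduct.map C.sigma C.d) =
    convAux C.toGrCoalg g.toGrLie (convD C g f) h +
      (sg m : k) • convAux C.toGrCoalg g.toGrLie f (convD C g h) := by
  refine GrMod.ext_gr₂ C.toGrMod C.toGrMod fun i j x hx y hy => ?_
  have e₁ : convAux C.toGrCoalg g.toGrLie f h (x ⊗ₜ y) = _ := convAux_apply f hh hx y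
  have e₂ : convAux C.toGrCoalg g.toGrLie f h (C.d x ⊗ₜ y) = _ := convAux_apply f hh (C.d_mem hx) y
  have e₃ : convAux C.toGrCoalg g.toGrLie f h (x ⊗ₜ C.d y) = _ := convAux_apply f hh hx (C.d y)
  have e₄ : convAux C.toGrCoalg g.toGrLie (convD C g f) h (x ⊗ₜ y) = _ :=
    convAux_apply (convD C g f) hh hx y
  have e₅ : convAux C.toGrCoalg g.toGrLie f (convD C g h) (x ⊗ₜ y) = _ :=
    convAux_apply f (convD_mem hh) hx y
  simp only [LinearMap.sub_apply, LinearMap.add_apply, LinearMap.smul_apply, LinearMap.comp_apply,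
    TensorProduct.map_tmul, LinearMap.id_apply, map_add, e₁, e₂, C.sigma_apply hx,
    ← TensorProduct.smul_tmul', map_smul, e₃, e₄, e₅]
  rw [g.leibniz (hf _ _ hx), convD_eq hf, convD_eq hh]
  simp only [LinearMap.sub_apply, LinearMap.smul_apply, LinearMap.comp_apply, map_sub, map_smul,
    smul_add, smul_sub, smul_smul, ← sg_add]
  rw [sg_congr (k := k) (m := m + n + n * (i - 1)) (n := n * i + m) (by grind),
    sg_congr (k := k) (m := m + n + (i + n * i)) (n := m + ((n - 1) * i + n)) (by grind),
    sg_congr (k := k) (m := n * i + (i + m)) (n := m + (n - 1) * i) (by grind)]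
  abel

theorem convD_leibniz {f h : C.carrier →ₗ[k] g.carrier} {m : ℤ}
    (hf : GrMod.IsHom C.toGrMod g.toGrMod m f) (hh : h ∈ GrMod.homTotal C.toGrMod g.toGrMod) :
    convD C g (convBracket C.toGrCoalg g.toGrLie f h) =
      convBracket C.toGrCoalg g.toGrLie (convD C g f) h +
        (sg m : k) • convBracket C.toGrCoalg g.toGrLie f (convD C g h) := by
  have key : GrMod.homTotal C.toGrMod g.toGrMod ≤ LinearMap.eqLocus
      (convD C g ∘ₗ convBracket C.toGrCoalg g.toGrLie f)
      (convBracket C.toGrCoalg g.toGrLie (convD C g f) +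
        (sg m : k) • convBracket C.toGrCoalg g.toGrLie f ∘ₗ convD C g) := by
    refine GrMod.homTotal_le fun n h hh => ?_
    rw [LinearMap.mem_eqLocus, LinearMap.comp_apply, convD_eq (convBracket_mem hf hh)]
    have h₁ := congrArg (· ∘ₗ C.comul) (convD_leibniz_aux hf hh)
    simp only [LinearMap.sub_comp, LinearMap.add_comp, LinearMap.smul_comp] at h₁
    simp only [LinearMap.add_apply, LinearMap.smul_apply, LinearMap.comp_apply]
    rw [convBracket_eq, convBracket_eq, convBracket_eq, LinearMap.comp_assoc, C.coder, ← h₁]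
    rfl
  exact key hh

/-- The convolution dg Lie algebra `{C, g}`. -/
noncomputable def conv [CharZero k] (C : DGCoalg k) (g : DGLie k) : DGLie k where
  toGrLie := convGrLie C.toGrCoalg g.toGrLie
  d := (convD C g).restrict fun _ hf => convD_mem_homTotal hf
  d_mem hf := convD_mem hf
  d_d f := Subtype.ext (convD_convD f.2)
  leibniz hf h := Subtype.ext (convD_leibniz hf h.2)

/-- Pre- and postcomposition with morphisms. -/
noncomputable def convMap {C D : DGCoalg k} {g h : DGLie k} (φ : D ⟶ C) (ψ : g ⟶ h) :
    (C.carrier →ₗ[k] g.carrier) →ₗ[k] (D.carrier →ₗ[k] h.carrier) :=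
  LinearMap.llcomp k D.carrier g.carrier h.carrier ψ.map ∘ₗ
    (LinearMap.llcomp k D.carrier C.carrier g.carrier).flip φ.map

theorem convMap_mem {C D : DGCoalg k} {g h : DGLie k} (φ : D ⟶ C) (ψ : g ⟶ h)
    {f : C.carrier →ₗ[k] g.carrier} {p : ℤ} (hf : GrMod.IsHom C.toGrMod g.toGrMod p f) :
    GrMod.IsHom D.toGrMod h.toGrMod p (convMap φ ψ f) :=
  fun n _ hx => ψ.map_mem (hf n _ (φ.map_mem hx))

theorem convBracket_natural {C D : GrCoalg k} {g h : GrLie k} {φ : D.carrier →ₗ[k] C.carrier}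
    (hφ : ∀ {n x}, x ∈ D.gr n → φ x ∈ C.gr n)
    (hφΔ : ∀ x, C.comul (φ x) = TensorProduct.map φ φ (D.comul x))
    {ψ : g.carrier →ₗ[k] h.carrier} (hψ : ∀ {n x}, x ∈ g.gr n → ψ x ∈ h.gr n)
    (hψb : ∀ x y, ψ (g.bracket x y) = h.bracket (ψ x) (ψ y))
    (f₁ : C.carrier →ₗ[k] g.carrier) {f₂ : C.carrier →ₗ[k] g.carrier} {p : ℤ}
    (h₂ : GrMod.IsHom C.toGrMod g.toGrMod p f₂) :
    ψ ∘ₗ convBracket C g f₁ f₂ ∘ₗ φ = convBracket D h (ψ ∘ₗ f₁ ∘ₗ φ) (ψ ∘ₗ f₂ ∘ₗ φ) := by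
  have h₃ : GrMod.IsHom D.toGrMod h.toGrMod p (ψ ∘ₗ f₂ ∘ₗ φ) :=
    fun n x hx => hψ (h₂ n _ (hφ hx))
  have aux : ψ ∘ₗ convAux C g f₁ f₂ ∘ₗ TensorProduct.map φ φ =
      convAux D h (ψ ∘ₗ f₁ ∘ₗ φ) (ψ ∘ₗ f₂ ∘ₗ φ) := by
    refine GrMod.ext_gr₂ D.toGrMod D.toGrMod fun i j x hx y hy => ?_
    have e₁ : convAux C g f₁ f₂ (φ x ⊗ₜ φ y) = _ := convAux_apply f₁ h₂ (hφ hx) (φ y)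
    have e₂ : convAux D h (ψ ∘ₗ f₁ ∘ₗ φ) (ψ ∘ₗ f₂ ∘ₗ φ) (x ⊗ₜ y) = _ :=
      convAux_apply (ψ ∘ₗ f₁ ∘ₗ φ) h₃ hx y
    simp only [LinearMap.comp_apply, TensorProduct.map_tmul, e₁, e₂, map_smul, hψb]
  rw [convBracket_eq D h, ← aux]
  refine LinearMap.ext fun x => ?_
  change ψ (convAux C g f₁ f₂ (C.comul (φ x))) = _
  rw [hφΔ]
  rfl

theorem convMap_bracket {C D : DGCoalg k} {g h : DGLie k} (φ : D ⟶ C) (ψ : g ⟶ h)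
    (f₁ : C.carrier →ₗ[k] g.carrier) {f₂ : C.carrier →ₗ[k] g.carrier}
    (h₂ : f₂ ∈ GrMod.homTotal C.toGrMod g.toGrMod) :
    convMap φ ψ (convBracket C.toGrCoalg g.toGrLie f₁ f₂) =
      convBracket D.toGrCoalg h.toGrLie (convMap φ ψ f₁) (convMap φ ψ f₂) := by
  have key : GrMod.homTotal C.toGrMod g.toGrMod ≤ LinearMap.eqLocus
      (convMap φ ψ ∘ₗ convBracket C.toGrCoalg g.toGrLie f₁)
      (convBracket D.toGrCoalg h.toGrLie (convMap φ ψ f₁) ∘ₗ convMap φ ψ) :=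
    GrMod.homTotal_le fun p f hf =>
      convBracket_natural (C := C.toGrCoalg) (D := D.toGrCoalg) (g := g.toGrLie) (h := h.toGrLie)
        φ.map_mem φ.map_comul ψ.map_mem ψ.map_bracket f₁ hf
  exact key h₂

theorem convMap_d {C D : DGCoalg k} {g h : DGLie k} (φ : D ⟶ C) (ψ : g ⟶ h)
    {f : C.carrier →ₗ[k] g.carrier} (hf : f ∈ GrMod.homTotal C.toGrMod g.toGrMod) :
    convMap φ ψ (convD C g f) = convD D h (convMap φ ψ f) := by
  have key : GrMod.homTotal C.toGrMod g.toGrMod ≤ LinearMap.eqLocus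
      (convMap φ ψ ∘ₗ convD C g) (convD D h ∘ₗ convMap φ ψ) := by
    refine GrMod.homTotal_le fun p f hf => ?_
    rw [LinearMap.mem_eqLocus, LinearMap.comp_apply, LinearMap.comp_apply, convD_eq hf,
      convD_eq (convMap_mem φ ψ hf)]
    refine LinearMap.ext fun x => ?_
    change ψ.map (g.d (f (φ.map x)) - (sg p : k) • f (C.d (φ.map x))) =
      h.d (ψ.map (f (φ.map x))) - (sg p : k) • ψ.map (f (φ.map (D.d x)))
    rw [map_sub, map_smul, ψ.map_d, φ.map_d]
  exact key hf

theorem convMap_mem_homTotal {C D : DGCoalg k} {g h : DGLie k} (φ : D ⟶ C) (ψ : g ⟶ h)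
    {f : C.carrier →ₗ[k] g.carrier} (hf : f ∈ GrMod.homTotal C.toGrMod g.toGrMod) :
    convMap φ ψ f ∈ GrMod.homTotal D.toGrMod h.toGrMod := by
  have key : GrMod.homTotal C.toGrMod g.toGrMod ≤
      (GrMod.homTotal D.toGrMod h.toGrMod).comap (convMap φ ψ) :=
    GrMod.homTotal_le fun p f hf => (convMap_mem φ ψ hf).mem_homTotal
  exact key hf

/-- The morphism of convolution algebras `f ↦ ψ ∘ f ∘ φ`. -/
noncomputable def convHom [CharZero k] {C D : DGCoalg k} {g h : DGLie k} (φ : D ⟶ C)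
    (ψ : g ⟶ h) : conv C g ⟶ conv D h where
  map := (convMap φ ψ).restrict fun _ hf => convMap_mem_homTotal φ ψ hf
  map_mem hf := convMap_mem φ ψ hf
  map_bracket f f' := Subtype.ext (convMap_bracket φ ψ f.1 f'.2)
  map_d f := Subtype.ext (convMap_d φ ψ f.2)

/-- The convolution algebra functor `{-, -}`. -/
noncomputable def convFunctor (k : Type u) [Field k] [CharZero k] :
    (DGCoalg k)ᵒᵖ ⥤ DGLie k ⥤ DGLie k where
  obj C :=
    { obj g := conv C.unop g
      map ψ := convHom (𝟙 C.unop) ψ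
      map_id _ := rfl
      map_comp _ _ := rfl }
  map φ := { app g := convHom φ.unop (𝟙 g), naturality _ _ _ := rfl }
  map_id _ := rfl
  map_comp _ _ := rfl

end convolutionLie

/-! ### Free graded Lie algebras -/

namespace FreeLie
variable {k : Type u} [Field k] (V : GrMod k)

/-- The homogeneous elements of `V`, together with a degree. -/
abbrev Gen : Type u := Σ n : ℤ, V.gr n

/-- The degree of a nonassociative monomial in homogeneous elements. -/
def deg : FreeMagma (Gen V) → ℤ
  | .of v => v.1
  | .mul x y => deg x + deg y

theorem deg_mul (x y : FreeMagma (Gen V)) : deg V (x * y) = deg V x + deg V y := rfl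

/-- The nonassociative polynomials: the vector space with basis the nonassociative monomials in
homogeneous elements of `V`. -/
abbrev Poly : Type u := FreeMagma (Gen V) →₀ k

variable {V}

/-- A monomial as a polynomial. -/
noncomputable def mon (x : FreeMagma (Gen V)) : Poly V := Finsupp.single x 1

/-- The product of polynomials. -/
noncomputable def mul : Poly V →ₗ[k] Poly V →ₗ[k] Poly V :=
  Finsupp.lift _ k _ fun x => Finsupp.lmapDomain k k fun y => x * y

theorem mul_mon (x y : FreeMagma (Gen V)) : mul (mon x) (mon y) = mon (x * y) := by
  simp [mul, mon]

theorem poly_induction {P : Poly V → Prop} (f : Poly V) (hmon : ∀ x, P (mon x))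
    (hadd : ∀ f g, P f → P g → P (f + g)) (hsmul : ∀ (c : k) f, P f → P (c • f)) : P f := by
  induction f using Finsupp.induction_linear with
  | zero => simpa using hsmul 0 (mon (.of ⟨0, 0⟩)) (hmon _)
  | add f g hf hg => exact hadd f g hf hg
  | single x c => simpa [mon] using hsmul c _ (hmon x)

/-- The homogeneous relations of the free graded Lie algebra, with their degrees: the generators
depend linearly on the elements of `V`, graded antisymmetry, the graded Jacobi identity, and the
products of these relations with monomials. -/
inductive Relator : ℤ → Poly V → Prop
  | add (n : ℤ) (v w : V.gr n) :
      Relator n (mon (.of ⟨n, v + w⟩) - mon (.of ⟨n, v⟩) - mon (.of ⟨n, w⟩))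
  | smul (n : ℤ) (c : k) (v : V.gr n) :
      Relator n (mon (.of ⟨n, c • v⟩) - c • mon (.of ⟨n, v⟩))
  | anti (x y : FreeMagma (Gen V)) :
      Relator (deg V x + deg V y) (mon (x * y) + (sg (deg V x * deg V y) : k) • mon (y * x))
  | jacobi (x y z : FreeMagma (Gen V)) :
      Relator (deg V x + deg V y + deg V z)
        (mon (x * (y * z)) - mon (x * y * z) - (sg (deg V x * deg V y) : k) • mon (y * (x * z)))
  | left (x : FreeMagma (Gen V)) {n : ℤ} {r : Poly V} :
      Relator n r → Relator (deg V x + n) (mul (mon x) r)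
  | right (x : FreeMagma (Gen V)) {n : ℤ} {r : Poly V} :
      Relator n r → Relator (n + deg V x) (mul r (mon x))

variable (V)

/-- The ideal generated by the relations. -/
noncomputable def ideal : Submodule k (Poly V) := Submodule.span k {r | ∃ n, Relator n r}

/-- The underlying vector space of the free graded Lie algebra on `V`. -/
abbrev Carrier : Type u := Poly V ⧸ ideal V

variable {V}

/-- The class of a monomial. -/
noncomputable def cls (x : FreeMagma (Gen V)) : Carrier V := (ideal V).mkQ (mon x)

theorem carrier_ext {M : Type*} [AddCommGroup M] [Module k M] {f g : Carrier V →ₗ[k] M}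
    (h : ∀ x, f (cls x) = g (cls x)) : f = g := by
  apply Submodule.linearMap_qext
  refine LinearMap.ext fun p => ?_
  induction p using poly_induction with
  | hmon x => exact h x
  | hadd p q hp hq => rw [map_add, map_add, hp, hq]
  | hsmul c p hp => rw [map_smul, map_smul, hp]

theorem mkQ_relator {n : ℤ} {r : Poly V} (hr : Relator n r) : (ideal V).mkQ r = 0 :=
  (Submodule.Quotient.mk_eq_zero _).2 (Submodule.subset_span ⟨n, hr⟩)

theorem mul_mem_right (p : Poly V) {r : Poly V} (hr : r ∈ ideal V) : mul p r ∈ ideal V := by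
  induction p using poly_induction with
  | hmon x =>
    have : ideal V ≤ (ideal V).comap (mul (mon x)) := by
      refine Submodule.span_le.2 ?_
      rintro r ⟨n, hr⟩
      exact Submodule.subset_span ⟨_, hr.left x⟩
    exact this hr
  | hadd p q hp hq => rw [map_add, LinearMap.add_apply]; exact Submodule.add_mem _ hp hq
  | hsmul c p hp => rw [map_smul, LinearMap.smul_apply]; exact Submodule.smul_mem _ c hp

theorem mul_mem_left (p : Poly V) {r : Poly V} (hr : r ∈ ideal V) : mul r p ∈ ideal V := by
  induction p using poly_induction with
  | hmon x =>
    have : ideal V ≤ (ideal V).comap (mul.flip (mon x)) := by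
      refine Submodule.span_le.2 ?_
      rintro r ⟨n, hr⟩
      exact Submodule.subset_span ⟨_, hr.right x⟩
    exact this hr
  | hadd p q hp hq => rw [map_add]; exact Submodule.add_mem _ hp hq
  | hsmul c p hp => rw [map_smul]; exact Submodule.smul_mem _ c hp

variable (V)

/-- The bracket of the free graded Lie algebra. -/
noncomputable def bracket : Carrier V →ₗ[k] Carrier V →ₗ[k] Carrier V :=
  (ideal V).liftQ (((ideal V).liftQ (mul.compr₂ (ideal V).mkQ).flip (by
    intro r hr
    rw [LinearMap.mem_ker]
    refine LinearMap.ext fun p => ?_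
    exact (Submodule.Quotient.mk_eq_zero _).2 (mul_mem_right p hr))).flip) (by
    intro r hr
    rw [LinearMap.mem_ker]
    apply Submodule.linearMap_qext
    refine LinearMap.ext fun p => ?_
    exact (Submodule.Quotient.mk_eq_zero _).2 (mul_mem_left p hr))

variable {V}

theorem bracket_mkQ (p q : Poly V) :
    bracket V ((ideal V).mkQ p) ((ideal V).mkQ q) = (ideal V).mkQ (mul p q) := rfl

theorem bracket_cls (x y : FreeMagma (Gen V)) : bracket V (cls x) (cls y) = cls (x * y) := by
  rw [cls, cls, bracket_mkQ, mul_mon]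
  rfl

variable (V)

/-- The degree `n` part, spanned by the monomials of degree `n`. -/
noncomputable def gr (n : ℤ) : Submodule k (Carrier V) := Submodule.span k {t | ∃ x, deg V x = n ∧ t = cls x}

/-- The operator that multiplies a monomial with its degree. -/
noncomputable def eulerPoly : Poly V →ₗ[k] Poly V :=
  Finsupp.lift _ k _ fun x => (deg V x : k) • mon x

variable {V}

theorem eulerPoly_mon (x : FreeMagma (Gen V)) : eulerPoly V (mon x) = (deg V x : k) • mon x := by
  rw [eulerPoly, mon, Finsupp.lift_apply, Finsupp.sum_single_index (by simp), one_smul]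
  rfl

theorem eulerPoly_mul (p q : Poly V) :
    eulerPoly V (mul p q) = mul (eulerPoly V p) q + mul p (eulerPoly V q) := by
  induction p using poly_induction with
  | hmon x =>
    induction q using poly_induction with
    | hmon y =>
      simp only [mul_mon, eulerPoly_mon, map_smul, LinearMap.smul_apply, ← add_smul]
      rw [deg_mul, Int.cast_add]
    | hadd p q hp hq => simp only [map_add, LinearMap.add_apply, hp, hq]; abel
    | hsmul c p hp => simp only [map_smul, LinearMap.smul_apply, hp, smul_add]
  | hadd p q hp hq => simp only [map_add, LinearMap.add_apply, hp, hq]; abel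
  | hsmul c p hp => simp only [map_smul, LinearMap.smul_apply, hp, smul_add]

theorem eulerPoly_relator {n : ℤ} {r : Poly V} (hr : Relator n r) :
    eulerPoly V r = (n : k) • r := by
  induction hr with
  | add n v w => simp only [map_sub, eulerPoly_mon, smul_sub]; rfl
  | smul n c v =>
    simp only [map_sub, map_smul, eulerPoly_mon, smul_sub, smul_comm (n : k) c]; rfl
  | anti x y =>
    simp only [map_add, map_smul, ← mul_mon, eulerPoly_mul, eulerPoly_mon, LinearMap.smul_apply]
    push_cast
    module
  | jacobi x y z =>
    simp only [map_sub, map_smul, map_add, ← mul_mon, eulerPoly_mul, eulerPoly_mon,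
      LinearMap.smul_apply, LinearMap.add_apply]
    push_cast
    module
  | left x hr ih =>
    simp only [eulerPoly_mul, ih, eulerPoly_mon, map_smul, LinearMap.smul_apply]
    push_cast
    module
  | right x hr ih =>
    simp only [eulerPoly_mul, ih, eulerPoly_mon, map_smul, LinearMap.smul_apply]
    push_cast
    module

/-- The degree operator on the free graded Lie algebra. -/
noncomputable def euler : Carrier V →ₗ[k] Carrier V :=
  (ideal V).mapQ (ideal V) (eulerPoly V) (by
    refine Submodule.span_le.2 ?_
    rintro r ⟨n, hr⟩
    rw [SetLike.mem_coe, Submodule.mem_comap, eulerPoly_relator hr]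
    exact Submodule.smul_mem _ _ (Submodule.subset_span ⟨n, hr⟩))

theorem euler_cls (x : FreeMagma (Gen V)) : euler (cls x) = (deg V x : k) • cls x := by
  change (ideal V).mkQ (eulerPoly V (mon x)) = _
  rw [eulerPoly_mon, map_smul]
  rfl

theorem cls_mem (x : FreeMagma (Gen V)) : cls x ∈ gr V (deg V x) :=
  Submodule.subset_span ⟨x, rfl, rfl⟩

theorem gr_isInternal [CharZero k] : DirectSum.IsInternal (gr V) := by
  refine GrMod.isInternal_of_euler euler ?_ ?_
  · intro n t ht
    have : gr V n ≤ LinearMap.eqLocus euler ((n : k) • LinearMap.id) := by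
      refine Submodule.span_le.2 ?_
      rintro _ ⟨x, rfl, rfl⟩
      exact euler_cls x
    exact this ht
  · have : (⨆ n, gr V n).mkQ = 0 := by
      refine carrier_ext fun x => ?_
      rw [LinearMap.zero_apply, Submodule.mkQ_apply, Submodule.Quotient.mk_eq_zero]
      exact Submodule.mem_iSup_of_mem _ (cls_mem x)
    rw [← Submodule.ker_mkQ (⨆ n, gr V n), this, LinearMap.ker_zero]

theorem gr_le {n : ℤ} {P : Submodule k (Carrier V)} (h : ∀ x, deg V x = n → cls x ∈ P) :
    gr V n ≤ P := by
  refine Submodule.span_le.2 ?_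
  rintro _ ⟨x, hx, rfl⟩
  exact h x hx

theorem gr_bilin {M : Type*} [AddCommGroup M] [Module k M] {m n : ℤ}
    {f g : Carrier V →ₗ[k] Carrier V →ₗ[k] M}
    (h : ∀ x y, deg V x = m → deg V y = n → f (cls x) (cls y) = g (cls x) (cls y))
    {a b : Carrier V} (ha : a ∈ gr V m) (hb : b ∈ gr V n) : f a b = g a b := by
  have h₁ : gr V m ≤ LinearMap.eqLocus (f.flip b) (g.flip b) := gr_le fun x hx => by
    have h₂ : gr V n ≤ LinearMap.eqLocus (f (cls x)) (g (cls x)) := gr_le fun y hy => h x y hx hy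
    exact h₂ hb
  exact h₁ ha

end FreeLie

/-- The free graded Lie algebra on a graded vector space. -/
noncomputable def freeLie {k : Type u} [Field k] [CharZero k] (V : GrMod k) : GrLie k where
  carrier := FreeLie.Carrier V
  gr := FreeLie.gr V
  isInternal := FreeLie.gr_isInternal
  bracket := FreeLie.bracket V
  bracket_mem {m n a b} ha hb := by
    have h₁ : FreeLie.gr V m ≤
        (FreeLie.gr V (m + n)).comap ((FreeLie.bracket V).flip b) := FreeLie.gr_le fun x hx => by
      have h₂ : FreeLie.gr V n ≤ (FreeLie.gr V (m + n)).comap (FreeLie.bracket V (FreeLie.cls x)) :=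
        FreeLie.gr_le fun y hy => by
          subst hx hy
          rw [Submodule.mem_comap, FreeLie.bracket_cls]
          exact FreeLie.cls_mem (x * y)
      exact h₂ hb
    exact h₁ ha
  bracket_anti {m n a b} ha hb := by
    refine FreeLie.gr_bilin (f := FreeLie.bracket V)
      (g := -((sg (m * n) : k) • (FreeLie.bracket V).flip)) ?_ ha hb
    rintro x y rfl rfl
    simp only [LinearMap.neg_apply, LinearMap.smul_apply, LinearMap.flip_apply, FreeLie.bracket_cls]
    rw [← add_eq_zero_iff_eq_neg]
    have := FreeLie.mkQ_relator (FreeLie.Relator.anti x y)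
    rwa [map_add, map_smul] at this
  jacobi {m n p a b c} ha hb hc := by
    have h₁ : FreeLie.gr V m ≤ LinearMap.eqLocus
        ((FreeLie.bracket V).flip (FreeLie.bracket V b c))
        ((FreeLie.bracket V).flip c ∘ₗ (FreeLie.bracket V).flip b +
          (sg (m * n) : k) • FreeLie.bracket V b ∘ₗ (FreeLie.bracket V).flip c) := by
      refine FreeLie.gr_le fun x hx => ?_
      have h₂ : FreeLie.gr V n ≤ LinearMap.eqLocus
          (FreeLie.bracket V (FreeLie.cls x) ∘ₗ (FreeLie.bracket V).flip c)
          ((FreeLie.bracket V).flip c ∘ₗ FreeLie.bracket V (FreeLie.cls x) +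
            (sg (m * n) : k) •
              (FreeLie.bracket V).flip (FreeLie.bracket V (FreeLie.cls x) c)) := by
        refine FreeLie.gr_le fun y hy => ?_
        have h₃ : FreeLie.gr V p ≤ LinearMap.eqLocus
            (FreeLie.bracket V (FreeLie.cls x) ∘ₗ FreeLie.bracket V (FreeLie.cls y))
            (FreeLie.bracket V (FreeLie.bracket V (FreeLie.cls x) (FreeLie.cls y)) +
              (sg (m * n) : k) • FreeLie.bracket V (FreeLie.cls y) ∘ₗ
                FreeLie.bracket V (FreeLie.cls x)) := by
          refine FreeLie.gr_le fun z _ => ?_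
          subst hx hy
          simp only [LinearMap.mem_eqLocus, LinearMap.comp_apply, LinearMap.add_apply,
            LinearMap.smul_apply, FreeLie.bracket_cls]
          have := FreeLie.mkQ_relator (FreeLie.Relator.jacobi x y z)
          rwa [map_sub, map_sub, map_smul, sub_sub, sub_eq_zero] at this
        exact h₃ hc
      exact h₂ hb
    exact h₁ ha

section freeLie
variable {k : Type u} [Field k] {V : GrMod k}

namespace FreeLie

variable {M : GrLie k}

/-- The value on a monomial of the morphism that extends `φ`. -/
noncomputable def liftMon (φ : V →ₗ[k] M.carrier) : FreeMagma (Gen V) → M.carrier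
  | .of v => φ v.2.1
  | .mul x y => M.bracket (liftMon φ x) (liftMon φ y)

/-- The value on a polynomial of the morphism that extends `φ`. -/
noncomputable def liftPoly (φ : V →ₗ[k] M.carrier) : Poly V →ₗ[k] M.carrier :=
  Finsupp.lift _ k _ (liftMon φ)

theorem liftPoly_mon (φ : V →ₗ[k] M.carrier) (x : FreeMagma (Gen V)) :
    liftPoly φ (mon x) = liftMon φ x := by
  rw [liftPoly, mon, Finsupp.lift_apply, Finsupp.sum_single_index (by simp), one_smul]

theorem liftMon_mul (φ : V →ₗ[k] M.carrier) (x y : FreeMagma (Gen V)) :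
    liftMon φ (x * y) = M.bracket (liftMon φ x) (liftMon φ y) := rfl

theorem liftMon_mem {φ : V →ₗ[k] M.carrier} (hφ : GrMod.IsHom V M.toGrMod 0 φ)
    (x : FreeMagma (Gen V)) : liftMon φ x ∈ M.gr (deg V x) := by
  induction x with
  | ih1 v =>
    have := hφ _ _ v.2.2
    rw [add_zero] at this
    exact this
  | ih2 x y hx hy => exact M.bracket_mem hx hy

theorem liftPoly_mul (φ : V →ₗ[k] M.carrier) (p q : Poly V) :
    liftPoly φ (mul p q) = M.bracket (liftPoly φ p) (liftPoly φ q) := by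
  induction p using poly_induction with
  | hmon x =>
    induction q using poly_induction with
    | hmon y => rw [mul_mon, liftPoly_mon, liftPoly_mon, liftPoly_mon, liftMon_mul]
    | hadd p q hp hq => simp only [map_add, hp, hq]
    | hsmul c p hp => simp only [map_smul, hp]
  | hadd p q hp hq => simp only [map_add, LinearMap.add_apply, hp, hq]
  | hsmul c p hp => simp only [map_smul, LinearMap.smul_apply, hp]

theorem liftPoly_relator {φ : V →ₗ[k] M.carrier} (hφ : GrMod.IsHom V M.toGrMod 0 φ) {n : ℤ}
    {r : Poly V} (hr : Relator n r) : liftPoly φ r = 0 := by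
  induction hr with
  | add n v w => simp [liftPoly_mon, liftMon]
  | smul n c v => simp [liftPoly_mon, liftMon]
  | anti x y =>
    simp only [map_add, map_smul, liftPoly_mon, liftMon_mul]
    rw [M.bracket_anti (liftMon_mem hφ x) (liftMon_mem hφ y)]
    simp
  | jacobi x y z =>
    simp only [map_sub, map_smul, liftPoly_mon, liftMon_mul]
    rw [M.jacobi (liftMon_mem hφ x) (liftMon_mem hφ y) (liftMon_mem hφ z)]
    abel
  | left x hr ih => simp [liftPoly_mul, ih]
  | right x hr ih => simp [liftPoly_mul, ih]

variable [CharZero k]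

/-- The projection from the polynomials. -/
noncomputable def proj (V : GrMod k) : Poly V →ₗ[k] (freeLie V).carrier := (ideal V).mkQ

/-- A monomial as an element of the free graded Lie algebra. -/
noncomputable def gmon (x : FreeMagma (Gen V)) : (freeLie V).carrier := cls x

theorem proj_mon (x : FreeMagma (Gen V)) : proj V (mon x) = gmon x := rfl

theorem proj_relator {n : ℤ} {r : Poly V} (hr : Relator n r) : proj V r = 0 := mkQ_relator hr

theorem proj_surjective : Function.Surjective (proj V) := (ideal V).mkQ_surjective

theorem proj_mul (p q : Poly V) :
    (freeLie V).bracket (proj V p) (proj V q) = proj V (mul p q) := rfl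

theorem gmon_bracket (x y : FreeMagma (Gen V)) :
    (freeLie V).bracket (gmon x) (gmon y) = gmon (x * y) := bracket_cls x y

theorem gmon_mem (x : FreeMagma (Gen V)) : gmon x ∈ (freeLie V).gr (deg V x) := cls_mem x

theorem freeLie_gr_le {n : ℤ} {P : Submodule k (freeLie V).carrier}
    (h : ∀ x, deg V x = n → gmon x ∈ P) : (freeLie V).gr n ≤ P := gr_le h

theorem freeLie_ext {M : Type*} [AddCommGroup M] [Module k M]
    {f g : (freeLie V).carrier →ₗ[k] M} (h : ∀ x, f (gmon x) = g (gmon x)) : f = g :=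
  carrier_ext h

/-- The inclusion of the generators. -/
noncomputable def inc (V : GrMod k) : V →ₗ[k] (freeLie V).carrier :=
  V.desc fun n =>
    { toFun v := gmon (.of ⟨n, v⟩)
      map_add' v w := by
        have := proj_relator (Relator.add n v w)
        rwa [map_sub, map_sub, sub_sub, sub_eq_zero] at this
      map_smul' c v := by
        have := proj_relator (Relator.smul n c v)
        rwa [map_sub, map_smul, sub_eq_zero] at this }

theorem inc_apply {n : ℤ} {v : V} (hv : v ∈ V.gr n) : inc V v = gmon (.of ⟨n, v, hv⟩) :=
  V.desc_apply _ hv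

theorem inc_isHom : GrMod.IsHom V (freeLie V).toGrMod 0 (inc V) := by
  intro n v hv
  rw [inc_apply hv, add_zero]
  exact gmon_mem (.of ⟨n, v, hv⟩)

theorem ext_mon {M : Type*} [AddCommGroup M] [Module k M] {f g : (freeLie V).carrier →ₗ[k] M}
    (hinc : ∀ v, f (inc V v) = g (inc V v))
    (hmul : ∀ x y, f (gmon x) = g (gmon x) → f (gmon y) = g (gmon y) →
      f ((freeLie V).bracket (gmon x) (gmon y)) = g ((freeLie V).bracket (gmon x) (gmon y))) :
    f = g := by
  refine freeLie_ext fun x => ?_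
  induction x with
  | ih1 v =>
    have := hinc v.2.1
    rwa [inc_apply v.2.2] at this
  | ih2 x y hx hy =>
    have := hmul x y hx hy
    rwa [gmon_bracket] at this

/-! #### Derivations of degree `-1` -/

/-- The value of a derivation on a monomial. -/
noncomputable def derMon (δ : V →ₗ[k] (freeLie V).carrier) :
    FreeMagma (Gen V) → (freeLie V).carrier
  | .of v => δ v.2.1
  | .mul x y => (freeLie V).bracket (derMon δ x) (gmon y) +
      (sg (deg V x) : k) • (freeLie V).bracket (gmon x) (derMon δ y)

/-- The value of a derivation on a polynomial. -/
noncomputable def derPoly (δ : V →ₗ[k] (freeLie V).carrier) :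
    Poly V →ₗ[k] (freeLie V).carrier := Finsupp.lift _ k _ (derMon δ)

theorem derPoly_mon (δ : V →ₗ[k] (freeLie V).carrier) (x : FreeMagma (Gen V)) :
    derPoly δ (mon x) = derMon δ x := by
  rw [derPoly, mon, Finsupp.lift_apply, Finsupp.sum_single_index (by simp), one_smul]

theorem derMon_mul (δ : V →ₗ[k] (freeLie V).carrier) (x y : FreeMagma (Gen V)) :
    derMon δ (x * y) = (freeLie V).bracket (derMon δ x) (gmon y) +
      (sg (deg V x) : k) • (freeLie V).bracket (gmon x) (derMon δ y) := rfl

theorem derMon_mem {δ : V →ₗ[k] (freeLie V).carrier}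
    (hδ : GrMod.IsHom V (freeLie V).toGrMod (-1) δ) (x : FreeMagma (Gen V)) :
    derMon δ x ∈ (freeLie V).gr (deg V x - 1) := by
  induction x with
  | ih1 v => exact hδ _ _ v.2.2
  | ih2 x y hx hy =>
    have h₁ := (freeLie V).bracket_mem hx (gmon_mem y)
    have h₂ := (freeLie V).bracket_mem (gmon_mem x) hy
    rw [show deg V x - 1 + deg V y = deg V (x * y) - 1 by rw [deg_mul]; ring] at h₁
    rw [show deg V x + (deg V y - 1) = deg V (x * y) - 1 by rw [deg_mul]; ring] at h₂
    exact Submodule.add_mem _ h₁ (Submodule.smul_mem _ _ h₂)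

theorem derPoly_mul (δ : V →ₗ[k] (freeLie V).carrier) (p q : Poly V) :
    derPoly δ (mul p q) = (freeLie V).bracket (derPoly δ p) (proj V q) +
      (freeLie V).bracket ((freeLie V).sigma (proj V p)) (derPoly δ q) := by
  induction p using poly_induction with
  | hmon x =>
    induction q using poly_induction with
    | hmon y =>
      have : (freeLie V).sigma (proj V (mon x)) = (sg (deg V x) : k) • gmon x :=
        (freeLie V).sigma_apply (gmon_mem x)
      rw [mul_mon, derPoly_mon, derPoly_mon, derPoly_mon, derMon_mul, this, map_smul,
        LinearMap.smul_apply]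
      rfl
    | hadd p q hp hq => simp only [map_add, hp, hq]; abel
    | hsmul c p hp => simp only [map_smul, hp, smul_add]
  | hadd p q hp hq => simp only [map_add, LinearMap.add_apply, hp, hq]; abel
  | hsmul c p hp => simp only [map_smul, LinearMap.smul_apply, hp, smul_add]

theorem derPoly_relator {δ : V →ₗ[k] (freeLie V).carrier}
    (hδ : GrMod.IsHom V (freeLie V).toGrMod (-1) δ) {n : ℤ} {r : Poly V} (hr : Relator n r) :
    derPoly δ r = 0 := by
  induction hr with
  | add n v w =>
    simp only [map_sub, derPoly_mon, derMon, Submodule.coe_add, map_add]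
    abel
  | smul n c v => simp [derPoly_mon, derMon]
  | anti x y =>
    simp only [map_add, map_smul, derPoly_mon, derMon_mul]
    rw [(freeLie V).bracket_anti (derMon_mem hδ y) (gmon_mem x),
      (freeLie V).bracket_anti (gmon_mem y) (derMon_mem hδ x)]
    simp only [smul_add, smul_neg, smul_smul, ← sg_add]
    rw [sg_congr (k := k) (m := deg V x * deg V y + (deg V y - 1) * deg V x) (n := deg V x)
        (by grind),
      sg_even (k := k) (m := deg V x * deg V y + (deg V y + deg V y * (deg V x - 1))) (by grind)]
    module
  | jacobi x y z =>
    have j₁ := (freeLie V).jacobi (derMon_mem hδ x) (gmon_mem y) (gmon_mem z)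
    have j₂ := (freeLie V).jacobi (gmon_mem x) (derMon_mem hδ y) (gmon_mem z)
    have j₃ := (freeLie V).jacobi (gmon_mem x) (gmon_mem y) (derMon_mem hδ z)
    simp only [map_sub, map_smul, derPoly_mon, derMon_mul, deg_mul, ← gmon_bracket, map_add,
      LinearMap.add_apply, LinearMap.smul_apply, smul_add, smul_smul, j₁, j₂, j₃, ← sg_add]
    rw [sg_congr (k := k) (m := deg V x + deg V x * (deg V y - 1)) (n := deg V x * deg V y)
        (by grind),
      sg_congr (k := k) (m := (deg V x - 1) * deg V y) (n := deg V x * deg V y + deg V y)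
        (by grind),
      sg_congr (k := k) (m := deg V x + (deg V y + deg V x * deg V y))
        (n := deg V x * deg V y + (deg V y + deg V x)) (by grind)]
    abel
  | left x hr ih => simp [derPoly_mul, ih, proj_relator hr]
  | right x hr ih =>
    rw [derPoly_mul, ih, proj_relator hr]
    simp

/-- The derivation of degree `-1` of the free graded Lie algebra that extends `δ`. -/
noncomputable def der (δ : V →ₗ[k] (freeLie V).carrier)
    (hδ : GrMod.IsHom V (freeLie V).toGrMod (-1) δ) :
    (freeLie V).carrier →ₗ[k] (freeLie V).carrier :=
  (ideal V).liftQ (derPoly δ) (Submodule.span_le.2 fun _ ⟨_, hr⟩ => derPoly_relator hδ hr)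

variable {δ : V →ₗ[k] (freeLie V).carrier} (hδ : GrMod.IsHom V (freeLie V).toGrMod (-1) δ)

theorem der_gmon (x : FreeMagma (Gen V)) : der δ hδ (gmon x) = derMon δ x := derPoly_mon δ x

theorem der_inc (v : V) : der δ hδ (inc V v) = δ v := by
  have : der δ hδ ∘ₗ inc V = δ := V.ext_gr fun n v hv => by
    rw [LinearMap.comp_apply, inc_apply hv, der_gmon]
    rfl
  exact LinearMap.congr_fun this v

theorem der_mem {n : ℤ} {a : (freeLie V).carrier} (ha : a ∈ (freeLie V).gr n) :
    der δ hδ a ∈ (freeLie V).gr (n - 1) := by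
  have : (freeLie V).gr n ≤ ((freeLie V).gr (n - 1)).comap (der δ hδ) := freeLie_gr_le fun x hx => by
    subst hx
    rw [Submodule.mem_comap, der_gmon]
    exact derMon_mem hδ x
  exact this ha

theorem der_leibniz {m : ℤ} {a : (freeLie V).carrier} (ha : a ∈ (freeLie V).gr m)
    (b : (freeLie V).carrier) :
    der δ hδ ((freeLie V).bracket a b) = (freeLie V).bracket (der δ hδ a) b +
      (sg m : k) • (freeLie V).bracket a (der δ hδ b) := by
  rw [← LinearMap.smul_apply, ← map_smul, ← (freeLie V).sigma_apply ha]
  obtain ⟨p, rfl⟩ := proj_surjective a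
  obtain ⟨q, rfl⟩ := proj_surjective b
  exact derPoly_mul δ p q

theorem der_der (h : ∀ v, der δ hδ (δ v) = 0) (a : (freeLie V).carrier) :
    der δ hδ (der δ hδ a) = 0 := by
  have : der δ hδ ∘ₗ der δ hδ = 0 := by
    refine ext_mon (fun v => ?_) fun x y hx hy => ?_
    · rw [LinearMap.comp_apply, der_inc, h]
      rfl
    · simp only [LinearMap.comp_apply, LinearMap.zero_apply] at hx hy ⊢
      rw [der_leibniz hδ (gmon_mem x), map_add, map_smul,
        der_leibniz hδ (der_mem hδ (gmon_mem x)), der_leibniz hδ (gmon_mem x), hx, hy]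
      simp only [map_zero, LinearMap.zero_apply, zero_add, smul_zero, add_zero]
      rw [sub_eq_add_neg, sg_add, sg_neg_one]
      module
  exact LinearMap.congr_fun this a

/-! #### The universal property -/

/-- The morphism of graded Lie algebras that extends `φ`. -/
noncomputable def lift (φ : V →ₗ[k] M.carrier) (hφ : GrMod.IsHom V M.toGrMod 0 φ) :
    (freeLie V).carrier →ₗ[k] M.carrier :=
  (ideal V).liftQ (liftPoly φ) (Submodule.span_le.2 fun _ ⟨_, hr⟩ => liftPoly_relator hφ hr)

variable {φ : V →ₗ[k] M.carrier} (hφ : GrMod.IsHom V M.toGrMod 0 φ)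

theorem lift_gmon (x : FreeMagma (Gen V)) : lift φ hφ (gmon x) = liftMon φ x := liftPoly_mon φ x

theorem lift_inc (v : V) : lift φ hφ (inc V v) = φ v := by
  have : lift φ hφ ∘ₗ inc V = φ := V.ext_gr fun n v hv => by
    rw [LinearMap.comp_apply, inc_apply hv, lift_gmon]
    rfl
  exact LinearMap.congr_fun this v

theorem lift_mem {n : ℤ} {a : (freeLie V).carrier} (ha : a ∈ (freeLie V).gr n) :
    lift φ hφ a ∈ M.gr n := by
  have : (freeLie V).gr n ≤ (M.gr n).comap (lift φ hφ) := freeLie_gr_le fun x hx => by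
    subst hx
    rw [Submodule.mem_comap, lift_gmon]
    exact liftMon_mem hφ x
  exact this ha

theorem lift_bracket (a b : (freeLie V).carrier) :
    lift φ hφ ((freeLie V).bracket a b) = M.bracket (lift φ hφ a) (lift φ hφ b) := by
  obtain ⟨p, rfl⟩ := proj_surjective a
  obtain ⟨q, rfl⟩ := proj_surjective b
  exact liftPoly_mul φ p q

end FreeLie

variable [CharZero k]

/-- The free graded Lie algebra on `V` with the differential induced by `δ : V → T_Lie V`, i.e.
the derivation that extends `δ`. -/
noncomputable def freeDGLie (δ : V →ₗ[k] (freeLie V).carrier)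
    (hδ : GrMod.IsHom V (freeLie V).toGrMod (-1) δ) (h : ∀ v, FreeLie.der δ hδ (δ v) = 0) :
    DGLie k where
  toGrLie := freeLie V
  d := FreeLie.der δ hδ
  d_mem := FreeLie.der_mem hδ
  d_d := FreeLie.der_der hδ h
  leibniz := FreeLie.der_leibniz hδ

end freeLie

/-! ### The universal Maurer-Cartan Lie algebra and the cobar construction -/

section cobar
variable {k : Type u} [Field k] [CharZero k]

theorem GrLie.bracket_bracket_self (M : GrLie k) {x : M.carrier} (hx : x ∈ M.gr (-1)) :
    M.bracket x (M.bracket x x) = 0 ∧ M.bracket (M.bracket x x) x = 0 := by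
  have j := M.jacobi hx hx hx
  have a := M.bracket_anti hx (M.bracket_mem hx hx)
  rw [sg_even (by decide), one_smul] at a
  rw [sg_odd (by decide)] at j
  rw [eq_neg_iff_add_eq_zero, add_comm] at a
  rw [eq_neg_iff_add_eq_zero.2 a] at j
  have : (3 : k) • M.bracket x (M.bracket x x) = 0 := by
    have h : (3 : k) • M.bracket x (M.bracket x x) = M.bracket x (M.bracket x x) -
        (-M.bracket x (M.bracket x x) + (-1 : k) • M.bracket x (M.bracket x x)) := by module
    rw [h]
    exact sub_eq_zero.2 j
  have h0 := (smul_eq_zero.1 this).resolve_left (by norm_num)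
  rw [h0] at a
  exact ⟨h0, by simpa using a⟩

/-- The graded vector space with one basis vector, of degree `p`. -/
def GrMod.line (k : Type u) [Field k] [CharZero k] (p : ℤ) : GrMod k where
  carrier := k
  gr n := if n = p then ⊤ else ⊥
  isInternal := by
    refine GrMod.isInternal_of_euler ((p : k) • LinearMap.id) (fun n x hx => ?_) ?_
    · split_ifs at hx with h
      · simp [h]
      · simp [(Submodule.mem_bot k).1 hx]
    · exact eq_top_iff.2 (le_iSup_of_le p (by simp))

/-- The basis vector. -/
def GrMod.lineGen (k : Type u) [Field k] [CharZero k] (p : ℤ) : GrMod.line k p := (1 : k)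

theorem GrMod.lineGen_mem (p : ℤ) : GrMod.lineGen k p ∈ (GrMod.line k p).gr p := by
  change (1 : k) ∈ if p = p then (⊤ : Submodule k k) else ⊥
  rw [if_pos rfl]
  trivial

theorem GrMod.line_eq_zero {n p : ℤ} (h : n ≠ p) {x : GrMod.line k p}
    (hx : x ∈ (GrMod.line k p).gr n) : x = 0 := by
  change (id x : k) ∈ if n = p then (⊤ : Submodule k k) else ⊥ at hx
  rw [if_neg h] at hx
  exact (Submodule.mem_bot k).1 hx

/-- The generator `x` of the universal Maurer-Cartan Lie algebra. -/
noncomputable def mcGen (k : Type u) [Field k] [CharZero k] :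
    (freeLie (GrMod.line k (-1))).carrier := FreeLie.inc _ (GrMod.lineGen k (-1))

theorem mcGen_mem : mcGen k ∈ (freeLie (GrMod.line k (-1))).gr (-1) := by
  have := FreeLie.inc_isHom (V := GrMod.line k (-1)) (-1) _ (GrMod.lineGen_mem (-1))
  rwa [add_zero] at this

/-- The linear map with `x ↦ -½ [x, x]`. -/
noncomputable def mcDelta (k : Type u) [Field k] [CharZero k] :
    (GrMod.line k (-1)).carrier →ₗ[k] (freeLie (GrMod.line k (-1))).carrier :=
  LinearMap.toSpanSingleton k (freeLie (GrMod.line k (-1))).carrier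
    (-((1 / 2 : k) • (freeLie (GrMod.line k (-1))).bracket (mcGen k) (mcGen k)))

theorem mcDelta_apply (c : k) : mcDelta k c =
    c • (-((1 / 2 : k) • (freeLie (GrMod.line k (-1))).bracket (mcGen k) (mcGen k))) := rfl

theorem mcDelta_mem :
    GrMod.IsHom (GrMod.line k (-1)) (freeLie (GrMod.line k (-1))).toGrMod (-1) (mcDelta k) := by
  intro n x hx
  by_cases h : n = -1
  · subst h
    exact Submodule.smul_mem _ _ (Submodule.neg_mem _ (Submodule.smul_mem _ _
      ((freeLie (GrMod.line k (-1))).bracket_mem mcGen_mem mcGen_mem)))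
  · rw [GrMod.line_eq_zero h hx, map_zero]
    exact Submodule.zero_mem _

theorem mc_square (v : GrMod.line k (-1)) :
    FreeLie.der (mcDelta k) mcDelta_mem (mcDelta k v) = 0 := by
  have h₁ : FreeLie.der (mcDelta k) mcDelta_mem (mcGen k) =
      -((1 / 2 : k) • (freeLie (GrMod.line k (-1))).bracket (mcGen k) (mcGen k)) :=
    (FreeLie.der_inc mcDelta_mem (GrMod.lineGen k (-1))).trans
      ((mcDelta_apply (1 : k)).trans (one_smul k _))
  have h₂ := GrLie.bracket_bracket_self _ (mcGen_mem (k := k))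
  have h₃ : FreeLie.der (mcDelta k) mcDelta_mem
      ((freeLie (GrMod.line k (-1))).bracket (mcGen k) (mcGen k)) = 0 := by
    rw [FreeLie.der_leibniz _ mcGen_mem, h₁, map_neg, map_smul, LinearMap.neg_apply,
      LinearMap.smul_apply, h₂.2, map_neg, map_smul, h₂.1]
    simp
  have h₄ : mcDelta k v = (id v : k) •
    (-((1 / 2 : k) • (freeLie (GrMod.line k (-1))).bracket (mcGen k) (mcGen k))) := rfl
  rw [h₄, map_smul, map_neg, map_smul, h₃]
  simp

/-- The universal Maurer-Cartan Lie algebra: the free graded Lie algebra on one generator `x` of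
degree `-1`, with the differential induced by `x ↦ -½ [x, x]`. -/
noncomputable def mcLie (k : Type u) [Field k] [CharZero k] : DGLie k :=
  freeDGLie (mcDelta k) mcDelta_mem mc_square

/-- The map `C → T_Lie ΣC` of degree `-1` that sends `c` to the generator `Σc`. -/
noncomputable def cobarInc (C : DGCoalg k) :
    C.carrier →ₗ[k] (freeLie (C.shift 1)).carrier := FreeLie.inc (C.shift 1)

theorem cobarInc_mem (C : DGCoalg k) :
    GrMod.IsHom C.toGrMod (freeLie (C.shift 1)).toGrMod (-1) (cobarInc C) := by
  intro n x hx
  have h : x ∈ (C.shift 1).gr (n - 1) := by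
    change x ∈ C.gr (n - 1 + 1)
    rwa [sub_add_cancel]
  have := FreeLie.inc_isHom (V := C.shift 1) _ x h
  rwa [add_zero] at this

/-- The differential of the cobar construction on generators,
`Σc ↦ -Σ(d c) - ½ ∑ (-1)^|c'| [Σc', Σc'']`. -/
noncomputable def cobarDelta (C : DGCoalg k) :
    C.carrier →ₗ[k] (freeLie (C.shift 1)).carrier :=
  -(cobarInc C ∘ₗ C.d) -
    (1 / 2 : k) • convBracket C.toGrCoalg (freeLie (C.shift 1)) (cobarInc C) (cobarInc C)

theorem cobarDelta_mem (C : DGCoalg k) :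
    GrMod.IsHom C.toGrMod (freeLie (C.shift 1)).toGrMod (-2) (cobarDelta C) := by
  intro n x hx
  have h₁ := cobarInc_mem C _ _ (C.d_mem hx)
  rw [show n - 1 + -1 = n + -2 by ring] at h₁
  have h₂ := convBracket_mem (C := C.toGrCoalg) (cobarInc_mem C) (cobarInc_mem C) _ _ hx
  exact Submodule.sub_mem _ (Submodule.neg_mem _ h₁) (Submodule.smul_mem _ _ h₂)

theorem cobarDelta_isHom (C : DGCoalg k) :
    GrMod.IsHom (C.shift 1) (freeLie (C.shift 1)).toGrMod (-1) (cobarDelta C) := by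
  intro n x hx
  have := cobarDelta_mem C (n + 1) x hx
  rwa [show n + 1 + -2 = n + -1 by ring] at this

/-- The derivation of `T_Lie ΣC` that extends `cobarDelta`. -/
noncomputable def cobarD (C : DGCoalg k) :
    (freeLie (C.shift 1)).carrier →ₗ[k] (freeLie (C.shift 1)).carrier :=
  FreeLie.der (V := C.shift 1) (cobarDelta C) (cobarDelta_isHom C)

theorem cobarD_inc (C : DGCoalg k) (c : C.carrier) : cobarD C (cobarInc C c) = cobarDelta C c :=
  FreeLie.der_inc (cobarDelta_isHom C) c

theorem cobarD_leibniz (C : DGCoalg k) {m : ℤ} {x : (freeLie (C.shift 1)).carrier}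
    (hx : x ∈ (freeLie (C.shift 1)).gr m) (y : (freeLie (C.shift 1)).carrier) :
    cobarD C ((freeLie (C.shift 1)).bracket x y) =
      (freeLie (C.shift 1)).bracket (cobarD C x) y +
        (sg m : k) • (freeLie (C.shift 1)).bracket x (cobarD C y) :=
  FreeLie.der_leibniz (cobarDelta_isHom C) hx y

theorem conv_comp_d {C : DGCoalg k} {M : GrLie k} {f : C.carrier →ₗ[k] M.carrier}
    (hf : GrMod.IsHom C.toGrMod M.toGrMod (-1) f) :
    convBracket C.toGrCoalg M f f ∘ₗ C.d = -((2 : k) • convBracket C.toGrCoalg M (f ∘ₗ C.d) f) := by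
  have hfd : GrMod.IsHom C.toGrMod M.toGrMod (-2) (f ∘ₗ C.d) := fun n x hx => by
    have := hf _ _ (C.d_mem hx)
    rwa [show n - 1 + -1 = n + -2 by ring] at this
  have a := convBracket_anti hf hfd
  rw [sg_even (by decide), one_smul] at a
  have key : convAux C.toGrCoalg M f f ∘ₗ
      (TensorProduct.map C.d LinearMap.id + TensorProduct.map C.sigma C.d) =
      convAux C.toGrCoalg M f (f ∘ₗ C.d) - convAux C.toGrCoalg M (f ∘ₗ C.d) f := by
    refine GrMod.ext_gr₂ C.toGrMod C.toGrMod fun i j x hx y hy => ?_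
    have e₁ : convAux C.toGrCoalg M f f (C.d x ⊗ₜ y) = _ := convAux_apply f hf (C.d_mem hx) y
    have e₂ : convAux C.toGrCoalg M f f (x ⊗ₜ C.d y) = _ := convAux_apply f hf hx (C.d y)
    have e₃ : convAux C.toGrCoalg M f (f ∘ₗ C.d) (x ⊗ₜ y) = _ := convAux_apply f hfd hx y
    have e₄ : convAux C.toGrCoalg M (f ∘ₗ C.d) f (x ⊗ₜ y) = _ := convAux_apply (f ∘ₗ C.d) hf hx y
    simp only [LinearMap.sub_apply, LinearMap.add_apply, LinearMap.comp_apply,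
      TensorProduct.map_tmul, LinearMap.id_apply, map_add, e₁, e₂, C.sigma_apply hx,
      ← TensorProduct.smul_tmul', map_smul, e₃, e₄, smul_smul, ← sg_add]
    rw [show -1 * (i - 1) = -1 * i + 1 by ring, ← neg_sg,
      sg_congr (k := k) (m := i + -1 * i) (n := -2 * i) (by grind)]
    module
  have h := congrArg (· ∘ₗ C.comul) key
  simp only [LinearMap.comp_assoc, ← C.coder] at h
  rw [convBracket_eq, LinearMap.comp_assoc, h, LinearMap.sub_comp, ← convBracket_eq,
    ← convBracket_eq, a]
  module

theorem cobar_der_conv (C : DGCoalg k) :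
    cobarD C ∘ₗ
      convBracket C.toGrCoalg (freeLie (C.shift 1)) (cobarInc C) (cobarInc C) =
    (2 : k) • convBracket C.toGrCoalg (freeLie (C.shift 1)) (cobarDelta C) (cobarInc C) := by
  have a := convBracket_anti (C := C.toGrCoalg) (cobarInc_mem C) (cobarDelta_mem C)
  rw [sg_even (by decide), one_smul] at a
  have key : cobarD C ∘ₗ
      convAux C.toGrCoalg (freeLie (C.shift 1)) (cobarInc C) (cobarInc C) =
      convAux C.toGrCoalg (freeLie (C.shift 1)) (cobarDelta C) (cobarInc C) -
        convAux C.toGrCoalg (freeLie (C.shift 1)) (cobarInc C) (cobarDelta C) := by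
    refine GrMod.ext_gr₂ C.toGrMod C.toGrMod fun i j x hx y hy => ?_
    have e₁ : convAux C.toGrCoalg (freeLie (C.shift 1)) (cobarInc C) (cobarInc C) (x ⊗ₜ y) = _ :=
      convAux_apply _ (cobarInc_mem C) hx y
    have e₂ : convAux C.toGrCoalg (freeLie (C.shift 1)) (cobarDelta C) (cobarInc C) (x ⊗ₜ y) = _ :=
      convAux_apply (C := C.toGrCoalg) (cobarDelta C) (cobarInc_mem C) hx y
    have e₃ : convAux C.toGrCoalg (freeLie (C.shift 1)) (cobarInc C) (cobarDelta C) (x ⊗ₜ y) = _ :=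
      convAux_apply (C := C.toGrCoalg) _ (cobarDelta_mem C) hx y
    simp only [LinearMap.sub_apply, LinearMap.comp_apply, map_smul, e₁, e₂, e₃]
    rw [cobarD_leibniz C (cobarInc_mem C _ _ hx), cobarD_inc, cobarD_inc, smul_add, smul_smul, ← sg_add,
      sg_congr (k := k) (m := -1 * i + (i + -1)) (n := -2 * i + 1) (by grind), ← neg_sg]
    module
  have h := congrArg (· ∘ₗ C.comul) key
  simp only [LinearMap.comp_assoc] at h
  rw [convBracket_eq, h, LinearMap.sub_comp, ← convBracket_eq, ← convBracket_eq, a]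
  module

/-- The graded convolution Lie algebra shows that `[f, [f, f]] = 0` for `f` of degree `-1`. -/
theorem conv_conv_self {C : GrCoalg k} {M : GrLie k} {f : C.carrier →ₗ[k] M.carrier}
    (hf : GrMod.IsHom C.toGrMod M.toGrMod (-1) f) :
    convBracket C M (convBracket C M f f) f = 0 :=
  congrArg Subtype.val ((convGrLie C M).bracket_bracket_self (x := ⟨f, hf.mem_homTotal⟩) hf).2

theorem cobar_square (C : DGCoalg k) (c : C.carrier) :
    cobarD C (cobarDelta C c) = 0 := by
  have h₁ : convBracket C.toGrCoalg (freeLie (C.shift 1)) (cobarDelta C) (cobarInc C) =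
      -convBracket C.toGrCoalg (freeLie (C.shift 1)) (cobarInc C ∘ₗ C.d) (cobarInc C) := by
    change convBracket C.toGrCoalg (freeLie (C.shift 1)) (-(cobarInc C ∘ₗ C.d) - _) _ = _
    rw [map_sub, map_neg, map_smul, LinearMap.sub_apply, LinearMap.smul_apply,
      conv_conv_self (cobarInc_mem C), smul_zero, sub_zero, LinearMap.neg_apply]
  have h₂ : cobarDelta C (C.d c) = -((1 / 2 : k) • (convBracket C.toGrCoalg (freeLie (C.shift 1))
      (cobarInc C) (cobarInc C) ∘ₗ C.d) c) := by
    change -(cobarInc C (C.d (C.d c))) - _ = _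
    rw [C.d_d, map_zero, neg_zero, zero_sub]
    rfl
  have h₃ := LinearMap.congr_fun (cobar_der_conv C) c
  rw [LinearMap.comp_apply] at h₃
  have h₄ : cobarDelta C c = -(cobarInc C (C.d c)) - (1 / 2 : k) •
    convBracket C.toGrCoalg (freeLie (C.shift 1)) (cobarInc C) (cobarInc C) c := rfl
  have h₅ : cobarD C (cobarInc C (C.d c)) =
    cobarDelta C (C.d c) := cobarD_inc C (C.d c)
  rw [h₄, map_sub, map_neg, map_smul, h₃, h₅, h₂, conv_comp_d (cobarInc_mem C), h₁]
  simp only [LinearMap.neg_apply, LinearMap.smul_apply]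
  module

/-- The cobar construction: the free graded Lie algebra on `ΣC`, with the differential induced by
`Σc ↦ -Σ(d c) - ½ ∑ (-1)^|c'| [Σc', Σc'']`. -/
noncomputable def cobarObj (C : DGCoalg k) : DGLie k :=
  freeDGLie (V := C.shift 1) (cobarDelta C) (cobarDelta_isHom C) (cobar_square C)

theorem cobarMap_aux {C D : DGCoalg k} (φ : C ⟶ D) :
    GrMod.IsHom (C.shift 1) (freeLie (D.shift 1)).toGrMod 0 (cobarInc D ∘ₗ φ.map) :=
  fun n _ hx => FreeLie.inc_isHom (V := D.shift 1) n _ (φ.map_mem hx)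

/-- The morphism of free graded Lie algebras induced by a morphism of coalgebras. -/
noncomputable def cobarLift {C D : DGCoalg k} (φ : C ⟶ D) :
    (freeLie (C.shift 1)).carrier →ₗ[k] (freeLie (D.shift 1)).carrier :=
  FreeLie.lift (V := C.shift 1) (cobarInc D ∘ₗ φ.map) (cobarMap_aux φ)

theorem cobarLift_inc {C D : DGCoalg k} (φ : C ⟶ D) (c : C.carrier) :
    cobarLift φ (cobarInc C c) = cobarInc D (φ.map c) :=
  FreeLie.lift_inc (cobarMap_aux φ) c

theorem cobarLift_mem {C D : DGCoalg k} (φ : C ⟶ D) {n : ℤ} {x : (freeLie (C.shift 1)).carrier}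
    (hx : x ∈ (freeLie (C.shift 1)).gr n) : cobarLift φ x ∈ (freeLie (D.shift 1)).gr n :=
  FreeLie.lift_mem (cobarMap_aux φ) hx

theorem cobarLift_bracket {C D : DGCoalg k} (φ : C ⟶ D) (x y : (freeLie (C.shift 1)).carrier) :
    cobarLift φ ((freeLie (C.shift 1)).bracket x y) =
      (freeLie (D.shift 1)).bracket (cobarLift φ x) (cobarLift φ y) :=
  FreeLie.lift_bracket (cobarMap_aux φ) x y

theorem cobarLift_delta {C D : DGCoalg k} (φ : C ⟶ D) (c : C.carrier) :
    cobarLift φ (cobarDelta C c) = cobarDelta D (φ.map c) := by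
  have h := convBracket_natural (C := C.toGrCoalg) (D := C.toGrCoalg)
    (g := freeLie (C.shift 1)) (h := freeLie (D.shift 1)) (φ := LinearMap.id) (fun h => h)
    (fun x => by simp) (ψ := cobarLift φ) (cobarLift_mem φ)
    (cobarLift_bracket φ) (cobarInc C) (cobarInc_mem C)
  have h' := convBracket_natural (C := D.toGrCoalg) (D := C.toGrCoalg)
    (g := freeLie (D.shift 1)) (h := freeLie (D.shift 1)) (φ := φ.map) φ.map_mem
    φ.map_comul (ψ := LinearMap.id) (fun h => h) (fun _ _ => rfl) (cobarInc D) (cobarInc_mem D)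
  have e : cobarLift φ ∘ₗ cobarInc C ∘ₗ LinearMap.id = LinearMap.id ∘ₗ cobarInc D ∘ₗ φ.map :=
    LinearMap.ext fun c => cobarLift_inc φ c
  rw [e, ← h'] at h
  have h'' := LinearMap.congr_fun h c
  simp only [LinearMap.comp_apply, LinearMap.id_apply] at h''
  change cobarLift φ (-(cobarInc C (C.d c)) - (1 / 2 : k) • _) =
    -(cobarInc D (D.d (φ.map c))) - (1 / 2 : k) • _
  rw [map_sub, map_neg, map_smul, h'', cobarLift_inc, φ.map_d]

/-- The cobar construction on morphisms. -/
noncomputable def cobarMap {C D : DGCoalg k} (φ : C ⟶ D) : cobarObj C ⟶ cobarObj D where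
  map := cobarLift φ
  map_mem h := cobarLift_mem φ h
  map_bracket a b := cobarLift_bracket φ a b
  map_d a := by
    have : cobarLift φ ∘ₗ cobarD C = cobarD D ∘ₗ cobarLift φ := by
      refine FreeLie.ext_mon (V := C.shift 1) (fun v => ?_) fun x y hx hy => ?_
      · have h (c : C.carrier) :
            cobarLift φ (cobarD C (cobarInc C c)) = cobarD D (cobarLift φ (cobarInc C c)) := by
          rw [cobarD_inc, cobarLift_inc, cobarD_inc, cobarLift_delta]
        exact h v
      · have hm := cobarLift_mem φ (FreeLie.gmon_mem x)
        simp only [LinearMap.comp_apply] at hx hy ⊢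
        rw [cobarD_leibniz C (FreeLie.gmon_mem x), map_add, map_smul, cobarLift_bracket,
          cobarLift_bracket, cobarLift_bracket, cobarD_leibniz D hm, hx, hy]
    exact LinearMap.congr_fun this a

theorem cobarHom_ext {C : DGCoalg k} {g : DGLie k} {α β : cobarObj C ⟶ g}
    (h : ∀ c, α.map (cobarInc C c) = β.map (cobarInc C c)) : α = β := by
  refine DGLie.Hom.ext (FreeLie.ext_mon h fun x y hx hy => ?_)
  exact (α.map_bracket _ _).trans ((congrArg₂ (fun a b => g.bracket a b) hx hy).trans
    (β.map_bracket _ _).symm)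

/-- The cobar construction `Ω`. -/
noncomputable def cobar (k : Type u) [Field k] [CharZero k] : DGCoalg k ⥤ DGLie k where
  obj := cobarObj
  map := cobarMap
  map_id C := cobarHom_ext fun c => cobarLift_inc (𝟙 C) c
  map_comp {C D E} φ ψ := cobarHom_ext fun c =>
    (cobarLift_inc (φ ≫ ψ) c).trans <| by
      change _ = cobarLift ψ (cobarLift φ (cobarInc C c))
      rw [cobarLift_inc, cobarLift_inc]
      rfl

end cobar

/-! ### The free graded commutative algebra -/

section sym
variable {k : Type u} [Field k]

/-- The relations `x y = (-1)^(|x| |y|) y x` on the tensor algebra. -/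
inductive SymRel (V : GrMod k) : TensorAlgebra k V.carrier → TensorAlgebra k V.carrier → Prop
  | comm {m n : ℤ} {x y : V.carrier} (hx : x ∈ V.gr m) (hy : y ∈ V.gr n) :
    SymRel V (TensorAlgebra.ι k x * TensorAlgebra.ι k y)
      ((sg (m * n) : k) • (TensorAlgebra.ι k y * TensorAlgebra.ι k x))

/-- The free graded commutative unital algebra on a graded vector space. -/
def Sym (V : GrMod k) : Type u := RingQuot (SymRel V)

noncomputable instance (V : GrMod k) : Ring (Sym V) := inferInstanceAs (Ring (RingQuot (SymRel V)))

noncomputable instance (V : GrMod k) : Algebra k (Sym V) :=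
  inferInstanceAs (Algebra k (RingQuot (SymRel V)))

namespace Sym
variable {V W : GrMod k}

/-- The projection from the tensor algebra. -/
noncomputable def proj (V : GrMod k) : TensorAlgebra k V.carrier →ₐ[k] Sym V :=
  RingQuot.mkAlgHom k (SymRel V)

/-- Multiplication by a generator from the left. -/
noncomputable def L (V : GrMod k) : V.carrier →ₗ[k] Sym V →ₗ[k] Sym V :=
  LinearMap.mul k (Sym V) ∘ₗ (proj V).toLinearMap ∘ₗ TensorAlgebra.ι k

theorem L_apply (v : V.carrier) (s : Sym V) : L V v s = proj V (TensorAlgebra.ι k v) * s := rfl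

theorem L_comm {m n : ℤ} {x y : V.carrier} (hx : x ∈ V.gr m) (hy : y ∈ V.gr n) (s : Sym V) :
    L V x (L V y s) = (sg (m * n) : k) • L V y (L V x s) := by
  have : proj V _ = proj V _ := RingQuot.mkAlgHom_rel k (SymRel.comm hx hy)
  rw [map_mul, map_smul, map_mul] at this
  rw [L_apply, L_apply, ← mul_assoc, this, L_apply, L_apply, smul_mul_assoc, mul_assoc]

theorem eq_top {P : Submodule k (Sym V)} (h₁ : (1 : Sym V) ∈ P)
    (h : ∀ m, ∀ v ∈ V.gr m, ∀ s ∈ P, L V v s ∈ P) : P = ⊤ := by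
  have h' : ∀ v, ∀ s ∈ P, L V v s ∈ P := fun v s hs => by
    have : ⨆ n, V.gr n ≤ P.comap ((L V).flip s) := iSup_le fun n v hv => h n v hv s hs
    rw [V.iSup_gr] at this
    exact this (Submodule.mem_top (x := v))
  have key : ∀ a : TensorAlgebra k V.carrier, ∀ s ∈ P, proj V a * s ∈ P := by
    intro a
    induction a using TensorAlgebra.induction with
    | algebraMap r =>
      intro s hs
      rw [AlgHom.commutes, ← Algebra.smul_def]
      exact P.smul_mem _ hs
    | ι v => exact h' v
    | mul a b ha hb =>
      intro s hs
      rw [map_mul, mul_assoc]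
      exact ha _ (hb _ hs)
    | add a b ha hb =>
      intro s hs
      rw [map_add, add_mul]
      exact P.add_mem (ha _ hs) (hb _ hs)
  refine eq_top_iff.2 fun s _ => ?_
  obtain ⟨a, rfl⟩ := RingQuot.mkAlgHom_surjective k (SymRel V) s
  have := key a 1 h₁
  rwa [mul_one] at this

theorem ext {M : Type*} [AddCommGroup M] [Module k M] {f g : Sym V →ₗ[k] M} (h₁ : f 1 = g 1)
    (h : ∀ m, ∀ v ∈ V.gr m, ∀ s, f s = g s → f (L V v s) = g (L V v s)) : f = g := by
  have : LinearMap.eqLocus f g = ⊤ := eq_top h₁ fun m v hv s hs => h m v hv s hs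
  ext x
  exact (this ▸ Submodule.mem_top : x ∈ LinearMap.eqLocus f g)

/-- The action of `Sym V` given by the action of the generators. -/
noncomputable def rep {N : Type u} [AddCommGroup N] [Module k N]
    (op : V.carrier →ₗ[k] N →ₗ[k] N)
    (hop : ∀ ⦃m n x y⦄, x ∈ V.gr m → y ∈ V.gr n → ∀ t,
      op x (op y t) = (sg (m * n) : k) • op y (op x t)) : Sym V →ₐ[k] Module.End k N :=
  (RingQuot.liftAlgHom k ⟨TensorAlgebra.lift k (A := Module.End k N) op, by
    rintro _ _ ⟨hx, hy⟩
    refine LinearMap.ext fun t => ?_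
    simp only [map_mul, map_smul, TensorAlgebra.lift_ι_apply]
    exact hop hx hy t⟩ : RingQuot (SymRel V) →ₐ[k] Module.End k N)

/-- The linear map with given value at `1` that intertwines the left multiplications with given
operators. -/
noncomputable def build {N : Type u} [AddCommGroup N] [Module k N]
    (op : V.carrier →ₗ[k] N →ₗ[k] N)
    (hop : ∀ ⦃m n x y⦄, x ∈ V.gr m → y ∈ V.gr n → ∀ t,
      op x (op y t) = (sg (m * n) : k) • op y (op x t)) (t₀ : N) : Sym V →ₗ[k] N where
  toFun s := rep op hop s t₀
  map_add' _ _ := by rw [map_add, LinearMap.add_apply]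
  map_smul' _ _ := by rw [map_smul, LinearMap.smul_apply, RingHom.id_apply]

section build
variable {N : Type u} [AddCommGroup N] [Module k N] (op : V.carrier →ₗ[k] N →ₗ[k] N)
    (hop : ∀ ⦃m n x y⦄, x ∈ V.gr m → y ∈ V.gr n → ∀ t,
      op x (op y t) = (sg (m * n) : k) • op y (op x t)) (t₀ : N)

theorem build_one : build op hop t₀ 1 = t₀ := by
  change rep op hop 1 t₀ = t₀
  rw [map_one]
  rfl

theorem rep_ι (v : V.carrier) : rep op hop (proj V (TensorAlgebra.ι k v)) = op v :=
  (RingQuot.liftAlgHom_mkAlgHom_apply k _ _ _).trans (TensorAlgebra.lift_ι_apply _ _)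

theorem build_L (v : V.carrier) (s : Sym V) :
    build op hop t₀ (L V v s) = op v (build op hop t₀ s) := by
  change rep op hop (L V v s) t₀ = op v (rep op hop s t₀)
  rw [L_apply, map_mul, rep_ι]
  rfl

end build

/-- The operators on `Sym V × Sym V` from which `twist` is built. -/
noncomputable def twistOp (p : ℤ) (A : V.carrier →ₗ[k] Sym V →ₗ[k] Sym V) :
    V.carrier →ₗ[k] (Sym V × Sym V) →ₗ[k] (Sym V × Sym V) :=
  LinearMap.mk₂ k
    (fun v z => (L V v z.1, L V (V.scale (fun n => sg (p * n)) v) z.2 + A v z.1))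
    (fun _ _ _ => by ext <;> simp <;> abel) (fun _ _ _ => by ext <;> simp)
    (fun _ _ _ => by ext <;> simp <;> abel) (fun _ _ _ => by ext <;> simp)

theorem twistOp_comm {p : ℤ} {A : V.carrier →ₗ[k] Sym V →ₗ[k] Sym V}
    (hA : ∀ ⦃m n x y⦄, x ∈ V.gr m → y ∈ V.gr n → ∀ s,
      (sg (p * m) : k) • L V x (A y s) + A x (L V y s) =
        (sg (m * n) : k) • ((sg (p * n) : k) • L V y (A x s) + A y (L V x s)))
    ⦃m n : ℤ⦄ ⦃x y : V.carrier⦄ (hx : x ∈ V.gr m) (hy : y ∈ V.gr n) (z : Sym V × Sym V) :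
    twistOp p A x (twistOp p A y z) = (sg (m * n) : k) • twistOp p A y (twistOp p A x z) := by
  refine Prod.ext (L_comm hx hy z.1) ?_
  have h := hA hx hy z.1
  change L V (V.scale _ x) (L V (V.scale _ y) z.2 + A y z.1) + A x (L V y z.1) =
    (sg (m * n) : k) • (L V (V.scale _ y) (L V (V.scale _ x) z.2 + A x z.1) + A y (L V x z.1))
  rw [V.scale_apply _ hx, V.scale_apply _ hy]
  simp only [map_smul, map_add, LinearMap.smul_apply, smul_add] at h ⊢
  rw [L_comm hx hy, add_assoc, h]
  module

/-- The linear map `T` of parity `p` with `T 1 = 0` and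
`T (v s) = (-1)^(p |v|) v (T s) + A v s`. -/
noncomputable def twist (p : ℤ) (A : V.carrier →ₗ[k] Sym V →ₗ[k] Sym V)
    (hA : ∀ ⦃m n x y⦄, x ∈ V.gr m → y ∈ V.gr n → ∀ s,
      (sg (p * m) : k) • L V x (A y s) + A x (L V y s) =
        (sg (m * n) : k) • ((sg (p * n) : k) • L V y (A x s) + A y (L V x s))) :
    Sym V →ₗ[k] Sym V :=
  LinearMap.snd k _ _ ∘ₗ build (twistOp p A) (twistOp_comm hA) (1, 0)

section twist
variable (p : ℤ) (A : V.carrier →ₗ[k] Sym V →ₗ[k] Sym V)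
    (hA : ∀ ⦃m n x y⦄, x ∈ V.gr m → y ∈ V.gr n → ∀ s,
      (sg (p * m) : k) • L V x (A y s) + A x (L V y s) =
        (sg (m * n) : k) • ((sg (p * n) : k) • L V y (A x s) + A y (L V x s)))

theorem twist_one : twist p A hA 1 = 0 := by
  rw [twist, LinearMap.comp_apply, build_one]
  rfl

theorem twist_L {m : ℤ} {v : V.carrier} (hv : v ∈ V.gr m) (s : Sym V) :
    twist p A hA (L V v s) = (sg (p * m) : k) • L V v (twist p A hA s) + A v s := by
  have h₁ : LinearMap.fst k _ _ ∘ₗ build (twistOp p A) (twistOp_comm hA) (1, 0) = LinearMap.id :=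
    ext (by rw [LinearMap.comp_apply, build_one]; rfl) fun m v hv s hs => by
      rw [LinearMap.comp_apply] at hs
      rw [LinearMap.comp_apply, build_L, LinearMap.id_apply]
      exact congrArg (L V v) hs
  have h₂ := LinearMap.congr_fun h₁ s
  rw [twist, LinearMap.comp_apply, build_L]
  change L V (V.scale _ v) _ + A v _ = _
  rw [V.scale_apply _ hv, map_smul, LinearMap.smul_apply]
  exact congrArg _ (congrArg (A v) h₂)

end twist

/-- The derivation of degree `p` that extends the linear map `δ` of degree `p` on generators. -/
noncomputable def der (p : ℤ) (δ : V.carrier →ₗ[k] V.carrier) (hδ : GrMod.IsHom V V p δ) :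
    Sym V →ₗ[k] Sym V :=
  twist p (L V ∘ₗ δ) (by
    intro m n x y hx hy s
    simp only [LinearMap.comp_apply]
    rw [L_comm (hδ _ _ hx) hy, L_comm (hδ _ _ hy) hx]
    simp only [smul_add, smul_smul, ← sg_add]
    rw [sg_congr (k := k) (m := m * n + p * n) (n := (m + p) * n) (by grind),
      sg_congr (k := k) (m := m * n + (n + p) * m) (n := p * m) (by grind), add_comm])

section der
variable {p q : ℤ} {δ ε : V.carrier →ₗ[k] V.carrier} (hδ : GrMod.IsHom V V p δ)
  (hε : GrMod.IsHom V V q ε)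

theorem der_one : der p δ hδ 1 = 0 := twist_one _ _ _

theorem der_L {m : ℤ} {v : V.carrier} (hv : v ∈ V.gr m) (s : Sym V) :
    der p δ hδ (L V v s) = (sg (p * m) : k) • L V v (der p δ hδ s) + L V (δ v) s :=
  twist_L _ _ _ hv s

end der

/-- `IsMon l n s` says that `s` is a product of `l` homogeneous generators, of total degree `n`. -/
inductive IsMon (V : GrMod k) : ℕ → ℤ → Sym V → Prop
  | one : IsMon V 0 0 1
  | cons {l : ℕ} {m n : ℤ} {v : V.carrier} {s : Sym V} (hv : v ∈ V.gr m) (hs : IsMon V l n s) :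
    IsMon V (l + 1) (m + n) (L V v s)

end Sym

theorem GrMod.scale_isHom (V : GrMod k) (c : ℤ → k) : GrMod.IsHom V V 0 (V.scale c) :=
  fun n _ hx => by rw [add_zero]; exact V.scale_mem c hx

variable [CharZero k]

/-- The free graded commutative algebra as a graded vector space: the degree `n` part is spanned by
the products of homogeneous generators of total degree `n`. -/
noncomputable def symGr (V : GrMod k) : GrMod k where
  carrier := Sym V
  gr n := Submodule.span k {s | ∃ l, Sym.IsMon V l n s}
  isInternal := by
    refine GrMod.isInternal_of_euler (Sym.der 0 (V.scale fun n => (n : k)) (V.scale_isHom _)) (fun n x hx => ?_) (Sym.eq_top ?_ ?_)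
    · refine Submodule.span_induction (p := fun x _ => Sym.der 0 _ _ x = (n : k) • x) ?_ ?_ ?_ ?_ hx
      · rintro s ⟨l, hs⟩
        clear hx
        induction hs with
        | one => rw [Sym.der_one, Int.cast_zero, zero_smul]
        | cons hv hs ih =>
          rw [Sym.der_L _ hv, ih, V.scale_apply _ hv]
          simp only [zero_mul, sg_even (k := k) Even.zero, map_smul, LinearMap.smul_apply,
            Int.cast_add]
          module
      · simp
      · intro x y _ _ hx hy
        rw [map_add, hx, hy, smul_add]
      · intro a x _ hx
        rw [map_smul, hx, smul_comm]
    · exact Submodule.mem_iSup_of_mem 0 (Submodule.subset_span ⟨0, .one⟩)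
    · intro m v hv s hs
      refine Submodule.iSup_induction _ (motive := fun s => Sym.L V v s ∈ _) hs (fun n s hs => ?_)
        (by simp) fun x y hx hy => by rw [map_add]; exact Submodule.add_mem _ hx hy
      refine Submodule.mem_iSup_of_mem (m + n) ?_
      refine Submodule.span_induction (p := fun x _ => Sym.L V v x ∈ _) ?_ ?_ ?_ ?_ hs
      · rintro s ⟨l, hs⟩
        exact Submodule.subset_span ⟨l + 1, .cons hv hs⟩
      · simp
      · intro x y _ _ hx hy
        rw [map_add]; exact Submodule.add_mem _ hx hy
      · intro a x _ hx
        rw [map_smul]; exact Submodule.smul_mem _ _ hx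

end sym

/-! ### The coalgebra structure on the free graded commutative algebra -/

section symco
variable {k : Type u} [Field k] [CharZero k]

namespace Sym
variable {V W : GrMod k}

/-- The span of the products of homogeneous generators of total degree `n`. -/
noncomputable def gr (V : GrMod k) (n : ℤ) : Submodule k (Sym V) := (symGr V).gr n

/-- The linear map that multiplies the degree `n` part with `(-1)^(p n)`. -/
noncomputable def tau (V : GrMod k) (p : ℤ) : Sym V →ₗ[k] Sym V :=
  (symGr V).scale fun n => sg (p * n)

theorem tau_apply (p : ℤ) {n : ℤ} {s : Sym V} (hs : s ∈ gr V n) :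
    tau V p s = (sg (p * n) : k) • s := (symGr V).scale_apply _ hs

theorem tau_neg_one : tau V (-1) = (symGr V).sigma :=
  (symGr V).ext_gr fun n x hx => by
    refine (tau_apply (-1) hx).trans (Eq.trans ?_ ((symGr V).sigma_apply hx).symm)
    rw [sg_congr (k := k) (m := -1 * n) (n := n) (by grind)]
    rfl

theorem mon_mem {l : ℕ} {n : ℤ} {s : Sym V} (hs : IsMon V l n s) : s ∈ gr V n :=
  Submodule.subset_span ⟨l, hs⟩

theorem one_mem : (1 : Sym V) ∈ gr V 0 := mon_mem .one

theorem gr_le {n : ℤ} {P : Submodule k (Sym V)} (h : ∀ l s, IsMon V l n s → s ∈ P) :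
    gr V n ≤ P := Submodule.span_le.2 fun _ ⟨l, hs⟩ => h l _ hs

theorem L_mem {m n : ℤ} {v : V.carrier} (hv : v ∈ V.gr m) {s : Sym V} (hs : s ∈ gr V n) :
    L V v s ∈ gr V (m + n) := by
  have : gr V n ≤ (gr V (m + n)).comap (L V v) := gr_le fun l s hs => mon_mem (.cons hv hs)
  exact this hs

theorem deg_of {p : ℤ} {M : Type u} [AddCommGroup M] [Module k M] {Q : ℤ → Submodule k M}
    {F : Sym V →ₗ[k] M} (h₁ : F 1 ∈ Q p)
    (h : ∀ m, ∀ v ∈ V.gr m, ∀ n, ∀ s ∈ gr V n, F s ∈ Q (n + p) → F (L V v s) ∈ Q (m + n + p))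
    {n : ℤ} {s : Sym V} (hs : s ∈ gr V n) : F s ∈ Q (n + p) := by
  have : gr V n ≤ (Q (n + p)).comap F := gr_le fun l s hs' => by
    clear hs
    induction hs' with
    | one => rwa [Submodule.mem_comap, zero_add]
    | cons hv hs ih => exact h _ _ hv _ _ (mon_mem hs) ih
  exact this hs

theorem ext_tensor {M : Type*} [AddCommGroup M] [Module k M] {f g : (Sym V ⊗[k] Sym V) →ₗ[k] M}
    (h : ∀ m n, ∀ x ∈ gr V m, ∀ y ∈ gr V n, f (x ⊗ₜ y) = g (x ⊗ₜ y)) : f = g :=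
  (symGr V).ext_gr₂ (symGr V) h

/-- The operator `s ⊗ t ↦ v s ⊗ t + (-1)^(|v| |s|) s ⊗ v t`. -/
noncomputable def rho (V : GrMod k) :
    V.carrier →ₗ[k] (Sym V ⊗[k] Sym V) →ₗ[k] (Sym V ⊗[k] Sym V) :=
  (TensorProduct.mapBilinear (RingHom.id k) (Sym V) (Sym V) (Sym V) (Sym V)).flip LinearMap.id ∘ₗ
    L V + TensorProduct.mapBilinear (RingHom.id k) (Sym V) (Sym V) (Sym V) (Sym V) LinearMap.id ∘ₗ
    L V ∘ₗ V.even + TensorProduct.mapBilinear (RingHom.id k) (Sym V) (Sym V) (Sym V) (Sym V)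
      (tau V 1) ∘ₗ L V ∘ₗ V.odd

theorem rho_tmul {m i : ℤ} {v : V.carrier} (hv : v ∈ V.gr m) {s : Sym V} (hs : s ∈ gr V i)
    (t : Sym V) :
    rho V v (s ⊗ₜ t) = L V v s ⊗ₜ t + (sg (m * i) : k) • (s ⊗ₜ[k] L V v t) := by
  have := V.parity_apply (TensorProduct.mk k (Sym V) (Sym V) s ∘ₗ (L V).flip t)
    (TensorProduct.mk k (Sym V) (Sym V) (tau V 1 s) ∘ₗ (L V).flip t) hv
  simp only [LinearMap.comp_apply, LinearMap.flip_apply, TensorProduct.mk_apply] at this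
  simp only [rho, LinearMap.add_apply, LinearMap.comp_apply, LinearMap.flip_apply,
    TensorProduct.mapBilinear_apply, TensorProduct.map_tmul, LinearMap.id_apply, add_assoc, this]
  congr 1
  split_ifs with h
  · rw [sg_even (h.mul_right i), one_smul]
  · rw [tau_apply 1 hs, ← TensorProduct.smul_tmul']
    congr 1
    apply sg_congr
    simp only [Int.even_sub, Int.even_mul]
    simp [h]

theorem rho_comm ⦃m n : ℤ⦄ ⦃x y : V.carrier⦄ (hx : x ∈ V.gr m) (hy : y ∈ V.gr n)
    (z : Sym V ⊗[k] Sym V) :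
    rho V x (rho V y z) = (sg (m * n) : k) • rho V y (rho V x z) := by
  have : rho V x ∘ₗ rho V y = (sg (m * n) : k) • rho V y ∘ₗ rho V x :=
    ext_tensor fun i j s hs t ht => by
      simp only [LinearMap.comp_apply, LinearMap.smul_apply, rho_tmul hx hs, rho_tmul hy hs,
        map_add, map_smul, rho_tmul hx (L_mem hy hs), rho_tmul hy (L_mem hx hs), L_comm hx hy s,
        L_comm hx hy t, TensorProduct.tmul_smul, ← TensorProduct.smul_tmul', smul_add, smul_smul,
        ← sg_add]
      rw [sg_congr (k := k) (m := m * n + (m * i + n * i)) (n := n * i + (m * i + m * n)) (by grind),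
        sg_congr (k := k) (m := m * n + n * (m + i)) (n := n * i) (by grind),
        show m * (n + i) = m * n + m * i by ring]
      module
  exact LinearMap.congr_fun this z

/-- The comultiplication: the map `Δ` with `Δ 1 = 1 ⊗ 1`, multiplicative, for which the generators
are primitive. -/
noncomputable def comul (V : GrMod k) : Sym V →ₗ[k] Sym V ⊗[k] Sym V :=
  build (rho V) rho_comm (1 ⊗ₜ 1)

theorem comul_one : comul V 1 = 1 ⊗ₜ 1 := build_one _ _ _

theorem comul_L (v : V.carrier) (s : Sym V) : comul V (L V v s) = rho V v (comul V s) :=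
  build_L _ _ _ v s

/-- The degree `n` part of `Sym V ⊗ Sym V`. -/
noncomputable def gr₂ (V : GrMod k) (n : ℤ) : Submodule k (Sym V ⊗[k] Sym V) :=
  GrMod.tensorGr (symGr V) (symGr V) n

theorem tmul_mem {i j n : ℤ} {s t : Sym V} (hs : s ∈ gr V i) (ht : t ∈ gr V j) (h : i + j = n) :
    s ⊗ₜ[k] t ∈ gr₂ V n := GrMod.tmul_mem (symGr V) (symGr V) hs ht h

theorem gr₂_le {n : ℤ} {P : Submodule k (Sym V ⊗[k] Sym V)}
    (h : ∀ i j s t, s ∈ gr V i → t ∈ gr V j → i + j = n → s ⊗ₜ[k] t ∈ P) : gr₂ V n ≤ P :=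
  Submodule.span_le.2 fun _ ⟨i, j, s, t, hs, ht, hn, e⟩ => e ▸ h i j s t hs ht hn

theorem rho_mem {m n : ℤ} {v : V.carrier} (hv : v ∈ V.gr m) {z : Sym V ⊗[k] Sym V}
    (hz : z ∈ gr₂ V n) : rho V v z ∈ gr₂ V (m + n) := by
  have : gr₂ V n ≤ (gr₂ V (m + n)).comap (rho V v) := gr₂_le fun i j s t hs ht h => by
    rw [Submodule.mem_comap, rho_tmul hv hs]
    exact Submodule.add_mem _ (tmul_mem (L_mem hv hs) ht (by omega))
      (Submodule.smul_mem _ _ (tmul_mem hs (L_mem hv ht) (by omega)))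
  exact this hz

theorem comul_mem {n : ℤ} {s : Sym V} (hs : s ∈ gr V n) : comul V s ∈ gr₂ V n := by
  have := deg_of (p := 0) (Q := gr₂ V) (F := comul V)
    (by rw [comul_one]; exact tmul_mem one_mem one_mem rfl)
    (fun m v hv n s _ h => by
      rw [comul_L, add_assoc]
      exact rho_mem hv h) hs
  rwa [add_zero] at this

/-- The braiding of `Sym V ⊗ Sym V`. -/
noncomputable def swap (V : GrMod k) : (Sym V ⊗[k] Sym V) →ₗ[k] (Sym V ⊗[k] Sym V) :=
  GrMod.braid (symGr V) (symGr V)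

theorem swap_tmul {i j : ℤ} {s t : Sym V} (hs : s ∈ gr V i) (ht : t ∈ gr V j) :
    swap V (s ⊗ₜ t) = (sg (i * j) : k) • (t ⊗ₜ[k] s) :=
  GrMod.braid_apply (symGr V) (symGr V) hs ht

theorem cocomm : swap V ∘ₗ comul V = comul V := by
  refine ext ?_ fun m v hv s hs => ?_
  · rw [LinearMap.comp_apply, comul_one, swap_tmul one_mem one_mem, sg_even (by simp), one_smul]
  · have key : swap V ∘ₗ rho V v = rho V v ∘ₗ swap V := ext_tensor fun i j s hs t ht => by
      simp only [LinearMap.comp_apply, rho_tmul hv hs, map_add, map_smul, swap_tmul hs ht,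
        swap_tmul (L_mem hv hs) ht, swap_tmul hs (L_mem hv ht), rho_tmul hv ht, smul_add, smul_smul,
        ← sg_add]
      rw [sg_congr (k := k) (m := m * i + i * (m + j)) (n := i * j) (by grind),
        show (m + i) * j = i * j + m * j by ring]
      module
    rw [LinearMap.comp_apply] at hs
    have := LinearMap.congr_fun key (comul V s)
    rw [LinearMap.comp_apply, LinearMap.comp_apply, hs] at this
    rw [LinearMap.comp_apply, comul_L, this]

theorem coassoc : (TensorProduct.assoc k (Sym V) (Sym V) (Sym V)).toLinearMap ∘ₗ
    (comul V).rTensor (Sym V) ∘ₗ comul V = (comul V).lTensor (Sym V) ∘ₗ comul V := by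
  refine ext (by simp [comul_one]) fun m v hv s hs => ?_
  let r : (Sym V ⊗[k] (Sym V ⊗[k] Sym V)) →ₗ[k] (Sym V ⊗[k] (Sym V ⊗[k] Sym V)) :=
    TensorProduct.map (L V v) LinearMap.id + TensorProduct.map (tau V m) (rho V v)
  have h₁ : (comul V).lTensor (Sym V) ∘ₗ rho V v = r ∘ₗ (comul V).lTensor (Sym V) :=
    ext_tensor fun i j s hs t ht => by
      simp only [LinearMap.comp_apply, rho_tmul hv hs, map_add, map_smul, LinearMap.lTensor_tmul,
        comul_L, r, LinearMap.add_apply, TensorProduct.map_tmul, tau_apply m hs, LinearMap.id_apply,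
        ← TensorProduct.smul_tmul']
  have h₂ : (TensorProduct.assoc k (Sym V) (Sym V) (Sym V)).toLinearMap ∘ₗ
      (comul V).rTensor (Sym V) ∘ₗ rho V v =
      r ∘ₗ (TensorProduct.assoc k (Sym V) (Sym V) (Sym V)).toLinearMap ∘ₗ
        (comul V).rTensor (Sym V) := ext_tensor fun i j s hs t ht => by
    simp only [LinearMap.comp_apply, rho_tmul hv hs, map_add, map_smul, LinearMap.rTensor_tmul,
      comul_L]
    have : gr₂ V i ≤ LinearMap.eqLocus
        ((TensorProduct.assoc k (Sym V) (Sym V) (Sym V)).toLinearMap ∘ₗ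
          ((TensorProduct.mk k (Sym V ⊗[k] Sym V) (Sym V)).flip t ∘ₗ rho V v +
            (sg (m * i) : k) • (TensorProduct.mk k (Sym V ⊗[k] Sym V) (Sym V)).flip (L V v t)))
        (r ∘ₗ (TensorProduct.assoc k (Sym V) (Sym V) (Sym V)).toLinearMap ∘ₗ
          (TensorProduct.mk k (Sym V ⊗[k] Sym V) (Sym V)).flip t) :=
      gr₂_le fun a b x y hx hy hab => by
        subst hab
        simp only [LinearMap.mem_eqLocus, LinearMap.comp_apply, LinearMap.add_apply,
          LinearMap.smul_apply, LinearMap.flip_apply, TensorProduct.mk_apply, rho_tmul hv hx,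
          map_add, map_smul, TensorProduct.add_tmul, ← TensorProduct.smul_tmul',
          LinearEquiv.coe_coe, TensorProduct.assoc_tmul, r, TensorProduct.map_tmul,
          LinearMap.id_apply, tau_apply m hx, rho_tmul hv hy, TensorProduct.tmul_add,
          TensorProduct.tmul_smul, smul_add, smul_smul, ← sg_add]
        rw [mul_add, add_comm (m * b)]
        module
    have := this (comul_mem hs)
    simpa only [LinearMap.mem_eqLocus, LinearMap.comp_apply, LinearMap.add_apply,
      LinearMap.smul_apply, LinearMap.flip_apply, TensorProduct.mk_apply, map_add, map_smul]
      using this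
  have h₃ := LinearMap.congr_fun h₁ (comul V s)
  have h₄ := LinearMap.congr_fun h₂ (comul V s)
  simp only [LinearMap.comp_apply] at h₃ h₄ hs ⊢
  rw [comul_L, h₃, h₄, hs]

/-- The operator `s ⊗ t ↦ F s ⊗ t + (-1)^(p |s|) s ⊗ F t`. -/
noncomputable def two (p : ℤ) (F : Sym V →ₗ[k] Sym V) : (Sym V ⊗[k] Sym V) →ₗ[k] (Sym V ⊗[k] Sym V) :=
  TensorProduct.map F LinearMap.id + TensorProduct.map (tau V p) F

theorem two_tmul (p : ℤ) (F : Sym V →ₗ[k] Sym V) {i : ℤ} {s : Sym V} (hs : s ∈ gr V i)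
    (t : Sym V) : two p F (s ⊗ₜ t) = F s ⊗ₜ t + (sg (p * i) : k) • (s ⊗ₜ[k] F t) := by
  simp only [two, LinearMap.add_apply, TensorProduct.map_tmul, LinearMap.id_apply, tau_apply p hs,
    ← TensorProduct.smul_tmul']

theorem rho_eq {m : ℤ} {v : V.carrier} (hv : v ∈ V.gr m) : rho V v = two m (L V v) :=
  ext_tensor fun i j s hs t _ => by rw [rho_tmul hv hs, two_tmul m _ hs]

/-- A criterion for coderivations. -/
theorem coder_of {p : ℤ} {F : Sym V →ₗ[k] Sym V}
    (hF : ∀ n, ∀ s ∈ gr V n, F s ∈ gr V (n + p)) (h₁ : F 1 = 0)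
    (A : V.carrier →ₗ[k] Sym V →ₗ[k] Sym V)
    (hA : ∀ m, ∀ v ∈ V.gr m, ∀ s,
      F (L V v s) = (sg (p * m) : k) • L V v (F s) + A v s)
    (hc : ∀ m, ∀ v ∈ V.gr m, ∀ s, comul V (A v s) =
      two (p + m) (A v) (comul V s)) :
    comul V ∘ₗ F = two p F ∘ₗ comul V := by
  refine ext ?_ fun m v hv s hs => ?_
  · rw [LinearMap.comp_apply, LinearMap.comp_apply, h₁, comul_one, two_tmul p F one_mem, h₁]
    simp
  · have key : two p F ∘ₗ rho V v = (sg (p * m) : k) • rho V v ∘ₗ two p F + two (p + m) (A v) :=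
      ext_tensor fun i j s hs t ht => by
        simp only [LinearMap.comp_apply, LinearMap.add_apply, LinearMap.smul_apply, rho_tmul hv hs,
          map_add, map_smul, two_tmul p F hs, two_tmul p F (L_mem hv hs), two_tmul _ (A v) hs,
          rho_tmul hv (hF _ _ hs), hA m v hv, TensorProduct.add_tmul, TensorProduct.tmul_add,
          TensorProduct.tmul_smul, ← TensorProduct.smul_tmul', smul_add, smul_smul, ← sg_add]
        rw [sg_congr (k := k) (m := p * m + m * (i + p)) (n := m * i) (by grind),
          show p * (m + i) = p * m + p * i by ring,
          sg_congr (k := k) (m := m * i + (p * i + p * m)) (n := p * m + (p * i + m * i)) (by grind),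
          show (p + m) * i = m * i + p * i by ring]
        module
    have := LinearMap.congr_fun key (comul V s)
    simp only [LinearMap.comp_apply, LinearMap.add_apply, LinearMap.smul_apply] at this hs ⊢
    rw [comul_L, this, hA m v hv, map_add, map_smul, comul_L, hs, hc m v hv]

theorem der_mem {p : ℤ} {δ : V.carrier →ₗ[k] V.carrier} (hδ : GrMod.IsHom V V p δ) {n : ℤ}
    {s : Sym V} (hs : s ∈ gr V n) : der p δ hδ s ∈ gr V (n + p) :=
  deg_of (Q := gr V) (F := der p δ hδ) (by rw [der_one]; exact Submodule.zero_mem _)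
    (fun m v hv n s hs h => by
      rw [der_L hδ hv]
      have e₁ := L_mem hv h
      have e₂ := L_mem (hδ _ _ hv) hs
      rw [show m + (n + p) = m + n + p by ring] at e₁
      rw [show m + p + n = m + n + p by ring] at e₂
      exact Submodule.add_mem _ (Submodule.smul_mem _ _ e₁) e₂) hs

theorem der_coder {p : ℤ} {δ : V.carrier →ₗ[k] V.carrier} (hδ : GrMod.IsHom V V p δ) :
    comul V ∘ₗ der p δ hδ = two p (der p δ hδ) ∘ₗ comul V :=
  coder_of (fun _ _ hs => der_mem hδ hs) (der_one hδ) (L V ∘ₗ δ) (fun _ _ hv s => der_L hδ hv s)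
    fun m v hv s => by
      rw [LinearMap.comp_apply, comul_L, rho_eq (hδ _ _ hv), add_comm]

/-- The algebra map induced by a map of degree `0`. -/
noncomputable def map (φ : V.carrier →ₗ[k] W.carrier) (hφ : GrMod.IsHom V W 0 φ) :
    Sym V →ₗ[k] Sym W :=
  build (L W ∘ₗ φ) (fun m n x y hx hy t => by
    have h₁ := hφ _ _ hx
    have h₂ := hφ _ _ hy
    rw [add_zero] at h₁ h₂
    exact L_comm h₁ h₂ t) 1

section map
variable {φ : V.carrier →ₗ[k] W.carrier} (hφ : GrMod.IsHom V W 0 φ)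

theorem map_one : map φ hφ 1 = 1 := build_one _ _ _

theorem map_L (v : V.carrier) (s : Sym V) : map φ hφ (L V v s) = L W (φ v) (map φ hφ s) :=
  build_L _ _ _ v s

theorem map_mem {n : ℤ} {s : Sym V} (hs : s ∈ gr V n) : map φ hφ s ∈ gr W n := by
  have := deg_of (p := 0) (Q := gr W) (F := map φ hφ) (by rw [map_one]; exact one_mem)
    (fun m v hv n s _ h => by
      have h₁ := L_mem (hφ _ _ hv) h
      rw [map_L]
      rwa [show m + 0 + (n + 0) = m + n + 0 by ring] at h₁) hs
  rwa [add_zero] at this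

theorem map_comul (s : Sym V) :
    comul W (map φ hφ s) = TensorProduct.map (map φ hφ) (map φ hφ) (comul V s) := by
  have : comul W ∘ₗ map φ hφ = TensorProduct.map (map φ hφ) (map φ hφ) ∘ₗ comul V := by
    refine ext ?_ fun m v hv s hs => ?_
    · simp only [LinearMap.comp_apply, map_one, comul_one, TensorProduct.map_tmul]
    · have h₀ := hφ _ _ hv
      rw [add_zero] at h₀
      have key : TensorProduct.map (map φ hφ) (map φ hφ) ∘ₗ rho V v =
          rho W (φ v) ∘ₗ TensorProduct.map (map φ hφ) (map φ hφ) :=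
        ext_tensor fun i j s hs t ht => by
          simp only [LinearMap.comp_apply, rho_tmul hv hs, map_add, map_smul,
            TensorProduct.map_tmul, map_L, rho_tmul h₀ (map_mem hφ hs)]
      have := LinearMap.congr_fun key (comul V s)
      simp only [LinearMap.comp_apply] at this hs ⊢
      rw [map_L, comul_L, comul_L, this, hs]
  exact LinearMap.congr_fun this s

end map

/-- Elements of `Sym V ⊗ Sym V` of the form `1 ⊗ t`, with `t` a product of `l` generators, or
`s ⊗ t`, with `t` a product of less than `l` generators. -/
def Small (V : GrMod k) (l : ℕ) : Set (Sym V ⊗[k] Sym V) :=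
  {z | (∃ n t, IsMon V l n t ∧ z = 1 ⊗ₜ t) ∨ ∃ s, ∃ l' < l, ∃ n t, IsMon V l' n t ∧ z = s ⊗ₜ t}

theorem comul_small {l : ℕ} {n : ℤ} {s : Sym V} (hs : IsMon V l n s) :
    comul V s ∈ Submodule.span k (Small V l) := by
  induction hs with
  | one =>
    rw [comul_one]
    exact Submodule.subset_span (.inl ⟨0, 1, .one, rfl⟩)
  | @cons l m n v s hv hs ih =>
    rw [comul_L]
    have : Submodule.span k (Small V l) ≤ (Submodule.span k (Small V (l + 1))).comap (rho V v) := by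
      refine Submodule.span_le.2 ?_
      rintro _ (⟨n', t, ht, rfl⟩ | ⟨a, l', hl, n', t, ht, rfl⟩)
      · rw [SetLike.mem_coe, Submodule.mem_comap, rho_tmul hv one_mem, mul_zero,
          sg_even Even.zero, one_smul]
        exact Submodule.add_mem _ (Submodule.subset_span (.inr ⟨_, l, by omega, n', t, ht, rfl⟩))
          (Submodule.subset_span (.inl ⟨_, _, .cons hv ht, rfl⟩))
      · rw [SetLike.mem_coe, Submodule.mem_comap, rho_eq hv]
        exact Submodule.add_mem _ (Submodule.subset_span (.inr ⟨_, l', by omega, n', t, ht, rfl⟩))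
          (Submodule.subset_span (.inr ⟨_, _, by omega, _, _, .cons hv ht, rfl⟩))
    exact this ih

end Sym

end symco

/-! ### The Chevalley-Eilenberg differential -/

section ce
variable {k : Type u} [Field k] [CharZero k]

/-- The free graded commutative algebra on `Σ⁻¹g`. -/
abbrev CE (g : DGLie k) : Type u := Sym (g.shift (-1))

namespace CE
variable {g h : DGLie k}

/-- Multiplication by the generator `Σ⁻¹x`, which has degree `|x| + 1`. -/
noncomputable def T (g : DGLie k) : g.carrier →ₗ[k] CE g →ₗ[k] CE g := Sym.L (g.shift (-1))

/-- The degree `n` part of `CE g`. -/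
noncomputable def gr (g : DGLie k) (n : ℤ) : Submodule k (CE g) := Sym.gr (g.shift (-1)) n

theorem mem_shift {a : ℤ} {x : g.carrier} (hx : x ∈ g.gr a) : x ∈ (g.shift (-1)).gr (a + 1) := by
  change x ∈ g.gr (a + 1 + -1)
  rwa [add_neg_cancel_right]

theorem of_mem_shift {m : ℤ} {x : g.carrier} (hx : x ∈ (g.shift (-1)).gr m) : x ∈ g.gr (m - 1) :=
  hx

theorem T_comm {a b : ℤ} {x y : g.carrier} (hx : x ∈ g.gr a) (hy : y ∈ g.gr b) (s : CE g) :
    T g x (T g y s) = (sg ((a + 1) * (b + 1)) : k) • T g y (T g x s) :=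
  Sym.L_comm (mem_shift hx) (mem_shift hy) s

theorem T_mem {a n : ℤ} {x : g.carrier} (hx : x ∈ g.gr a) {s : CE g} (hs : s ∈ gr g n) :
    T g x s ∈ gr g (a + 1 + n) := Sym.L_mem (mem_shift hx) hs

theorem ext {M : Type*} [AddCommGroup M] [Module k M] {F G : CE g →ₗ[k] M} (h₁ : F 1 = G 1)
    (h : ∀ a, ∀ x ∈ g.gr a, ∀ s, F s = G s → F (T g x s) = G (T g x s)) : F = G :=
  Sym.ext h₁ fun m v hv s hs => h (m - 1) v hv s hs

theorem shift_isHom {p : ℤ} {δ : g.carrier →ₗ[k] g.carrier}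
    (hδ : GrMod.IsHom g.toGrMod g.toGrMod p δ) :
    GrMod.IsHom (g.shift (-1)) (g.shift (-1)) p δ := fun n x hx => by
  have := mem_shift (hδ _ x (of_mem_shift hx))
  rwa [show n - 1 + p + 1 = n + p by ring] at this

/-- The derivation of `CE g` of degree `p` with `Σ⁻¹x ↦ Σ⁻¹(δ x)`. -/
noncomputable def der (p : ℤ) (δ : g.carrier →ₗ[k] g.carrier)
    (hδ : GrMod.IsHom g.toGrMod g.toGrMod p δ) : CE g →ₗ[k] CE g :=
  Sym.der (V := g.shift (-1)) p δ (shift_isHom hδ)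

section der
variable {p : ℤ} {δ : g.carrier →ₗ[k] g.carrier} (hδ : GrMod.IsHom g.toGrMod g.toGrMod p δ)

theorem der_one : der p δ hδ 1 = 0 := Sym.der_one _

theorem der_T {a : ℤ} {x : g.carrier} (hx : x ∈ g.gr a) (s : CE g) :
    der p δ hδ (T g x s) = (sg (p * (a + 1)) : k) • T g x (der p δ hδ s) + T g (δ x) s :=
  Sym.der_L (shift_isHom hδ) (mem_shift hx) s

end der

theorem ad_isHom {a : ℤ} {x : g.carrier} (hx : x ∈ g.gr a) :
    GrMod.IsHom g.toGrMod g.toGrMod a ((sg a : k) • g.bracket x) := fun n y hy => by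
  rw [add_comm]
  exact Submodule.smul_mem _ _ (g.bracket_mem hx hy)

/-- The derivation of degree `|x|` with `Σ⁻¹y ↦ (-1)^|x| Σ⁻¹[x, y]`. -/
noncomputable def theta (g : DGLie k) : g.carrier →ₗ[k] CE g →ₗ[k] CE g :=
  g.desc fun a =>
    { toFun := fun x => der a ((sg a : k) • g.bracket x.1) (ad_isHom x.2)
      map_add' := fun x y => ext (by simp [der_one]) fun b z hz s hs => by
        rw [LinearMap.add_apply] at hs
        rw [LinearMap.add_apply, der_T _ hz, der_T _ hz, der_T _ hz, hs]
        simp only [LinearMap.add_apply, Submodule.coe_add, map_add, smul_add, LinearMap.smul_apply]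
        module
      map_smul' := fun c x => ext (by simp [der_one]) fun b z hz s hs => by
        rw [LinearMap.smul_apply] at hs
        rw [LinearMap.smul_apply, der_T _ hz, der_T _ hz, hs]
        simp only [LinearMap.smul_apply, Submodule.coe_smul, map_smul, RingHom.id_apply]
        module }

section theta
variable {a : ℤ} {x : g.carrier}

theorem theta_eq (hx : x ∈ g.gr a) : theta g x = der a ((sg a : k) • g.bracket x) (ad_isHom hx) :=
  g.desc_apply _ hx

theorem theta_one (hx : x ∈ g.gr a) : theta g x 1 = 0 := by rw [theta_eq hx, der_one]

theorem theta_T (hx : x ∈ g.gr a) {b : ℤ} {y : g.carrier} (hy : y ∈ g.gr b) (s : CE g) :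
    theta g x (T g y s) =
      (sg (a * (b + 1)) : k) • T g y (theta g x s) + (sg a : k) • T g (g.bracket x y) s := by
  rw [theta_eq hx, der_T _ hy, LinearMap.smul_apply, map_smul, LinearMap.smul_apply]

theorem theta_bracket (hx : x ∈ g.gr a) {b : ℤ} {y : g.carrier} (hy : y ∈ g.gr b) (s : CE g) :
    theta g (g.bracket x y) s =
      theta g x (theta g y s) - (sg (a * b) : k) • theta g y (theta g x s) := by
  have hxy := g.bracket_mem hx hy
  have : theta g (g.bracket x y) =
      theta g x ∘ₗ theta g y - (sg (a * b) : k) • theta g y ∘ₗ theta g x := by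
    refine ext ?_ fun c z hz s hs => ?_
    · simp [theta_one hx, theta_one hy, theta_one hxy]
    · have hj := g.jacobi hx hy hz
      rw [← sub_eq_iff_eq_add] at hj
      simp only [LinearMap.sub_apply, LinearMap.smul_apply, LinearMap.comp_apply] at hs ⊢
      simp only [theta_T hxy hz, theta_T hx hz, theta_T hy hz, map_add, map_smul,
        theta_T hx (g.bracket_mem hy hz), theta_T hy (g.bracket_mem hx hz), hs, ← hj, map_sub,
        LinearMap.sub_apply, LinearMap.smul_apply, smul_add, smul_sub, smul_smul, ← sg_add]
      rw [sg_congr (k := k) (m := b + a * (b + c + 1)) (n := a * b + (a * (c + 1) + b)) (by grind),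
        sg_congr (k := k) (m := a * b + (a + b * (a + c + 1))) (n := b * (c + 1) + a) (by grind),
        show (a + b) * (c + 1) = b * (c + 1) + a * (c + 1) by ring, add_comm _ (a * b),
        add_comm b a, add_comm (b * (c + 1)) (a * (c + 1)), add_comm (a + b) (a * b)]
      module
  exact LinearMap.congr_fun this s

end theta

end CE

end ce

section ce
variable {k : Type u} [Field k] [CharZero k]

namespace CE
variable {g h : DGLie k}

/-- The operator `-Σ⁻¹(d x) + θ_x`, the graded commutator of the differential with `Σ⁻¹x`. -/
noncomputable def diffA (g : DGLie k) : g.carrier →ₗ[k] CE g →ₗ[k] CE g :=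
  -(T g ∘ₗ g.d) + theta g

theorem diffA_apply (x : g.carrier) (s : CE g) : diffA g x s = -T g (g.d x) s + theta g x s := rfl

theorem diffA_comm {a b : ℤ} {x y : g.carrier} (hx : x ∈ g.gr a) (hy : y ∈ g.gr b) (s : CE g) :
    (sg (-1 * (a + 1)) : k) • T g x (diffA g y s) + diffA g x (T g y s) =
      (sg ((a + 1) * (b + 1)) : k) •
        ((sg (-1 * (b + 1)) : k) • T g y (diffA g x s) + diffA g y (T g x s)) := by
  simp only [diffA_apply, theta_T hx hy, theta_T hy hx, T_comm (g.d_mem hx) hy,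
    T_comm (g.d_mem hy) hx, g.bracket_anti hx hy, map_neg, map_add, map_smul, LinearMap.neg_apply,
    LinearMap.smul_apply, smul_add, smul_neg, smul_smul, ← sg_add]
  rw [sg_congr (k := k) (m := (a - 1 + 1) * (b + 1)) (n := (a + 1) * (b + 1) + -1 * (b + 1))
      (by grind),
    sg_congr (k := k) (m := (a + 1) * (b + 1) + (b - 1 + 1) * (a + 1)) (n := -1 * (a + 1))
      (by grind),
    sg_congr (k := k) (m := (a + 1) * (b + 1) + b * (a + 1)) (n := -1 * (a + 1))
      (by grind),
    sg_congr (k := k) (m := (a + 1) * (b + 1) + -1 * (b + 1)) (n := a * (b + 1))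
      (by grind),
    sg_congr (k := k) (m := (a + 1) * (b + 1) + b) (n := a + a * b + 1) (by grind), ← neg_sg]
  module

theorem diffA_comm' ⦃m n : ℤ⦄ ⦃x y : (g.shift (-1)).carrier⦄ (hx : x ∈ (g.shift (-1)).gr m)
    (hy : y ∈ (g.shift (-1)).gr n) (s : CE g) :
    (sg (-1 * m) : k) • Sym.L (g.shift (-1)) x (diffA g y s) +
      diffA g x (Sym.L (g.shift (-1)) y s) =
      (sg (m * n) : k) • ((sg (-1 * n) : k) • Sym.L (g.shift (-1)) y (diffA g x s) +
        diffA g y (Sym.L (g.shift (-1)) x s)) := by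
  have := diffA_comm (of_mem_shift hx) (of_mem_shift hy) s
  rwa [sub_add_cancel, sub_add_cancel] at this

/-- The differential, of degree `-1`: `D 1 = 0` and
`D (Σ⁻¹x s) = -Σ⁻¹(d x) s - (-1)^|x| Σ⁻¹x D s + θ_x s`. On a product `Σ⁻¹x₁ ⋯ Σ⁻¹xₙ` it is the sum
of the terms that replace a factor `Σ⁻¹xᵢ` by `-Σ⁻¹(d xᵢ)` and of those that replace two factors
`Σ⁻¹xᵢ`, `Σ⁻¹xⱼ` by `(-1)^|xᵢ| Σ⁻¹[xᵢ, xⱼ]`, with Koszul signs. -/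
noncomputable def D (g : DGLie k) : CE g →ₗ[k] CE g :=
  Sym.twist (V := g.shift (-1)) (-1) (diffA g) diffA_comm'

theorem D_one : D g 1 = 0 := Sym.twist_one _ _ _

theorem D_T' {a : ℤ} {x : g.carrier} (hx : x ∈ g.gr a) (s : CE g) :
    D g (T g x s) = (sg (-1 * (a + 1)) : k) • T g x (D g s) + diffA g x s :=
  Sym.twist_L (V := g.shift (-1)) (-1) (diffA g) diffA_comm' (mem_shift hx) s

theorem D_T {a : ℤ} {x : g.carrier} (hx : x ∈ g.gr a) (s : CE g) :
    D g (T g x s) = -T g (g.d x) s - (sg a : k) • T g x (D g s) + theta g x s := by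
  rw [D_T' hx, diffA_apply, sg_congr (k := k) (m := -1 * (a + 1)) (n := a + 1) (by grind), ← neg_sg]
  module

theorem theta_mem {a n : ℤ} {x : g.carrier} (hx : x ∈ g.gr a) {s : CE g} (hs : s ∈ gr g n) :
    theta g x s ∈ gr g (n + a) := by
  rw [theta_eq hx]
  exact Sym.der_mem (shift_isHom (ad_isHom hx)) hs

theorem diffA_mem {a n : ℤ} {x : g.carrier} (hx : x ∈ g.gr a) {s : CE g} (hs : s ∈ gr g n) :
    diffA g x s ∈ gr g (n + a) := by
  have := T_mem (g.d_mem hx) hs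
  rw [show a - 1 + 1 + n = n + a by ring] at this
  exact Submodule.add_mem _ (Submodule.neg_mem _ this) (theta_mem hx hs)

theorem D_mem {n : ℤ} {s : CE g} (hs : s ∈ gr g n) : D g s ∈ gr g (n + -1) :=
  Sym.deg_of (V := g.shift (-1)) (Q := gr g) (F := D g)
    (by rw [D_one]; exact Submodule.zero_mem _)
    (fun m v hv n s hs h => by
      have e := D_T' (of_mem_shift hv) s
      have e₁ := T_mem (of_mem_shift hv) h
      have e₂ := diffA_mem (of_mem_shift hv) hs
      rw [show m - 1 + 1 + (n + -1) = m + n + -1 by ring] at e₁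
      rw [show n + (m - 1) = m + n + -1 by ring] at e₂
      refine (congrArg (· ∈ gr g (m + n + -1)) e).mpr ?_
      exact Submodule.add_mem _ (Submodule.smul_mem _ _ e₁) e₂) hs

theorem D_theta {a : ℤ} {x : g.carrier} (hx : x ∈ g.gr a) (s : CE g) :
    D g (theta g x s) = (sg a : k) • theta g x (D g s) + theta g (g.d x) s := by
  have hdx := g.d_mem hx
  have : D g ∘ₗ theta g x = (sg a : k) • theta g x ∘ₗ D g + theta g (g.d x) := by
    refine ext ?_ fun b y hy s hs => ?_
    · simp [theta_one hx, theta_one hdx, D_one]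
    · have hdy := g.d_mem hy
      have hxy := g.bracket_mem hx hy
      simp only [LinearMap.add_apply, LinearMap.smul_apply, LinearMap.comp_apply] at hs ⊢
      simp only [theta_T hx hy, theta_T hdx hy, map_add, map_smul, D_T' hy, D_T' hxy, diffA_apply,
        map_neg, hs, theta_T hx hdy, g.leibniz hx y, LinearMap.add_apply, LinearMap.smul_apply,
        theta_bracket hx hy, smul_add, smul_sub, smul_neg, smul_smul, ← sg_add]
      rw [sg_congr (k := k) (m := a * (b + 1) + (-1 * (b + 1) + a)) (n := a + (-1 * (b + 1) + a * (b + 1))) (by grind),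
        show (a - 1) * (b + 1) = a * (b + 1) + -1 * (b + 1) by ring,
        sg_congr (k := k) (m := a + a * (b - 1 + 1)) (n := a * (b + 1)) (by grind),
        show a + a * b = a * (b + 1) by ring,
        sg_congr (k := k) (m := a + -1 * (a + b + 1)) (n := a + (-1 * (b + 1) + a)) (by grind),
        sg_congr (k := k) (m := a - 1) (n := a + 1) (by grind), ← neg_sg]
      module
  exact LinearMap.congr_fun this s

theorem D_D (s : CE g) : D g (D g s) = 0 := by
  have : D g ∘ₗ D g = 0 := by
    refine ext ?_ fun a x hx s hs => ?_
    · simp [D_one]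
    · simp only [LinearMap.comp_apply, LinearMap.zero_apply] at hs ⊢
      simp only [D_T hx, D_T (g.d_mem hx), map_add, map_sub, map_neg, map_smul, hs, D_theta hx,
        g.d_d, LinearMap.zero_apply, map_zero]
      rw [sub_eq_add_neg a, sg_add, sg_neg_one]
      module
  exact LinearMap.congr_fun this s

theorem diffA_coder {a : ℤ} {x : g.carrier} (hx : x ∈ g.gr a) (s : CE g) :
    Sym.comul (g.shift (-1)) (diffA g x s) =
      Sym.two (V := g.shift (-1)) a (diffA g x) (Sym.comul (g.shift (-1)) s) := by
  have h₁ := LinearMap.congr_fun (Sym.der_coder (shift_isHom (ad_isHom hx))) s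
  have h₂ : Sym.comul (g.shift (-1)) (T g (g.d x) s) =
      Sym.rho (g.shift (-1)) (g.d x) (Sym.comul (g.shift (-1)) s) := Sym.comul_L _ _
  have h₃ : Sym.rho (g.shift (-1)) (g.d x) = Sym.two (V := g.shift (-1)) a (T g (g.d x)) := by
    have := Sym.rho_eq (mem_shift (g.d_mem hx))
    rwa [sub_add_cancel] at this
  have h₄ : theta g x = Sym.der (V := g.shift (-1)) a ((sg a : k) • g.bracket x)
    (shift_isHom (ad_isHom hx)) := theta_eq hx
  have h₅ : Sym.two (V := g.shift (-1)) a (diffA g x) =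
      -Sym.two (V := g.shift (-1)) a (T g (g.d x)) +
        Sym.two (V := g.shift (-1)) a (theta g x) := by
    refine TensorProduct.ext' fun s t => ?_
    simp only [Sym.two, LinearMap.add_apply, LinearMap.neg_apply, TensorProduct.map_tmul,
      diffA_apply, TensorProduct.add_tmul, TensorProduct.tmul_add, TensorProduct.neg_tmul,
      TensorProduct.tmul_neg]
    abel
  rw [h₅, diffA_apply, map_add, map_neg, h₂, h₃, h₄]
  exact congrArg _ h₁

theorem D_coder : Sym.comul (g.shift (-1)) ∘ₗ D g =
    Sym.two (V := g.shift (-1)) (-1) (D g) ∘ₗ Sym.comul (g.shift (-1)) :=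
  Sym.coder_of (V := g.shift (-1)) (fun _ _ hs => D_mem hs) D_one (diffA g)
    (fun _ _ hv s => Sym.twist_L (V := g.shift (-1)) (-1) (diffA g) diffA_comm' hv s)
    fun m v hv s => by
      have := diffA_coder (of_mem_shift hv) s
      rwa [show m - 1 = -1 + m by ring] at this

/-- The algebra map induced by a morphism of dg Lie algebras. -/
noncomputable def map (φ : g ⟶ h) : CE g →ₗ[k] CE h :=
  Sym.map (V := g.shift (-1)) (W := h.shift (-1)) φ.map fun n x hx => by
    rw [add_zero]
    exact φ.map_mem hx

theorem map_one (φ : g ⟶ h) : map φ 1 = 1 := Sym.map_one _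

theorem map_T (φ : g ⟶ h) (x : g.carrier) (s : CE g) :
    map φ (T g x s) = T h (φ.map x) (map φ s) := Sym.map_L _ _ _

theorem map_mem (φ : g ⟶ h) {n : ℤ} {s : CE g} (hs : s ∈ gr g n) : map φ s ∈ gr h n :=
  Sym.map_mem _ hs

theorem map_comul (φ : g ⟶ h) (s : CE g) : Sym.comul (h.shift (-1)) (map φ s) =
    TensorProduct.map (map φ) (map φ) (Sym.comul (g.shift (-1)) s) := Sym.map_comul _ s

theorem map_id (g : DGLie k) (s : CE g) : map (𝟙 g) s = s := by
  have : map (𝟙 g) = LinearMap.id := ext (map_one _) fun a x hx s hs => by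
    rw [map_T, hs]
    rfl
  exact LinearMap.congr_fun this s

theorem map_comp {l : DGLie k} (φ : g ⟶ h) (ψ : h ⟶ l) (s : CE g) :
    map (φ ≫ ψ) s = map ψ (map φ s) := by
  have : map (φ ≫ ψ) = map ψ ∘ₗ map φ := ext (by simp [map_one]) fun a x hx s hs => by
    rw [LinearMap.comp_apply] at hs ⊢
    rw [map_T, hs, map_T, map_T]
    rfl
  exact LinearMap.congr_fun this s

theorem map_theta (φ : g ⟶ h) {a : ℤ} {x : g.carrier} (hx : x ∈ g.gr a) (s : CE g) :
    map φ (theta g x s) = theta h (φ.map x) (map φ s) := by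
  have hφ := φ.map_mem hx
  have : map φ ∘ₗ theta g x = theta h (φ.map x) ∘ₗ map φ := by
    refine ext ?_ fun b y hy s hs => ?_
    · simp [theta_one hx, theta_one hφ, map_one]
    · simp only [LinearMap.comp_apply] at hs ⊢
      simp only [theta_T hx hy, map_add, map_smul, map_T, theta_T hφ (φ.map_mem hy), hs,
        φ.map_bracket]
  exact LinearMap.congr_fun this s

theorem map_D (φ : g ⟶ h) (s : CE g) : map φ (D g s) = D h (map φ s) := by
  have : map φ ∘ₗ D g = D h ∘ₗ map φ := by
    refine ext ?_ fun a x hx s hs => ?_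
    · simp [D_one, map_one]
    · simp only [LinearMap.comp_apply] at hs ⊢
      simp only [D_T hx, D_T (φ.map_mem hx), map_add, map_sub, map_neg, map_smul, map_T, hs,
        φ.map_d, map_theta φ hx]
  exact LinearMap.congr_fun this s

end CE

end ce

/-! ### The cofree conilpotent cocommutative coalgebra and the bar construction -/

section bar
variable {k : Type u} [Field k] [CharZero k]

/-- The quotient of the free graded commutative algebra by the line spanned by `1`; it is the
sum of the symmetric powers of positive exponent. -/
abbrev Red (V : GrMod k) : Type u := Sym V ⧸ Submodule.span k {(1 : Sym V)}

namespace Red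
variable {V W : GrMod k}

/-- The projection. -/
noncomputable def q (V : GrMod k) : Sym V →ₗ[k] Red V := Submodule.mkQ _

theorem q_one : q V 1 = 0 :=
  (Submodule.Quotient.mk_eq_zero _).2 (Submodule.mem_span_singleton_self _)

theorem q_surjective : Function.Surjective (q V) := Submodule.mkQ_surjective _

theorem ext {M : Type*} [AddCommGroup M] [Module k M] {f g : Red V →ₗ[k] M}
    (h : f ∘ₗ q V = g ∘ₗ q V) : f = g := Submodule.linearMap_qext _ h

/-- The linear map on the quotient induced by a linear map that vanishes at `1`. -/
noncomputable def desc {M : Type*} [AddCommGroup M] [Module k M] (F : Sym V →ₗ[k] M)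
    (h : F 1 = 0) : Red V →ₗ[k] M :=
  Submodule.liftQ _ F ((Submodule.span_singleton_le_iff_mem _ _).2 h)

theorem desc_q {M : Type*} [AddCommGroup M] [Module k M] (F : Sym V →ₗ[k] M) (h : F 1 = 0)
    (s : Sym V) : desc F h (q V s) = F s := rfl

/-- The grading of the quotient. -/
noncomputable def grMod (V : GrMod k) : GrMod k where
  carrier := Red V
  gr n := (Sym.gr V n).map (q V)
  isInternal := by
    let E : Sym V →ₗ[k] Sym V := (symGr V).scale fun n => (n : k)
    have hE (n : ℤ) (s : Sym V) (hs : s ∈ Sym.gr V n) : E s = (n : k) • s :=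
      (symGr V).scale_cast hs
    refine GrMod.isInternal_of_euler (desc (q V ∘ₗ E) (by
      rw [LinearMap.comp_apply, hE 0 1 Sym.one_mem, Int.cast_zero, zero_smul, map_zero])) ?_ ?_
    · rintro n _ ⟨s, hs, rfl⟩
      rw [desc_q, LinearMap.comp_apply, hE n s hs, map_smul]
    · rw [← Submodule.map_iSup]
      have : ⨆ n, Sym.gr V n = ⊤ := (symGr V).iSup_gr
      rw [this, Submodule.map_top, LinearMap.range_eq_top]
      exact q_surjective

theorem q_mem {n : ℤ} {s : Sym V} (hs : s ∈ Sym.gr V n) : q V s ∈ (grMod V).gr n :=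
  Submodule.mem_map_of_mem hs

/-- The reduced comultiplication. -/
noncomputable def comul (V : GrMod k) : Red V →ₗ[k] Red V ⊗[k] Red V :=
  desc (TensorProduct.map (q V) (q V) ∘ₗ Sym.comul V) (by
    rw [LinearMap.comp_apply, Sym.comul_one, TensorProduct.map_tmul, q_one,
      TensorProduct.zero_tmul])

theorem comul_q (s : Sym V) : comul V (q V s) = TensorProduct.map (q V) (q V) (Sym.comul V s) := rfl

theorem comul_mem {n : ℤ} {x : Red V} (hx : x ∈ (grMod V).gr n) :
    comul V x ∈ GrMod.tensorGr (grMod V) (grMod V) n := by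
  obtain ⟨s, hs, rfl⟩ := hx
  rw [comul_q]
  have : Sym.gr₂ V n ≤ Submodule.comap (TensorProduct.map (q V) (q V))
      (GrMod.tensorGr (grMod V) (grMod V) n) := Sym.gr₂_le fun i j s t hs ht h =>
    GrMod.tmul_mem (grMod V) (grMod V) (q_mem hs) (q_mem ht) h
  exact this (Sym.comul_mem hs)

theorem coassoc : (TensorProduct.assoc k (Red V) (Red V) (Red V)).toLinearMap ∘ₗ
    (comul V).rTensor (Red V) ∘ₗ comul V = (comul V).lTensor (Red V) ∘ₗ comul V := by
  refine ext (LinearMap.ext fun s => ?_)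
  have h₁ : (comul V).lTensor (Red V) ∘ₗ TensorProduct.map (q V) (q V) =
      TensorProduct.map (q V) (TensorProduct.map (q V) (q V)) ∘ₗ (Sym.comul V).lTensor (Sym V) :=
    TensorProduct.ext' fun s t => by simp [comul_q]
  have h₂ : (comul V).rTensor (Red V) ∘ₗ TensorProduct.map (q V) (q V) =
      TensorProduct.map (TensorProduct.map (q V) (q V)) (q V) ∘ₗ (Sym.comul V).rTensor (Sym V) :=
    TensorProduct.ext' fun s t => by simp [comul_q]
  have h₃ : (TensorProduct.assoc k (Red V) (Red V) (Red V)).toLinearMap ∘ₗ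
      TensorProduct.map (TensorProduct.map (q V) (q V)) (q V) =
      TensorProduct.map (q V) (TensorProduct.map (q V) (q V)) ∘ₗ
        (TensorProduct.assoc k (Sym V) (Sym V) (Sym V)).toLinearMap :=
    TensorProduct.ext_threefold fun s t r => by simp
  have h₄ := LinearMap.congr_fun (Sym.coassoc (V := V)) s
  have e₁ := LinearMap.congr_fun h₁ (Sym.comul V s)
  have e₂ := LinearMap.congr_fun h₂ (Sym.comul V s)
  have e₃ := LinearMap.congr_fun h₃ ((Sym.comul V).rTensor (Sym V) (Sym.comul V s))
  simp only [LinearMap.comp_apply] at h₄ e₁ e₂ e₃ ⊢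
  rw [comul_q, e₁, e₂, e₃, h₄]

theorem cocomm : GrMod.braid (grMod V) (grMod V) ∘ₗ comul V = comul V := by
  refine ext (LinearMap.ext fun s => ?_)
  have h : GrMod.braid (grMod V) (grMod V) ∘ₗ TensorProduct.map (q V) (q V) =
      TensorProduct.map (q V) (q V) ∘ₗ Sym.swap V := Sym.ext_tensor fun i j s hs t ht => by
    have h₁ : TensorProduct.map (q V) (q V) (Sym.swap V (s ⊗ₜ t)) =
        (sg (i * j) : k) • (q V t ⊗ₜ[k] q V s) := by
      rw [Sym.swap_tmul hs ht, map_smul, TensorProduct.map_tmul]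
    exact (GrMod.braid_apply (grMod V) (grMod V) (q_mem hs) (q_mem ht)).trans h₁.symm
  have e := LinearMap.congr_fun h (Sym.comul V s)
  have e' := LinearMap.congr_fun (Sym.cocomm (V := V)) s
  rw [LinearMap.comp_apply] at e'
  exact e.trans (congrArg (TensorProduct.map (q V) (q V)) e')

/-- The iterated reduced comultiplication. -/
noncomputable def iter (V : GrMod k) (n : ℕ) : Red V →ₗ[k] tensorTower (grMod V) n :=
  iterComul (grMod V) (comul V) n

theorem iter_succ (n : ℕ) (F : Sym V) : iter V (n + 1) (q V F) =
    LinearMap.lTensor (Red V) (iter V n) (TensorProduct.map (q V) (q V) (Sym.comul V F)) := rfl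

theorem iterComul_mon (n : ℕ) : ∀ {l : ℕ} {i : ℤ} {s : Sym V}, l ≤ n → Sym.IsMon V l i s →
    iter V n (q V s) = 0 := by
  induction n with
  | zero =>
    intro l i s hl hs
    cases hs with
    | one => exact q_one
    | cons hv hs => omega
  | succ n ih =>
    intro l i s hl hs
    rw [iter_succ]
    have : Submodule.span k (Sym.Small V l) ≤ LinearMap.ker
        (LinearMap.lTensor (Red V) (iter V n) ∘ₗ
          TensorProduct.map (q V) (q V)) := by
      refine Submodule.span_le.2 ?_
      rintro _ (⟨n', t, ht, rfl⟩ | ⟨a, l', hl', n', t, ht, rfl⟩)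
      · rw [SetLike.mem_coe, LinearMap.mem_ker, LinearMap.comp_apply, TensorProduct.map_tmul,
          LinearMap.lTensor_tmul, q_one, TensorProduct.zero_tmul]
      · rw [SetLike.mem_coe, LinearMap.mem_ker, LinearMap.comp_apply, TensorProduct.map_tmul,
          LinearMap.lTensor_tmul, ih (by omega) ht, TensorProduct.tmul_zero]
    exact this (Sym.comul_small hs)

theorem conilpotent (x : Red V) : ∃ n, iterComul (grMod V) (comul V) n x = 0 := by
  suffices h : ∃ n, ∀ n' ≥ n, iter V n' x = 0 from
    h.imp fun n h => h n le_rfl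
  obtain ⟨s, rfl⟩ := q_surjective x
  have hs : s ∈ ⨆ n, Sym.gr V n := by
    have : ⨆ n, Sym.gr V n = ⊤ := (symGr V).iSup_gr
    rw [this]
    trivial
  refine Submodule.iSup_induction _ (motive := fun s => ∃ n, ∀ n' ≥ n,
    iter V n' (q V s) = 0) hs (fun i s hs => ?_) ⟨0, fun n' _ => by rw [map_zero]; exact map_zero _⟩ ?_
  · refine Submodule.span_induction (p := fun s _ => ∃ n, ∀ n' ≥ n,
      iter V n' (q V s) = 0) ?_ ⟨0, fun n' _ => by rw [map_zero]; exact map_zero _⟩ ?_ ?_ hs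
    · rintro s ⟨l, hs⟩
      exact ⟨l, fun n' hn => iterComul_mon n' hn hs⟩
    · rintro x y _ _ ⟨a, ha⟩ ⟨b, hb⟩
      refine ⟨max a b, fun n' hn => ?_⟩
      rw [map_add]
      exact (map_add _ _ _).trans (by
        rw [ha n' (le_of_max_le_left hn), hb n' (le_of_max_le_right hn), add_zero])
    · rintro c x _ ⟨a, ha⟩
      refine ⟨a, fun n' hn => ?_⟩
      rw [map_smul]
      exact (map_smul _ _ _).trans (by rw [ha n' hn, smul_zero])
  · rintro x y ⟨a, ha⟩ ⟨b, hb⟩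
    refine ⟨max a b, fun n' hn => ?_⟩
    rw [map_add]
    exact (map_add _ _ _).trans (by
      rw [ha n' (le_of_max_le_left hn), hb n' (le_of_max_le_right hn), add_zero])

end Red

/-- The cofree conilpotent cocommutative coalgebra `S^co(V)` on a graded vector space, realized as
the sum of the symmetric powers of positive exponent with the unshuffle comultiplication. -/
noncomputable def symCo (V : GrMod k) : GrCoalg k where
  toGrMod := Red.grMod V
  comul := Red.comul V
  comul_mem := Red.comul_mem
  coassoc := Red.coassoc
  cocomm := Red.cocomm
  conilpotent := Red.conilpotent

namespace Red
variable {g h : DGLie k} {V : GrMod k}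

/-- The differential of the bar construction. -/
noncomputable def d (g : DGLie k) : Red (g.shift (-1)) →ₗ[k] Red (g.shift (-1)) :=
  desc (q (g.shift (-1)) ∘ₗ CE.D g) (by rw [LinearMap.comp_apply, CE.D_one, map_zero])

theorem d_q (s : CE g) : d g (q (g.shift (-1)) s) = q (g.shift (-1)) (CE.D g s) := rfl

theorem d_mem {n : ℤ} {x : Red (g.shift (-1))} (hx : x ∈ (grMod (g.shift (-1))).gr n) :
    d g x ∈ (grMod (g.shift (-1))).gr (n - 1) := by
  obtain ⟨s, hs, rfl⟩ := hx
  exact q_mem (CE.D_mem hs)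

theorem d_d (x : Red (g.shift (-1))) : d g (d g x) = 0 := by
  obtain ⟨s, rfl⟩ := q_surjective x
  rw [d_q, d_q, CE.D_D, map_zero]

/-- The sign involution. -/
noncomputable def sig (V : GrMod k) : Red V →ₗ[k] Red V := (grMod V).sigma

theorem sig_q {i : ℤ} {s : Sym V} (hs : s ∈ Sym.gr V i) :
    sig V (q V s) = (sg i : k) • q V s := (grMod V).sigma_apply (q_mem hs)

theorem coder : comul (g.shift (-1)) ∘ₗ d g = (TensorProduct.map (d g) LinearMap.id +
    TensorProduct.map (sig (g.shift (-1))) (d g)) ∘ₗ comul (g.shift (-1)) := by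
  refine ext (LinearMap.ext fun s => ?_)
  have h : (TensorProduct.map (d g) LinearMap.id +
      TensorProduct.map (sig (g.shift (-1))) (d g)) ∘ₗ
      TensorProduct.map (q (g.shift (-1))) (q (g.shift (-1))) =
      TensorProduct.map (q (g.shift (-1))) (q (g.shift (-1))) ∘ₗ
        Sym.two (V := g.shift (-1)) (-1) (CE.D g) := Sym.ext_tensor fun i j s hs t ht => by
    simp only [LinearMap.comp_apply, LinearMap.add_apply, Sym.two_tmul _ _ hs, map_add, map_smul,
      TensorProduct.map_tmul, sig_q hs, d_q, LinearMap.id_apply, ← TensorProduct.smul_tmul']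
    rw [sg_congr (k := k) (m := -1 * i) (n := i) (by grind)]
  have e := LinearMap.congr_fun h (Sym.comul (g.shift (-1)) s)
  have e' := LinearMap.congr_fun (CE.D_coder (g := g)) s
  simp only [LinearMap.comp_apply] at e e' ⊢
  rw [d_q, comul_q, comul_q, e, e']

/-- The map induced by a morphism of dg Lie algebras. -/
noncomputable def map (φ : g ⟶ h) : Red (g.shift (-1)) →ₗ[k] Red (h.shift (-1)) :=
  desc (q (h.shift (-1)) ∘ₗ CE.map φ) (by rw [LinearMap.comp_apply, CE.map_one, q_one])

theorem map_q (φ : g ⟶ h) (s : CE g) :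
    map φ (q (g.shift (-1)) s) = q (h.shift (-1)) (CE.map φ s) := rfl

theorem map_mem (φ : g ⟶ h) {n : ℤ} {x : Red (g.shift (-1))}
    (hx : x ∈ (grMod (g.shift (-1))).gr n) : map φ x ∈ (grMod (h.shift (-1))).gr n := by
  obtain ⟨s, hs, rfl⟩ := hx
  exact q_mem (CE.map_mem φ hs)

theorem map_comul (φ : g ⟶ h) (x : Red (g.shift (-1))) :
    comul (h.shift (-1)) (map φ x) =
      TensorProduct.map (map φ) (map φ) (comul (g.shift (-1)) x) := by
  obtain ⟨s, rfl⟩ := q_surjective x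
  have key : TensorProduct.map (q (h.shift (-1))) (q (h.shift (-1))) ∘ₗ
      TensorProduct.map (CE.map φ) (CE.map φ) =
      TensorProduct.map (map φ) (map φ) ∘ₗ
        TensorProduct.map (q (g.shift (-1))) (q (g.shift (-1))) :=
    TensorProduct.ext' fun s t => rfl
  have := LinearMap.congr_fun key (Sym.comul (g.shift (-1)) s)
  rw [LinearMap.comp_apply, LinearMap.comp_apply] at this
  rw [map_q, comul_q, comul_q, CE.map_comul, this]

theorem map_d (φ : g ⟶ h) (x : Red (g.shift (-1))) : map φ (d g x) = d h (map φ x) := by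
  obtain ⟨s, rfl⟩ := q_surjective x
  rw [d_q, map_q, map_q, d_q, CE.map_D]

theorem map_id (g : DGLie k) : map (𝟙 g) = LinearMap.id :=
  ext (LinearMap.ext fun s => congrArg (q _) (CE.map_id g s))

theorem map_comp {l : DGLie k} (φ : g ⟶ h) (ψ : h ⟶ l) : map (φ ≫ ψ) = map ψ ∘ₗ map φ :=
  ext (LinearMap.ext fun s => congrArg (q _) (CE.map_comp φ ψ s))

end Red

/-- The bar construction: the cofree conilpotent cocommutative coalgebra on `Σ⁻¹g`, with the
coderivation induced by the differential and by the bracket of `g`. -/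
noncomputable def barObj (g : DGLie k) : DGCoalg k where
  toGrCoalg := symCo (g.shift (-1))
  d := Red.d g
  d_mem := Red.d_mem
  d_d := Red.d_d
  coder := Red.coder

/-- The bar construction on morphisms. -/
noncomputable def barMap {g h : DGLie k} (φ : g ⟶ h) : DGCoalg.Hom (barObj g) (barObj h) where
  map := Red.map φ
  map_mem := Red.map_mem φ
  map_comul := Red.map_comul φ
  map_d := Red.map_d φ

/-- The bar construction `B`. -/
noncomputable def bar (k : Type u) [Field k] [CharZero k] : DGLie k ⥤ DGCoalg k where
  obj := barObj
  map := barMap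
  map_id g := DGCoalg.Hom.ext (Red.map_id g)
  map_comp φ ψ := DGCoalg.Hom.ext (Red.map_comp φ ψ)

end bar

/-! ### The tensoring and the enrichment over coalgebras -/

section modules
variable (k : Type u) [Field k] [CharZero k]

/-- The convolution dg Lie algebra `{C, h}`, as an object. -/
noncomputable abbrev convObj {k : Type u} [Field k] [CharZero k] (C : DGCoalg k) (h : DGLie k) : DGLie k :=
  ((convFunctor k).obj (Opposite.op C)).obj h

/-- A tensoring `C ▷ g` of dg Lie algebras over coalgebras: a bifunctor such that `C ▷ -` is left
adjoint to the convolution functor `{C, -}`, by bijections `Hom(C ▷ g, h) ≃ Hom(g, {C, h})` that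
are natural in `C`, `g` and `h`. -/
structure Tensoring where
  functor : DGCoalg k ⥤ DGLie k ⥤ DGLie k
  homEquiv (C : DGCoalg k) (g h : DGLie k) :
    ((functor.obj C).obj g ⟶ h) ≃ (g ⟶ convObj C h)
  natural_coalgebra {C D : DGCoalg k} (φ : C ⟶ D) {g h : DGLie k}
    (α : (functor.obj D).obj g ⟶ h) :
    homEquiv C g h ((functor.map φ).app g ≫ α) =
      homEquiv D g h α ≫ ((convFunctor k).map φ.op).app h
  natural_left (C : DGCoalg k) {g g' : DGLie k} (ψ : g' ⟶ g) {h : DGLie k}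
    (α : (functor.obj C).obj g ⟶ h) :
    homEquiv C g' h ((functor.obj C).map ψ ≫ α) = ψ ≫ homEquiv C g h α
  natural_right (C : DGCoalg k) (g : DGLie k) {h h' : DGLie k} (χ : h ⟶ h')
    (α : (functor.obj C).obj g ⟶ h) :
    homEquiv C g h' (α ≫ χ) =
      homEquiv C g h α ≫ ((convFunctor k).obj (Opposite.op C)).map χ

/-- An enrichment `E(g, h)` of dg Lie algebras over coalgebras: a bifunctor such that `E(-, h)` is
right adjoint to the opposite convolution functor `{-, h}ᵒᵖ`, by bijections
`Hom(g, {C, h}) ≃ Hom(C, E(g, h))` that are natural in `C`, `g` and `h`. -/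
structure Enrichment where
  functor : (DGLie k)ᵒᵖ ⥤ DGLie k ⥤ DGCoalg k
  homEquiv (C : DGCoalg k) (g h : DGLie k) :
    (g ⟶ convObj C h) ≃ (C ⟶ (functor.obj (Opposite.op g)).obj h)
  natural_coalgebra {C D : DGCoalg k} (φ : C ⟶ D) {g h : DGLie k} (α : g ⟶ convObj D h) :
    homEquiv C g h (α ≫ ((convFunctor k).map φ.op).app h) = φ ≫ homEquiv D g h α
  natural_left (C : DGCoalg k) {g g' : DGLie k} (ψ : g' ⟶ g) {h : DGLie k}
    (α : g ⟶ convObj C h) :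
    homEquiv C g' h (ψ ≫ α) = homEquiv C g h α ≫ (functor.map ψ.op).app h
  natural_right (C : DGCoalg k) (g : DGLie k) {h h' : DGLie k} (χ : h ⟶ h')
    (α : g ⟶ convObj C h) :
    homEquiv C g h' (α ≫ ((convFunctor k).obj (Opposite.op C)).map χ) =
      homEquiv C g h α ≫ (functor.obj (Opposite.op g)).map χ

end modules

end ComLie

/-! Everything is governed by Maurer-Cartan elements. A morphism from `mcLie k` to a dg Lie algebra
`L` is the same as an element `x` of degree `-1` with `d x = -½ [x, x]` (`mcLift`, `mc_hom_ext`).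
For `L = {C, h}` such an element is a twisting cochain `C → h`. Twisting cochains are represented on
both sides. A map of degree `-1` on `C` extends uniquely to the free Lie algebra on `ΣC`, and
compatibility with the cobar differential on generators is exactly the Maurer-Cartan equation
(`cobar_exists_desc`, `cobar_hom_ext`). Dually, such a map lifts uniquely to the cofree coalgebra on
`Σ⁻¹h`, and the lift commutes with the bar differential exactly because of the same equation
(`bar_exists_lift`, `bar_hom_ext`). Hence `Hom(Ω C, h)`, `Hom(mc, {C, h})` and `Hom(C, B h)` agree
naturally, and a Yoneda argument gives the isomorphisms for any tensoring and any enrichment.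

The substantial algebraic input is the cofreeness of the reduced symmetric coalgebra among
conilpotent cocommutative coalgebras. Existence uses the convolution exponential `exp φ = 1 + Φ` of
a map `φ : C → V`. If `W` multiplies a product of `l` generators by `l`, then `W (exp φ) = φ * exp
φ`; in characteristic zero `W` can be inverted off the constants, so this becomes a recursion along
the comultiplication, solvable by conilpotence (`GrCoalg.exists_rec`). That `Φ` induces a coalgebra
map, and that such maps are unique, are both instances of the principle that a homogeneous recursion
of this kind has only the zero solution (`GrCoalg.eq_zero_of_rec`).

Existence of the tensoring: `C ▷ g` is the free dg Lie algebra on the complex `g ⊗ C` modulo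
everything killed by all morphisms that come from some `g ⟶ {C, h}`. The expected relation `[x, y] ⊗
c = ∑ ± [x ⊗ c', y ⊗ c'']` is among these, and nothing is lost in the universal property. Existence
of the enrichment is dual: a morphism `g ⟶ {C, h}` gives a linear map from `C` to the complex of
maps `g → h`, hence a classifying morphism to the cofree coalgebra on that complex. The sum of the
images of all classifying morphisms is a subcoalgebra, and it is the required object. The cofree
coalgebra is obtained at no extra cost as the bar construction of a suspended complex with zero
bracket. -/

namespace ComLie

/-! ### Tensor products of graded vector spaces -/

section tensor
variable {k : Type u} [Field k] [CharZero k]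

/-- The tensor product of graded vector spaces. -/
noncomputable def GrMod.tensor (V W : GrMod k) : GrMod k where
  carrier := V ⊗[k] W
  gr := GrMod.tensorGr V W
  isInternal := by
    -- The total degree operator `E ⊗ 1 + 1 ⊗ E` acts as `n` on the degree `n` part, so the parts
    -- are independent in characteristic zero.
    refine GrMod.isInternal_of_euler (TensorProduct.map (V.scale fun n => (n : k)) LinearMap.id +
      TensorProduct.map LinearMap.id (W.scale fun n => (n : k))) (fun n z hz => ?_) ?_
    · have : GrMod.tensorGr V W n ≤ LinearMap.eqLocus
          (TensorProduct.map (V.scale fun n => (n : k)) LinearMap.id +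
            TensorProduct.map LinearMap.id (W.scale fun n => (n : k)))
          ((n : k) • LinearMap.id) := by
        refine Submodule.span_le.2 ?_
        rintro _ ⟨i, j, x, y, hx, hy, rfl, rfl⟩
        rw [SetLike.mem_coe, LinearMap.mem_eqLocus, LinearMap.add_apply, TensorProduct.map_tmul,
          TensorProduct.map_tmul, V.scale_apply _ hx, W.scale_apply _ hy, LinearMap.smul_apply,
          LinearMap.id_apply, LinearMap.id_apply, LinearMap.id_apply, Int.cast_add, add_smul,
          TensorProduct.smul_tmul', TensorProduct.tmul_smul]
      exact this hz
    · rw [← Submodule.ker_mkQ (⨆ n, GrMod.tensorGr V W n), LinearMap.ker_eq_top]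
      refine GrMod.ext_gr₂ V W fun m n x hx y hy => ?_
      rw [LinearMap.zero_apply, Submodule.mkQ_apply, Submodule.Quotient.mk_eq_zero]
      exact Submodule.mem_iSup_of_mem _ (GrMod.tmul_mem V W hx hy rfl)

end tensor

/-! ### The counit and the projection to the generators -/

namespace Sym
variable {k : Type u} [Field k] {V : GrMod k}

/-- The operators from which `aug` is built. -/
noncomputable def augOp (V : GrMod k) : V.carrier →ₗ[k] (k × V.carrier) →ₗ[k] (k × V.carrier) :=
  LinearMap.mk₂ k (fun v z => (0, z.1 • v))
    (fun _ _ _ => by simp)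
    (fun c v z => by rw [Prod.smul_mk, smul_zero, smul_comm c z.1 v])
    (fun _ _ _ => by simp [add_smul]) (fun _ _ _ => by simp [mul_smul])

theorem augOp_apply (v : V.carrier) (z : k × V.carrier) : augOp V v z = (0, z.1 • v) := rfl

/-- Both sides are zero: a product with two generators in front has neither a constant nor a linear
part. -/
theorem augOp_comm ⦃m n : ℤ⦄ ⦃x y : V.carrier⦄ (_ : x ∈ V.gr m) (_ : y ∈ V.gr n)
    (t : k × V.carrier) :
    augOp V x (augOp V y t) = (sg (m * n) : k) • augOp V y (augOp V x t) := by
  simp [augOp_apply]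

/-- The components of a polynomial of weight `0` and `1`. -/
noncomputable def aug (V : GrMod k) : Sym V →ₗ[k] k × V.carrier :=
  build (augOp V) augOp_comm (1, 0)

/-- The counit. -/
noncomputable def eps (V : GrMod k) : Sym V →ₗ[k] k := LinearMap.fst k _ _ ∘ₗ aug V

/-- The projection to the generators. -/
noncomputable def pr (V : GrMod k) : Sym V →ₗ[k] V.carrier := LinearMap.snd k _ _ ∘ₗ aug V

theorem eps_one : eps V 1 = 1 := by
  rw [eps, aug, LinearMap.comp_apply, build_one]
  rfl

theorem eps_L (v : V.carrier) (s : Sym V) : eps V (L V v s) = 0 := by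
  rw [eps, aug, LinearMap.comp_apply, build_L]
  rfl

theorem pr_one : pr V 1 = 0 := by
  rw [pr, aug, LinearMap.comp_apply, build_one]
  rfl

theorem pr_L (v : V.carrier) (s : Sym V) : pr V (L V v s) = eps V s • v := by
  rw [pr, aug, LinearMap.comp_apply, build_L]
  rfl

theorem eps_mon {l : ℕ} {n : ℤ} {s : Sym V} (hs : IsMon V l n s) (hl : l ≠ 0) : eps V s = 0 := by
  cases hs with
  | one => exact absurd rfl hl
  | cons hv hs => exact eps_L _ _

theorem mon_zero {n : ℤ} {s : Sym V} (hs : IsMon V 0 n s) : s = 1 := by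
  cases hs
  rfl

theorem pr_mon {l : ℕ} {n : ℤ} {s : Sym V} (hs : IsMon V l n s) (hl : l ≠ 1) : pr V s = 0 := by
  cases hs with
  | one => exact pr_one
  | cons hv hs => rw [pr_L, eps_mon hs (by omega), zero_smul]

theorem isHom_id (V : GrMod k) : GrMod.IsHom V V 0 LinearMap.id := fun n x hx => by
  rwa [add_zero]

/-! ### The number of factors and division by it -/

/-- The operator that multiplies a product of `l` generators with `l`. -/
noncomputable def weight (V : GrMod k) : Sym V →ₗ[k] Sym V := der 0 LinearMap.id (isHom_id V)

theorem weight_one : weight V 1 = 0 := der_one _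

/-- A derivation of degree `0` carries no Koszul signs, so the rule extends by linearity from
homogeneous `v` to all `v`. -/
theorem weight_L (v : V.carrier) (s : Sym V) :
    weight V (L V v s) = L V v (weight V s) + L V v s := by
  have : weight V ∘ₗ (L V).flip s = (L V).flip (weight V s) + (L V).flip s :=
    V.ext_gr fun n v hv => by
      have := der_L (p := 0) (isHom_id V) hv s
      rwa [zero_mul, sg_even Even.zero, one_smul] at this
  exact LinearMap.congr_fun this v

theorem weight_mon {l : ℕ} {n : ℤ} {s : Sym V} (hs : IsMon V l n s) :
    weight V s = (l : k) • s := by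
  induction hs with
  | one => rw [weight_one, Nat.cast_zero, zero_smul]
  | cons hv hs ih =>
    rw [weight_L, ih, map_smul, Nat.cast_add, Nat.cast_one, add_smul, one_smul]

variable [CharZero k]

theorem ext_mon {M : Type*} [AddCommGroup M] [Module k M] {f g : Sym V →ₗ[k] M}
    (h : ∀ l n s, IsMon V l n s → f s = g s) : f = g := by
  refine (symGr V).ext_gr fun n s hs => ?_
  have : gr V n ≤ LinearMap.eqLocus f g := gr_le fun l s hs => h l n s hs
  exact this hs

theorem ext_mon_tensor {M : Type*} [AddCommGroup M] [Module k M]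
    {f g : (Sym V ⊗[k] Sym V) →ₗ[k] M}
    (h : ∀ l n s l' n' t, IsMon V l n s → IsMon V l' n' t → f (s ⊗ₜ t) = g (s ⊗ₜ t)) : f = g :=
  TensorProduct.ext (ext_mon fun l n s hs => ext_mon fun l' n' t ht => h l n s l' n' t hs ht)

/-- The span of the products of `n` homogeneous generators. -/
noncomputable def wtGr (V : GrMod k) (n : ℤ) : Submodule k (Sym V) :=
  Submodule.span k {s | ∃ (l : ℕ) (i : ℤ), IsMon V l i s ∧ (l : ℤ) = n}

theorem mon_mem_wt {l : ℕ} {n : ℤ} {s : Sym V} (hs : IsMon V l n s) : s ∈ wtGr V (l : ℤ) :=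
  Submodule.subset_span ⟨l, n, hs, rfl⟩

/-- The grading of `Sym V` by the number of factors. -/
noncomputable def wt (V : GrMod k) : GrMod k where
  carrier := Sym V
  gr := wtGr V
  isInternal := by
    refine GrMod.isInternal_of_euler (weight V) (fun n s hs => ?_) ?_
    · have : wtGr V n ≤
          LinearMap.eqLocus (weight V) ((n : k) • LinearMap.id) := by
        refine Submodule.span_le.2 ?_
        rintro t ⟨l, i, ht, rfl⟩
        rw [SetLike.mem_coe, LinearMap.mem_eqLocus, weight_mon ht]
        simp
      exact this hs
    · rw [← Submodule.ker_mkQ (⨆ n : ℤ, wtGr V n), LinearMap.ker_eq_top]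
      refine ext_mon fun l i s hs => ?_
      rw [LinearMap.zero_apply, Submodule.mkQ_apply, Submodule.Quotient.mk_eq_zero]
      exact Submodule.mem_iSup_of_mem (l : ℤ) (mon_mem_wt hs)

/-- The operator that divides a product of `l` generators by `l`, and annihilates `1`. -/
noncomputable def weightInv (V : GrMod k) : Sym V →ₗ[k] Sym V := (wt V).scale fun n => (n : k)⁻¹

theorem weightInv_mon {l : ℕ} {n : ℤ} {s : Sym V} (hs : IsMon V l n s) :
    weightInv V s = (l : k)⁻¹ • s := by
  have : weightInv V s = ((l : ℤ) : k)⁻¹ • s :=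
    (wt V).scale_apply (fun n => (n : k)⁻¹) (mon_mem_wt hs)
  rwa [Int.cast_natCast] at this

theorem weightInv_mem {n : ℤ} {s : Sym V} (hs : s ∈ gr V n) : weightInv V s ∈ gr V n := by
  have : gr V n ≤ (gr V n).comap (weightInv V) := gr_le fun l s hs => by
    rw [Submodule.mem_comap, weightInv_mon hs]
    exact Submodule.smul_mem _ _ (mon_mem hs)
  exact this hs

theorem eps_weightInv (s : Sym V) : eps V (weightInv V s) = 0 := by
  have : eps V ∘ₗ weightInv V = 0 := ext_mon fun l n s hs => by
    rw [LinearMap.comp_apply, weightInv_mon hs]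
    -- For `l = 0` the scalar is `0⁻¹ = 0`; otherwise the counit kills the product itself.
    rcases eq_or_ne l 0 with rfl | hl
    · simp
    · simp [eps_mon hs hl]
  exact LinearMap.congr_fun this s

theorem pr_weightInv (s : Sym V) : pr V (weightInv V s) = pr V s := by
  have : pr V ∘ₗ weightInv V = pr V := ext_mon fun l n s hs => by
    rw [LinearMap.comp_apply, weightInv_mon hs]
    rcases eq_or_ne l 1 with rfl | hl
    · simp
    · simp [pr_mon hs hl]
  exact LinearMap.congr_fun this s

/-- On products of `l ≥ 1` generators the two operators are mutually inverse scalings, and on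
constants both vanish. Adding back the constant part `ε(s) 1` therefore gives the identity, and the
correction disappears when `ε(s) = 0`. -/
theorem weight_weightInv {s : Sym V} (hs : eps V s = 0) : weight V (weightInv V s) = s := by
  have : weight V ∘ₗ weightInv V + (eps V).smulRight 1 = LinearMap.id := ext_mon fun l n s hs => by
    rw [LinearMap.add_apply, LinearMap.comp_apply, weightInv_mon hs, map_smul, weight_mon hs,
      LinearMap.smulRight_apply, LinearMap.id_apply, smul_smul]
    rcases eq_or_ne l 0 with rfl | hl
    · rw [mon_zero hs, eps_one]; simp
    · rw [inv_mul_cancel₀ (Nat.cast_ne_zero.2 hl), eps_mon hs hl]; simp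
  have := LinearMap.congr_fun this s
  rwa [LinearMap.add_apply, LinearMap.smulRight_apply, hs, zero_smul, add_zero] at this

theorem weightInv_weight {s : Sym V} (hs : eps V s = 0) : weightInv V (weight V s) = s := by
  have : weightInv V ∘ₗ weight V + (eps V).smulRight 1 = LinearMap.id := ext_mon fun l n s hs => by
    rw [LinearMap.add_apply, LinearMap.comp_apply, weight_mon hs, map_smul, weightInv_mon hs,
      LinearMap.smulRight_apply, LinearMap.id_apply, smul_smul]
    rcases eq_or_ne l 0 with rfl | hl
    · rw [mon_zero hs, eps_one]; simp
    · rw [mul_inv_cancel₀ (Nat.cast_ne_zero.2 hl), eps_mon hs hl]; simp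
  have := LinearMap.congr_fun this s
  rwa [LinearMap.add_apply, LinearMap.smulRight_apply, hs, zero_smul, add_zero] at this

/-! ### The weight operator on the tensor square -/

/-- The counit of the tensor square. -/
noncomputable def eps₂ (V : GrMod k) : (Sym V ⊗[k] Sym V) →ₗ[k] k :=
  TensorProduct.lift ((LinearMap.mul k k).compl₁₂ (eps V) (eps V))

theorem eps₂_tmul (s t : Sym V) : eps₂ V (s ⊗ₜ t) = eps V s * eps V t := rfl

/-- The weight operator of the tensor square. -/
noncomputable def weight₂ (V : GrMod k) : (Sym V ⊗[k] Sym V) →ₗ[k] (Sym V ⊗[k] Sym V) :=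
  TensorProduct.map (weight V) LinearMap.id + TensorProduct.map LinearMap.id (weight V)

theorem weight₂_tmul (s t : Sym V) :
    weight₂ V (s ⊗ₜ t) = weight V s ⊗ₜ t + s ⊗ₜ weight V t := rfl

/-- The inverse of `weight₂` on tensors of positive weight. -/
noncomputable def weightInv₂ (V : GrMod k) : (Sym V ⊗[k] Sym V) →ₗ[k] (Sym V ⊗[k] Sym V) :=
  (GrMod.tensor (wt V) (wt V)).scale fun n => (n : k)⁻¹

theorem weightInv₂_mon {l l' : ℕ} {n n' : ℤ} {s t : Sym V} (hs : IsMon V l n s)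
    (ht : IsMon V l' n' t) : weightInv₂ V (s ⊗ₜ t) = (l + l' : k)⁻¹ • (s ⊗ₜ[k] t) := by
  have := (GrMod.tensor (wt V) (wt V)).scale_apply (fun n => (n : k)⁻¹)
    (GrMod.tmul_mem (wt V) (wt V) (mon_mem_wt hs) (mon_mem_wt ht) rfl)
  rwa [Int.cast_add, Int.cast_natCast, Int.cast_natCast] at this

/-- The only pairs of monomials of total weight zero are multiples of `1 ⊗ 1`, and `eps₂` detects
exactly that component. -/
theorem weightInv₂_weight₂ {z : Sym V ⊗[k] Sym V} (hz : eps₂ V z = 0) :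
    weightInv₂ V (weight₂ V z) = z := by
  have : weightInv₂ V ∘ₗ weight₂ V + (eps₂ V).smulRight (1 ⊗ₜ 1) = LinearMap.id :=
    ext_mon_tensor fun l n s l' n' t hs ht => by
      rw [LinearMap.add_apply, LinearMap.comp_apply, weight₂_tmul, weight_mon hs, weight_mon ht,
        TensorProduct.tmul_smul, ← TensorProduct.smul_tmul', ← add_smul, map_smul,
        weightInv₂_mon hs ht, LinearMap.smulRight_apply, LinearMap.id_apply, smul_smul, eps₂_tmul]
      -- If some factor is present, one of the counits vanishes and `l + l'` is invertible;
      -- otherwise `(0 + 0)⁻¹ = 0` and the correction term alone gives `1 ⊗ 1`.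
      by_cases h : l = 0 ∧ l' = 0
      · obtain ⟨rfl, rfl⟩ := h
        rw [mon_zero hs, mon_zero ht, eps_one]
        simp
      · have h₁ : eps V s * eps V t = 0 := by
          by_cases hl : l = 0
          · rw [eps_mon ht (fun h' => h ⟨hl, h'⟩), mul_zero]
          · rw [eps_mon hs hl, zero_mul]
        have h₂ : (l + l' : k) ≠ 0 := by
          rw [← Nat.cast_add, Nat.cast_ne_zero]
          omega
        rw [h₁, mul_inv_cancel₀ h₂, zero_smul, add_zero, one_smul]
  have := LinearMap.congr_fun this z
  rwa [LinearMap.add_apply, LinearMap.smulRight_apply, hz, zero_smul, add_zero] at this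

theorem eps_gr {n : ℤ} {s : Sym V} (hs : s ∈ gr V n) (hn : n ≠ 0) : eps V s = 0 := by
  have : gr V n ≤ LinearMap.ker (eps V) := gr_le fun l s hs => by
    cases hs with
    | one => exact absurd rfl hn
    | cons hv hs => exact eps_L _ _
  exact this hs

/-- The counit is supported in degree `0`, where every such sign is `1`; Koszul signs can be dropped
in front of a counit. -/
theorem sg_smul_eps {m n : ℤ} {s : Sym V} (hs : s ∈ gr V n) :
    (sg (m * n) : k) * eps V s = eps V s := by
  rcases eq_or_ne n 0 with rfl | hn
  · rw [mul_zero, sg_even Even.zero, one_mul]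
  · rw [eps_gr hs hn, mul_zero]

theorem pr_mem {n : ℤ} {s : Sym V} (hs : s ∈ gr V n) : pr V s ∈ V.gr n := by
  have : gr V n ≤ (V.gr n).comap (pr V) := gr_le fun l t ht => by
    clear hs
    cases ht with
    | one => rw [Submodule.mem_comap, pr_one]; exact Submodule.zero_mem _
    | @cons l m n v s hv hs =>
      rw [Submodule.mem_comap, pr_L]
      -- The value is `ε(s) v`, which can be nonzero only for `s` of degree `0`, and then `v s` has
      -- the degree of `v`.
      rcases eq_or_ne n 0 with rfl | hn
      · rw [add_zero]; exact Submodule.smul_mem _ _ hv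
      · rw [eps_gr (mon_mem hs) hn, zero_smul]; exact Submodule.zero_mem _
  exact this hs

/-! ### Counit identities for the comultiplication -/

/-- The map `s ⊗ t ↦ ε(s) t`. -/
noncomputable def epsLeft (V : GrMod k) : (Sym V ⊗[k] Sym V) →ₗ[k] Sym V :=
  (TensorProduct.lid k (Sym V)).toLinearMap ∘ₗ (eps V).rTensor (Sym V)

/-- The map `s ⊗ t ↦ ε(t) s`. -/
noncomputable def epsRight (V : GrMod k) : (Sym V ⊗[k] Sym V) →ₗ[k] Sym V :=
  (TensorProduct.rid k (Sym V)).toLinearMap ∘ₗ (eps V).lTensor (Sym V)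

theorem epsLeft_tmul (s t : Sym V) : epsLeft V (s ⊗ₜ t) = eps V s • t := rfl

theorem epsRight_tmul (s t : Sym V) : epsRight V (s ⊗ₜ t) = eps V t • s := rfl

/-- This is the counit axiom. The map `ε ⊗ id` intertwines `rho V v` with multiplication by `v`,
because it kills the summand where `v` enters the left factor; induction over the generators
finishes. -/
theorem epsLeft_comul (s : Sym V) : epsLeft V (comul V s) = s := by
  have : epsLeft V ∘ₗ comul V = LinearMap.id := by
    refine ext ?_ fun m v hv s hs => ?_
    · rw [LinearMap.comp_apply, comul_one, epsLeft_tmul, eps_one, one_smul]; rfl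
    · have key : epsLeft V ∘ₗ rho V v = L V v ∘ₗ epsLeft V := ext_tensor fun i j s hs t ht => by
        simp only [LinearMap.comp_apply, rho_tmul hv hs, map_add, map_smul, epsLeft_tmul, eps_L,
          zero_smul, zero_add, smul_smul, sg_smul_eps hs]
      have := LinearMap.congr_fun key (comul V s)
      simp only [LinearMap.comp_apply] at this hs ⊢
      rw [comul_L, this, hs]
      rfl
  exact LinearMap.congr_fun this s

theorem epsRight_comul (s : Sym V) : epsRight V (comul V s) = s := by
  have : epsRight V ∘ₗ comul V = LinearMap.id := by
    refine ext ?_ fun m v hv s hs => ?_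
    · rw [LinearMap.comp_apply, comul_one, epsRight_tmul, eps_one, one_smul]; rfl
    · have key : epsRight V ∘ₗ rho V v = L V v ∘ₗ epsRight V := ext_tensor fun i j s hs t ht => by
        simp only [LinearMap.comp_apply, rho_tmul hv hs, map_add, map_smul, epsRight_tmul, eps_L,
          zero_smul, smul_zero, add_zero]
      have := LinearMap.congr_fun key (comul V s)
      simp only [LinearMap.comp_apply] at this hs ⊢
      rw [comul_L, this, hs]
      rfl
  exact LinearMap.congr_fun this s

/-- The map `s ⊗ t ↦ π(s) t`, with `π` the projection to the generators. -/
noncomputable def prL (V : GrMod k) : (Sym V ⊗[k] Sym V) →ₗ[k] Sym V :=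
  TensorProduct.lift (L V ∘ₗ pr V)

theorem prL_tmul (s t : Sym V) : prL V (s ⊗ₜ t) = L V (pr V s) t := rfl

/-- The components of `Δ s` whose left factor is linear split off one generator at a time.
Multiplying it back restores the product, Koszul sign included, so a product of `l` generators is
counted `l` times. This identity turns statements about `Δ` into recursions. -/
theorem prL_comul (s : Sym V) : prL V (comul V s) = weight V s := by
  have : prL V ∘ₗ comul V = weight V := by
    refine ext ?_ fun m v hv s hs => ?_
    · rw [LinearMap.comp_apply, comul_one, prL_tmul, pr_one, weight_one, map_zero]; rfl
    · have key : prL V ∘ₗ rho V v = L V v ∘ₗ prL V + L V v ∘ₗ epsLeft V :=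
        ext_tensor fun i j s hs t ht => by
          simp only [LinearMap.comp_apply, LinearMap.add_apply, rho_tmul hv hs, map_add, map_smul,
            prL_tmul, epsLeft_tmul, pr_L, LinearMap.smul_apply, L_comm hv (pr_mem hs)]
          rw [add_comm]
      have := LinearMap.congr_fun key (comul V s)
      simp only [LinearMap.comp_apply, LinearMap.add_apply] at this hs ⊢
      rw [comul_L, this, hs, epsLeft_comul, weight_L]
  exact LinearMap.congr_fun this s

/-- The weight operator is the derivation of degree `0` extending the identity of `V`, and
derivations induced by maps of generators are coderivations. -/
theorem comul_weight (s : Sym V) : comul V (weight V s) = weight₂ V (comul V s) := by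
  have h := LinearMap.congr_fun (der_coder (isHom_id V)) s
  have e : two 0 (weight V) = weight₂ V := ext_tensor fun i j s hs t ht => by
    rw [two_tmul 0 _ hs, weight₂_tmul, zero_mul, sg_even Even.zero, one_smul]
  rw [← e]
  exact h

end Sym

/-! ### Recursion over conilpotent coalgebras -/

section conilpotent
variable {k : Type u} [Field k]

/-- The map `id ⊗ ⋯ ⊗ id ⊗ Δ`. -/
noncomputable def iterNext (V : GrMod k) (Δ : V →ₗ[k] (V ⊗[k] V)) :
    (n : ℕ) → tensorTower V n →ₗ[k] tensorTower V (n + 1)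
  | 0 => Δ
  | n + 1 => LinearMap.lTensor V (iterNext V Δ n)

/-- The recursive definition always comultiplies the last factor, so the new `Δ` can be moved from
the front to the end without coassociativity. Consequently, once an iterated comultiplication kills
an element, so do all later ones. -/
theorem iterComul_succ (V : GrMod k) (Δ : V →ₗ[k] (V ⊗[k] V)) (n : ℕ) :
    iterComul V Δ (n + 1) = iterNext V Δ n ∘ₗ iterComul V Δ n := by
  induction n with
  | zero =>
    refine LinearMap.ext fun x => ?_
    exact LinearMap.congr_fun (LinearMap.lTensor_id V V) (Δ x)
  | succ n ih =>
    refine (congrArg (fun f => LinearMap.lTensor V f ∘ₗ Δ) ih).trans ?_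
    rw [LinearMap.lTensor_comp]
    rfl

theorem iterComul_eq_zero (V : GrMod k) (Δ : V →ₗ[k] (V ⊗[k] V)) {n m : ℕ} (h : n ≤ m) {x : V}
    (hx : iterComul V Δ n x = 0) : iterComul V Δ m x = 0 := by
  induction m, h using Nat.le_induction with
  | base => exact hx
  | succ m _ ih => rw [iterComul_succ, LinearMap.comp_apply, ih, map_zero]

variable {M : Type u} [AddCommGroup M] [Module k M]

/-- Substituting the equation into itself `n` times shows that `D` factors through the `n`-th
iterated comultiplication; by conilpotence some such iterate kills any given element. -/
theorem GrCoalg.eq_zero_of_rec (C : GrCoalg k) {D : C.carrier →ₗ[k] M}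
    (K : (C.carrier ⊗[k] M) →ₗ[k] M) (h : D = K ∘ₗ LinearMap.lTensor C.carrier D ∘ₗ C.comul) :
    D = 0 := by
  have key (n : ℕ) : ∃ G : tensorTower C.toGrMod n →ₗ[k] M,
      D = G ∘ₗ iterComul C.toGrMod C.comul n := by
    induction n with
    | zero => exact ⟨D, rfl⟩
    | succ n ih =>
      obtain ⟨G, hG⟩ := ih
      refine ⟨K ∘ₗ LinearMap.lTensor C.carrier G, ?_⟩
      rw [h, hG, LinearMap.lTensor_comp]
      rfl
  ext x
  obtain ⟨n, hn⟩ := C.conilpotent x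
  obtain ⟨G, hG⟩ := key n
  rw [hG, LinearMap.comp_apply, hn, map_zero, LinearMap.zero_apply]

/-- The approximations of the solution of `D = b + K ∘ (id ⊗ D) ∘ Δ`. -/
noncomputable def GrCoalg.approx (C : GrCoalg k) (b : C.carrier →ₗ[k] M)
    (K : (C.carrier ⊗[k] M) →ₗ[k] M) : ℕ → C.carrier →ₗ[k] M
  | 0 => 0
  | n + 1 => b + K ∘ₗ LinearMap.lTensor C.carrier (C.approx b K n) ∘ₗ C.comul

theorem GrCoalg.approx_succ (C : GrCoalg k) (b : C.carrier →ₗ[k] M)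
    (K : (C.carrier ⊗[k] M) →ₗ[k] M) (n : ℕ) : C.approx b K (n + 1) =
      b + K ∘ₗ LinearMap.lTensor C.carrier (C.approx b K n) ∘ₗ C.comul := rfl

/-- Consecutive differences satisfy the homogeneous recursion, hence factor through the iterated
comultiplication. On a fixed element they eventually vanish, so the approximations stabilize
pointwise. -/
theorem GrCoalg.approx_sub (C : GrCoalg k) (b : C.carrier →ₗ[k] M)
    (K : (C.carrier ⊗[k] M) →ₗ[k] M) (n : ℕ) : ∃ G : tensorTower C.toGrMod n →ₗ[k] M,
      C.approx b K (n + 1) - C.approx b K n = G ∘ₗ iterComul C.toGrMod C.comul n := by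
  induction n with
  | zero => exact ⟨b, by simp [approx]; rfl⟩
  | succ n ih =>
    obtain ⟨G, hG⟩ := ih
    refine ⟨K ∘ₗ LinearMap.lTensor C.carrier G, ?_⟩
    have : C.approx b K (n + 1 + 1) - C.approx b K (n + 1) =
        K ∘ₗ LinearMap.lTensor C.carrier (C.approx b K (n + 1) - C.approx b K n) ∘ₗ C.comul := by
      rw [LinearMap.lTensor_sub, LinearMap.sub_comp, LinearMap.comp_sub, C.approx_succ b K (n + 1), C.approx_succ b K n]
      abel
    rw [this, hG, LinearMap.lTensor_comp]
    rfl

theorem GrCoalg.approx_stable (C : GrCoalg k) (b : C.carrier →ₗ[k] M)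
    (K : (C.carrier ⊗[k] M) →ₗ[k] M) (x : C.carrier) :
    ∃ n, ∀ m ≥ n, C.approx b K m x = C.approx b K n x := by
  obtain ⟨n, hn⟩ := C.conilpotent x
  refine ⟨n, fun m hm => ?_⟩
  induction m, hm using Nat.le_induction with
  | base => rfl
  | succ m hm ih =>
    obtain ⟨G, hG⟩ := C.approx_sub b K m
    have := LinearMap.congr_fun hG x
    rw [LinearMap.comp_apply, iterComul_eq_zero _ _ hm hn, map_zero, LinearMap.sub_apply,
      sub_eq_zero] at this
    rw [this, ih]

/-- The solution is the pointwise stable value of the approximations. The last clause, that each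
value is attained by some approximation, is kept so that degree statements can be transferred to the
solution. -/
theorem GrCoalg.exists_rec (C : GrCoalg k) (b : C.carrier →ₗ[k] M)
    (K : (C.carrier ⊗[k] M) →ₗ[k] M) : ∃ D : C.carrier →ₗ[k] M,
      D = b + K ∘ₗ LinearMap.lTensor C.carrier D ∘ₗ C.comul ∧
      ∀ x, ∃ n, D x = C.approx b K n x := by
  choose N hN using C.approx_stable b K
  have hS (x : C.carrier) (m : ℕ) (hm : N x ≤ m) :
      C.approx b K (N x) x = C.approx b K m x := (hN x m hm).symm
  -- Linearity is seen by evaluating all the elements involved at one common later stage.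
  let D : C.carrier →ₗ[k] M :=
    { toFun x := C.approx b K (N x) x
      map_add' x y := by
        have h := le_max_left (N (x + y)) (max (N x) (N y))
        have h₁ := (le_max_left _ _).trans (le_max_right (N (x + y)) (max (N x) (N y)))
        have h₂ := (le_max_right _ _).trans (le_max_right (N (x + y)) (max (N x) (N y)))
        rw [hS _ _ h, hS _ _ h₁, hS _ _ h₂, map_add]
      map_smul' c x := by
        rw [hS _ _ (le_max_left (N (c • x)) (N x)), hS _ _ (le_max_right (N (c • x)) (N x)),
          map_smul, RingHom.id_apply] }
  have hD (x : C.carrier) (m : ℕ) (hm : N x ≤ m) : D x = C.approx b K m x := hS x m hm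
  -- A tensor is a finite sum of pure tensors, so a single stage computes `D` on all its right
  -- factors.
  have hT (z : C.carrier ⊗[k] C.carrier) : ∃ n, ∀ m ≥ n,
      LinearMap.lTensor C.carrier D z = LinearMap.lTensor C.carrier (C.approx b K m) z := by
    induction z with
    | zero => exact ⟨0, fun m _ => by simp⟩
    | tmul x y =>
      exact ⟨N y, fun m hm => by rw [LinearMap.lTensor_tmul, LinearMap.lTensor_tmul, hD y m hm]⟩
    | add z w hz hw =>
      obtain ⟨n, hn⟩ := hz
      obtain ⟨n', hn'⟩ := hw
      exact ⟨max n n', fun m hm => by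
        rw [map_add, map_add, hn m (le_of_max_le_left hm), hn' m (le_of_max_le_right hm)]⟩
  refine ⟨D, LinearMap.ext fun x => ?_, fun x => ⟨N x, rfl⟩⟩
  obtain ⟨n, hn⟩ := hT (C.comul x)
  -- Stage `m + 1` is expressed through stage `m`; with `m = max n (N x)` both sides have reached
  -- their stable values.
  have h₁ := hD x (max n (N x) + 1) ((le_max_right n (N x)).trans (Nat.le_succ _))
  rw [h₁, approx, LinearMap.add_apply, LinearMap.add_apply, LinearMap.comp_apply,
    LinearMap.comp_apply, LinearMap.comp_apply, LinearMap.comp_apply, hn _ (le_max_left n (N x))]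

theorem GrCoalg.comul_le (C : GrCoalg k) {n : ℤ} {c : C.carrier} (hc : c ∈ C.gr n)
    {P : Submodule k (C.carrier ⊗[k] C.carrier)}
    (h : ∀ i j, ∀ x ∈ C.gr i, ∀ y ∈ C.gr j, i + j = n → x ⊗ₜ[k] y ∈ P) : C.comul c ∈ P := by
  have : GrMod.tensorGr C.toGrMod C.toGrMod n ≤ P := Submodule.span_le.2 (by
    rintro _ ⟨i, j, x, y, hx, hy, hij, rfl⟩
    exact h i j x hx y hy hij)
  exact this (C.comul_mem hc)

/-- `Q` plays the role of a grading of `M`, which here is only a vector space. -/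
theorem GrCoalg.approx_mem (C : GrCoalg k) {b : C.carrier →ₗ[k] M}
    {K : (C.carrier ⊗[k] M) →ₗ[k] M} {Q : ℤ → Submodule k M}
    (hb : ∀ n, ∀ c ∈ C.gr n, b c ∈ Q n)
    (hK : ∀ i j, ∀ c ∈ C.gr i, ∀ x ∈ Q j, K (c ⊗ₜ x) ∈ Q (i + j)) (m : ℕ) :
    ∀ n, ∀ c ∈ C.gr n, C.approx b K m c ∈ Q n := by
  induction m with
  | zero => exact fun n c _ => Submodule.zero_mem _
  | succ m ih =>
    intro n c hc
    refine Submodule.add_mem _ (hb n c hc) ?_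
    refine C.comul_le (P := (Q n).comap (K ∘ₗ LinearMap.lTensor C.carrier (C.approx b K m))) hc ?_
    rintro i j x hx y hy rfl
    exact hK i j x hx _ (ih j y hy)

end conilpotent

/-! ### The universal property of the cofree conilpotent cocommutative coalgebra -/

section cofree
variable {k : Type u} [Field k] [CharZero k] {V : GrMod k} {C : GrCoalg k}

namespace Sym

theorem eps₂_comul (s : Sym V) : eps₂ V (comul V s) = eps V s := by
  have : eps₂ V = eps V ∘ₗ epsLeft V := TensorProduct.ext' fun s t => by
    rw [eps₂_tmul, LinearMap.comp_apply, epsLeft_tmul, map_smul, smul_eq_mul]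
  rw [this, LinearMap.comp_apply, epsLeft_comul]

/-- The map `c ⊗ s ↦ φ(c) s`. -/
noncomputable def act (φ : C.carrier →ₗ[k] V.carrier) : (C.carrier ⊗[k] Sym V) →ₗ[k] Sym V :=
  TensorProduct.lift (L V ∘ₗ φ)

/-- The equation that characterizes the exponential of `φ` with respect to convolution, without
the constant term. -/
def IsExp (φ : C.carrier →ₗ[k] V.carrier) (Φ : C.carrier →ₗ[k] Sym V) : Prop :=
  Φ = weightInv V ∘ₗ ((L V).flip 1 ∘ₗ φ + act φ ∘ₗ LinearMap.lTensor C.carrier Φ ∘ₗ C.comul)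

/-- With `1 + Φ = exp φ` and `W` the weight operator, `W (exp φ) = φ * exp φ` reads `W Φ = φ + φ *
Φ`. Dividing by the weight expresses `Φ(c)` through `Φ` on the second factors of `Δ c`, which is a
recursion of the solvable type; every operation in it preserves degrees. -/
theorem exists_isExp {φ : C.carrier →ₗ[k] V.carrier} (hφ : GrMod.IsHom C.toGrMod V 0 φ) :
    ∃ Φ : C.carrier →ₗ[k] Sym V, IsExp φ Φ ∧ ∀ n, ∀ c ∈ C.gr n, Φ c ∈ gr V n := by
  have hφ' (n : ℤ) (c : C.carrier) (hc : c ∈ C.gr n) : φ c ∈ V.gr n := by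
    simpa only [add_zero] using hφ n c hc
  obtain ⟨Φ, h₁, h₂⟩ := C.exists_rec (weightInv V ∘ₗ (L V).flip 1 ∘ₗ φ) (weightInv V ∘ₗ act φ)
  refine ⟨Φ, ?_, fun n c hc => ?_⟩
  · rw [IsExp, LinearMap.comp_add]
    exact h₁
  · obtain ⟨m, hm⟩ := h₂ c
    rw [hm]
    refine C.approx_mem (Q := gr V) (fun n c hc => ?_) (fun i j c hc x hx => ?_) m n c hc
    · refine weightInv_mem ?_
      have := L_mem (hφ' n c hc) one_mem
      rwa [add_zero] at this
    · exact weightInv_mem (L_mem (hφ' i c hc) hx)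

theorem eps_act (z : C.carrier ⊗[k] Sym V) : eps V (act φ z) = 0 := by
  have : eps V ∘ₗ act φ = 0 := TensorProduct.ext' fun c s => eps_L _ _
  exact LinearMap.congr_fun this z

section IsExp
variable {φ : C.carrier →ₗ[k] V.carrier} {Φ : C.carrier →ₗ[k] Sym V} (h : IsExp φ Φ)
include h

theorem IsExp.eps (c : C.carrier) : eps V (Φ c) = 0 := by
  rw [h]
  exact eps_weightInv _

/-- The division by the weight can be undone because the right hand side consists of multiples of
generators and so has no constant term. -/
theorem IsExp.weight (c : C.carrier) : weight V (Φ c) =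
    L V (φ c) 1 + act φ (LinearMap.lTensor C.carrier Φ (C.comul c)) := by
  have e : Φ c = weightInv V (L V (φ c) 1 + act φ (LinearMap.lTensor C.carrier Φ (C.comul c))) :=
    LinearMap.congr_fun h c
  conv_lhs => rw [e]
  exact weight_weightInv (by rw [map_add, eps_L, eps_act, add_zero])

/-- Of the terms on the right only `φ(c)` is linear: in `φ(c') Φ(c'')` the second factor has no
constant term. -/
theorem IsExp.pr (c : C.carrier) : pr V (Φ c) = φ c := by
  have e : Φ c = weightInv V (L V (φ c) 1 + act φ (LinearMap.lTensor C.carrier Φ (C.comul c))) :=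
    LinearMap.congr_fun h c
  have : Sym.pr V ∘ₗ act φ ∘ₗ LinearMap.lTensor C.carrier Φ = 0 := TensorProduct.ext' fun x y => by
    have : Sym.pr V (L V (φ x) (Φ y)) = 0 := by rw [pr_L, h.eps, zero_smul]
    exact this
  rw [e, pr_weightInv, map_add, pr_L, eps_one, one_smul]
  have := LinearMap.congr_fun this (C.comul c)
  rw [LinearMap.comp_apply, LinearMap.comp_apply, LinearMap.zero_apply] at this
  rw [this, add_zero]

/-- This says that `1 + Φ` is group-like, the constant term being left out. Both sides, as functions
`Z` of `c`, satisfy `weight₂ Z = r + R (id ⊗ Z) Δ`. Their difference satisfies the homogeneous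
equation and has no constant component, so the weight can be divided out and the difference vanishes
by conilpotence. -/
theorem IsExp.comul (hφ : GrMod.IsHom C.toGrMod V 0 φ) (hΦ : ∀ n, ∀ c ∈ C.gr n, Φ c ∈ gr V n)
    (c : C.carrier) : comul V (Φ c) =
      Φ c ⊗ₜ 1 + 1 ⊗ₜ Φ c + TensorProduct.map Φ Φ (C.comul c) := by
  have hφ' (n : ℤ) (c : C.carrier) (hc : c ∈ C.gr n) : φ c ∈ V.gr n := by
    simpa only [add_zero] using hφ n c hc
  let A : (C.carrier ⊗[k] C.carrier) →ₗ[k] Sym V := act φ ∘ₗ LinearMap.lTensor C.carrier Φ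
  let b : C.carrier →ₗ[k] Sym V := (L V).flip 1 ∘ₗ φ
  let R : (C.carrier ⊗[k] (Sym V ⊗[k] Sym V)) →ₗ[k] (Sym V ⊗[k] Sym V) :=
    TensorProduct.lift (rho V ∘ₗ φ)
  let i₁ : Sym V →ₗ[k] Sym V ⊗[k] Sym V := (TensorProduct.mk k _ _).flip 1
  let i₂ : Sym V →ₗ[k] Sym V ⊗[k] Sym V := TensorProduct.mk k _ _ 1
  let X : C.carrier →ₗ[k] Sym V ⊗[k] Sym V := Sym.comul V ∘ₗ Φ
  let Y : C.carrier →ₗ[k] Sym V ⊗[k] Sym V :=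
    i₁ ∘ₗ Φ + i₂ ∘ₗ Φ + TensorProduct.map Φ Φ ∘ₗ C.comul
  have hW : Sym.weight V ∘ₗ Φ = b + A ∘ₗ C.comul := LinearMap.ext h.weight
  let r : C.carrier →ₗ[k] Sym V ⊗[k] Sym V := (rho V).flip (1 ⊗ₜ 1) ∘ₗ φ
  -- For `X = Δ Φ`: the comultiplication commutes with the weight operators and turns multiplication
  -- by `φ(c)` into `rho V (φ c)`.
  have hX : weight₂ V ∘ₗ X = r + R ∘ₗ LinearMap.lTensor C.carrier X ∘ₗ C.comul := by
    have e : Sym.comul V ∘ₗ A = R ∘ₗ LinearMap.lTensor C.carrier X :=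
      TensorProduct.ext' fun x y => comul_L _ _
    refine LinearMap.ext fun c => ?_
    have e₁ : weight₂ V (X c) = Sym.comul V (Sym.weight V (Φ c)) := (comul_weight _).symm
    have e₂ : Sym.comul V (L V (φ c) 1) = r c := by rw [comul_L, comul_one]; rfl
    rw [LinearMap.comp_apply, e₁, h.weight, map_add, e₂]
    exact congrArg (r c + ·) (LinearMap.congr_fun e (C.comul c))
  -- The generator `φ(x)` enters either factor of `Φ(y) ⊗ 1`. Entering the right factor it passes
  -- `Φ(y)`; as `φ` and `Φ` have degree `0`, the sign is that of the braiding of `x` and `y`.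
  have r₁ : R ∘ₗ LinearMap.lTensor C.carrier (i₁ ∘ₗ Φ) =
      i₁ ∘ₗ A + TensorProduct.map Φ b ∘ₗ GrMod.braid C.toGrMod C.toGrMod := by
    refine GrMod.ext_gr₂ C.toGrMod C.toGrMod fun i j x hx y hy => ?_
    rw [LinearMap.add_apply, LinearMap.comp_apply _ (GrMod.braid _ _), GrMod.braid_apply _ _ hx hy,
      map_smul]
    exact rho_tmul (hφ' _ _ hx) (hΦ _ _ hy) 1
  have r₂ : R ∘ₗ LinearMap.lTensor C.carrier (i₂ ∘ₗ Φ) = TensorProduct.map b Φ + i₂ ∘ₗ A := by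
    refine GrMod.ext_gr₂ C.toGrMod C.toGrMod fun i j x hx y hy => ?_
    have := rho_tmul (hφ' _ _ hx) one_mem (Φ y)
    rw [mul_zero, sg_even Even.zero, one_smul] at this
    exact this
  -- The same dichotomy on three arguments: entering the second factor exchanges the first two
  -- arguments.
  have r₃ : R ∘ₗ LinearMap.lTensor C.carrier (TensorProduct.map Φ Φ) =
      TensorProduct.map A Φ ∘ₗ (TensorProduct.assoc k _ _ _).symm.toLinearMap +
        TensorProduct.map Φ A ∘ₗ braid₁₂ C.toGrMod := by
    refine GrMod.ext_gr₃ C.toGrMod C.toGrMod C.toGrMod fun i j l x hx y hy z hz => ?_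
    have e₄ : braid₁₂ C.toGrMod (x ⊗ₜ (y ⊗ₜ z)) = (sg (i * j) : k) • (y ⊗ₜ (x ⊗ₜ z)) := by
      simp only [braid₁₂, LinearMap.comp_apply, LinearEquiv.coe_coe, TensorProduct.assoc_symm_tmul,
        LinearMap.rTensor_tmul, GrMod.braid_apply _ _ hx hy, ← TensorProduct.smul_tmul', map_smul,
        TensorProduct.assoc_tmul]
    rw [LinearMap.add_apply, LinearMap.comp_apply _ (braid₁₂ _), e₄, map_smul]
    exact rho_tmul (hφ' _ _ hx) (hΦ _ _ hy) (Φ z)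
  have hr : r = i₁ ∘ₗ b + i₂ ∘ₗ b := C.ext_gr fun n c hc => by
    have := rho_tmul (hφ' _ _ hc) one_mem 1
    rw [mul_zero, sg_even Even.zero, one_smul] at this
    exact this
  have hY : weight₂ V ∘ₗ Y = r + R ∘ₗ LinearMap.lTensor C.carrier Y ∘ₗ C.comul := by
    have w₁ : weight₂ V ∘ₗ i₁ = i₁ ∘ₗ Sym.weight V := LinearMap.ext fun s => by
      refine (weight₂_tmul s 1).trans ?_
      rw [weight_one, TensorProduct.tmul_zero, add_zero]
      rfl
    have w₂ : weight₂ V ∘ₗ i₂ = i₂ ∘ₗ Sym.weight V := LinearMap.ext fun s => by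
      refine (weight₂_tmul 1 s).trans ?_
      rw [weight_one, TensorProduct.zero_tmul, zero_add]
      rfl
    have w₃ : weight₂ V ∘ₗ TensorProduct.map Φ Φ =
        TensorProduct.map (Sym.weight V ∘ₗ Φ) Φ + TensorProduct.map Φ (Sym.weight V ∘ₗ Φ) :=
      TensorProduct.ext' fun x y => rfl
    have c₁ : TensorProduct.map (A ∘ₗ C.comul) Φ =
        TensorProduct.map A Φ ∘ₗ C.comul.rTensor C.carrier := (LinearMap.map_comp_rTensor ..).symm
    have c₂ : TensorProduct.map Φ (A ∘ₗ C.comul) =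
        TensorProduct.map Φ A ∘ₗ C.comul.lTensor C.carrier := (LinearMap.map_comp_lTensor ..).symm
    refine LinearMap.ext fun c => ?_
    -- The coalgebra axioms match the two expansions: cocommutativity removes the braidings coming
    -- from `r₁` and `r₃`, and coassociativity identifies the two ways of comultiplying twice.
    have h₁ := LinearMap.congr_fun C.cocomm c
    have h₂ := LinearMap.congr_fun C.coassoc c
    have h₃ := braid₁₂_comul C c
    simp only [LinearMap.comp_apply, LinearEquiv.coe_coe] at h₁ h₂
    rw [← LinearEquiv.eq_symm_apply] at h₂
    have e₁ : weight₂ V ∘ₗ Y = i₁ ∘ₗ (b + A ∘ₗ C.comul) + i₂ ∘ₗ (b + A ∘ₗ C.comul) +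
        (TensorProduct.map b Φ + TensorProduct.map A Φ ∘ₗ C.comul.rTensor C.carrier +
          (TensorProduct.map Φ b + TensorProduct.map Φ A ∘ₗ C.comul.lTensor C.carrier)) ∘ₗ
          C.comul := by
      simp only [Y, LinearMap.comp_add, ← LinearMap.comp_assoc, w₁, w₂, w₃]
      simp only [LinearMap.comp_assoc, hW, TensorProduct.map_add_left, TensorProduct.map_add_right,
        c₁, c₂]
      simp only [← LinearMap.comp_assoc, LinearMap.comp_add]
    have e₂ : R ∘ₗ LinearMap.lTensor C.carrier Y =
        i₁ ∘ₗ A + TensorProduct.map Φ b ∘ₗ GrMod.braid C.toGrMod C.toGrMod +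
        (TensorProduct.map b Φ + i₂ ∘ₗ A) +
        (TensorProduct.map A Φ ∘ₗ (TensorProduct.assoc k _ _ _).symm.toLinearMap +
        TensorProduct.map Φ A ∘ₗ braid₁₂ C.toGrMod) ∘ₗ C.comul.lTensor C.carrier := by
      simp only [Y, LinearMap.lTensor_add, LinearMap.lTensor_comp, LinearMap.comp_add, ← r₁, ← r₂,
        ← r₃, LinearMap.comp_assoc]
    rw [e₁, hr, ← LinearMap.comp_assoc _ _ R, e₂]
    simp only [LinearMap.add_apply, LinearMap.comp_apply, LinearEquiv.coe_coe, h₁, ← h₂, h₃,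
      map_add]
    abel
  have hXY : X - Y = 0 := by
    refine C.eq_zero_of_rec (weightInv₂ V ∘ₗ R) ?_
    refine LinearMap.ext fun c => ?_
    -- Absence of a constant component is needed to recover `X - Y` from its image under `weight₂`.
    have e : eps₂ V ((X - Y) c) = 0 := by
      have e₁ : eps₂ V (X c) = 0 := (eps₂_comul _).trans (h.eps c)
      have e₂ : eps₂ V ∘ₗ TensorProduct.map Φ Φ = 0 := TensorProduct.ext' fun x y => by
        rw [LinearMap.comp_apply, TensorProduct.map_tmul, eps₂_tmul, h.eps, zero_mul]
        rfl
      have e₃ : eps₂ V (Y c) = 0 := by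
        change eps₂ V (Φ c ⊗ₜ 1 + 1 ⊗ₜ Φ c + TensorProduct.map Φ Φ (C.comul c)) = 0
        rw [map_add, map_add, eps₂_tmul, eps₂_tmul, h.eps, zero_mul, mul_zero, add_zero, zero_add]
        exact LinearMap.congr_fun e₂ _
      rw [LinearMap.sub_apply, map_sub, e₁, e₃, sub_zero]
    have e' : weight₂ V ∘ₗ (X - Y) = R ∘ₗ LinearMap.lTensor C.carrier (X - Y) ∘ₗ C.comul := by
      rw [LinearMap.comp_sub, hX, hY, LinearMap.lTensor_sub, LinearMap.sub_comp, LinearMap.comp_sub]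
      abel
    rw [← weightInv₂_weight₂ e]
    exact congrArg (weightInv₂ V) (LinearMap.congr_fun e' c)
  exact LinearMap.congr_fun (sub_eq_zero.1 hXY) c

end IsExp

end Sym

/-! ### Maps into the reduced symmetric coalgebra -/

namespace Red

/-- The projection to the generators. -/
noncomputable def pr (V : GrMod k) : Red V →ₗ[k] V.carrier := desc (Sym.pr V) Sym.pr_one

theorem pr_q (s : Sym V) : pr V (q V s) = Sym.pr V s := rfl

theorem pr_mem {n : ℤ} {x : Red V} (hx : x ∈ (grMod V).gr n) : pr V x ∈ V.gr n := by
  obtain ⟨s, hs, rfl⟩ := hx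
  exact Sym.pr_mem hs

/-- The section of the projection `q` with values in the kernel of the counit. -/
noncomputable def sec (V : GrMod k) : Red V →ₗ[k] Sym V :=
  desc (LinearMap.id - (Sym.eps V).smulRight 1) (by simp [Sym.eps_one])

theorem sec_q (s : Sym V) : sec V (q V s) = s - Sym.eps V s • 1 := rfl

theorem q_sec (x : Red V) : q V (sec V x) = x := by
  obtain ⟨s, rfl⟩ := q_surjective x
  rw [sec_q, map_sub, map_smul, q_one, smul_zero, sub_zero]

theorem eps_sec (x : Red V) : Sym.eps V (sec V x) = 0 := by
  obtain ⟨s, rfl⟩ := q_surjective x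
  rw [sec_q, map_sub, map_smul, Sym.eps_one, smul_eq_mul, mul_one, sub_self]

/-- For an element without constant term the full comultiplication is the reduced one plus the two
primitive terms. It follows by expanding `(s' - ε(s') 1) ⊗ (s'' - ε(s'') 1)` over `Δ s` and applying
the counit axioms. -/
theorem comul_sec (x : Red V) : Sym.comul V (sec V x) =
    sec V x ⊗ₜ 1 + 1 ⊗ₜ sec V x + TensorProduct.map (sec V) (sec V) (comul V x) := by
  obtain ⟨s, rfl⟩ := q_surjective x
  have h : TensorProduct.map (sec V) (sec V) ∘ₗ TensorProduct.map (q V) (q V) =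
      LinearMap.id - (TensorProduct.mk k _ _).flip 1 ∘ₗ Sym.epsRight V -
        TensorProduct.mk k _ _ 1 ∘ₗ Sym.epsLeft V + (Sym.eps₂ V).smulRight (1 ⊗ₜ 1) := by
    refine TensorProduct.ext' fun s t => ?_
    have h₁ : (TensorProduct.map (sec V) (sec V) ∘ₗ TensorProduct.map (q V) (q V)) (s ⊗ₜ[k] t) =
      (s - Sym.eps V s • 1) ⊗ₜ (t - Sym.eps V t • 1) := rfl
    rw [h₁]
    simp only [LinearMap.add_apply, LinearMap.sub_apply, LinearMap.id_apply, LinearMap.comp_apply,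
      Sym.epsRight_tmul, Sym.epsLeft_tmul, LinearMap.flip_apply, TensorProduct.mk_apply,
      LinearMap.smulRight_apply, Sym.eps₂_tmul, TensorProduct.sub_tmul, TensorProduct.tmul_sub,
      TensorProduct.tmul_smul, ← TensorProduct.smul_tmul']
    module
  have h' := LinearMap.congr_fun h (Sym.comul V s)
  rw [LinearMap.comp_apply] at h'
  rw [comul_q, h', sec_q, map_sub, map_smul, Sym.comul_one]
  simp only [LinearMap.add_apply, LinearMap.sub_apply, LinearMap.id_apply, LinearMap.comp_apply,
    Sym.epsRight_comul, Sym.epsLeft_comul, LinearMap.flip_apply, TensorProduct.mk_apply,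
    LinearMap.smulRight_apply, Sym.eps₂_comul, TensorProduct.sub_tmul, TensorProduct.tmul_sub,
    TensorProduct.tmul_smul, ← TensorProduct.smul_tmul']
  module

/-- Apply `prL` to the formula for the comultiplication: the term `1 ⊗ s` dies since `1` has no
linear part, and `s ⊗ 1` gives the linear part of `s`. Thus a reduced element is determined by its
linear part and its reduced comultiplication. -/
theorem weight_sec (x : Red V) : Sym.weight V (sec V x) = Sym.L V (pr V x) 1 +
    TensorProduct.lift (Sym.L V ∘ₗ pr V) (LinearMap.lTensor (Red V) (sec V) (comul V x)) := by
  have h₁ : Sym.prL V ∘ₗ TensorProduct.map (sec V) (sec V) =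
      TensorProduct.lift (Sym.L V ∘ₗ pr V) ∘ₗ LinearMap.lTensor (Red V) (sec V) := by
    refine TensorProduct.ext' fun x y => ?_
    have : Sym.pr V (sec V x) = pr V x := by
      rw [← pr_q, q_sec]
    rw [LinearMap.comp_apply, TensorProduct.map_tmul, Sym.prL_tmul, this]
    rfl
  have h₂ := LinearMap.congr_fun h₁ (comul V x)
  rw [LinearMap.comp_apply] at h₂
  have h₃ : Sym.pr V (sec V x) = pr V x := by rw [← pr_q, q_sec]
  rw [← Sym.prL_comul, comul_sec, map_add, map_add, h₂, Sym.prL_tmul, Sym.prL_tmul, Sym.pr_one,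
    h₃, map_zero, LinearMap.zero_apply, add_zero]
  rfl

/-- A (co)derivation to `Red V` whose projection to the generators vanishes is zero; applied to the
difference of two morphisms, this also shows that a morphism is determined by its projection. -/
theorem eq_zero_of_coder {D A B : C.carrier →ₗ[k] Red V} (hD : pr V ∘ₗ D = 0)
    (h : comul V ∘ₗ D = (TensorProduct.map D A + TensorProduct.map B D) ∘ₗ C.comul) : D = 0 := by
  have key : sec V ∘ₗ D = 0 := by
    refine C.eq_zero_of_rec (Sym.weightInv V ∘ₗ TensorProduct.lift (Sym.L V ∘ₗ pr V ∘ₗ B)) ?_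
    refine LinearMap.ext fun c => ?_
    -- Since `D` has no linear part, the terms in which `D` sits in the left factor drop out. The
    -- weight of `D c` is then linear in `D` of the second factors of `Δ c`, a homogeneous
    -- recursion.
    have h₁ : TensorProduct.lift (Sym.L V ∘ₗ pr V) ∘ₗ LinearMap.lTensor (Red V) (sec V) ∘ₗ
        (TensorProduct.map D A + TensorProduct.map B D) =
        TensorProduct.lift (Sym.L V ∘ₗ pr V ∘ₗ B) ∘ₗ LinearMap.lTensor C.carrier (sec V ∘ₗ D) := by
      refine TensorProduct.ext' fun x y => ?_
      have e : pr V (D x) = 0 := LinearMap.congr_fun hD x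
      have : Sym.L V (pr V (D x)) (sec V (A y)) + Sym.L V (pr V (B x)) (sec V (D y)) =
          Sym.L V (pr V (B x)) (sec V (D y)) := by
        rw [e, map_zero, LinearMap.zero_apply, zero_add]
      simp only [LinearMap.comp_apply, LinearMap.add_apply, map_add]
      exact this
    have h₂ := LinearMap.congr_fun h c
    have h₃ : pr V (D c) = 0 := LinearMap.congr_fun hD c
    have h₄ := weight_sec (D c)
    rw [h₃, map_zero, LinearMap.zero_apply, zero_add] at h₄
    rw [LinearMap.comp_apply, LinearMap.comp_apply] at h₂
    rw [h₂] at h₄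
    have h₅ := LinearMap.congr_fun h₁ (C.comul c)
    simp only [LinearMap.comp_apply] at h₅
    rw [h₅] at h₄
    rw [LinearMap.comp_apply, ← Sym.weightInv_weight (eps_sec (D c)), h₄]
    rfl
  refine LinearMap.ext fun c => ?_
  rw [← q_sec (D c)]
  have := LinearMap.congr_fun key c
  rw [LinearMap.comp_apply] at this
  rw [this, LinearMap.zero_apply, map_zero, LinearMap.zero_apply]

/-- Writing `Φ ⊗ Φ - Ψ ⊗ Ψ = (Φ - Ψ) ⊗ Φ + Ψ ⊗ (Φ - Ψ)` makes the difference a coderivation along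
the two maps. -/
theorem map_ext {Φ Ψ : C.carrier →ₗ[k] Red V}
    (hΦ : ∀ c, comul V (Φ c) = TensorProduct.map Φ Φ (C.comul c))
    (hΨ : ∀ c, comul V (Ψ c) = TensorProduct.map Ψ Ψ (C.comul c))
    (h : ∀ c, pr V (Φ c) = pr V (Ψ c)) : Φ = Ψ := by
  rw [← sub_eq_zero]
  refine eq_zero_of_coder (A := Φ) (B := Ψ) (LinearMap.ext fun c => ?_) (LinearMap.ext fun c => ?_)
  · rw [LinearMap.comp_apply, LinearMap.sub_apply, map_sub, h, sub_self, LinearMap.zero_apply]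
  · have : TensorProduct.map (Φ - Ψ) Φ + TensorProduct.map Ψ (Φ - Ψ) =
        TensorProduct.map Φ Φ - TensorProduct.map Ψ Ψ := TensorProduct.ext' fun x y => by
      simp only [LinearMap.add_apply, LinearMap.sub_apply, TensorProduct.map_tmul,
        TensorProduct.sub_tmul, TensorProduct.tmul_sub]
      abel
    rw [this, LinearMap.comp_apply, LinearMap.comp_apply, LinearMap.sub_apply, map_sub, hΦ, hΨ,
      LinearMap.sub_apply]

/-- The exponential without its constant term, taken modulo `1`: the summands `Φ ⊗ 1` and `1 ⊗ Φ` of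
its comultiplication vanish in the quotient. -/
theorem exists_map {φ : C.carrier →ₗ[k] V.carrier} (hφ : GrMod.IsHom C.toGrMod V 0 φ) :
    ∃ Φ : C.carrier →ₗ[k] Red V, (∀ n, ∀ c ∈ C.gr n, Φ c ∈ (grMod V).gr n) ∧
      (∀ c, comul V (Φ c) = TensorProduct.map Φ Φ (C.comul c)) ∧ ∀ c, pr V (Φ c) = φ c := by
  obtain ⟨Φ, h, hm⟩ := Sym.exists_isExp hφ
  refine ⟨q V ∘ₗ Φ, fun n c hc => q_mem (hm n c hc), fun c => ?_, fun c => h.pr c⟩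
  rw [LinearMap.comp_apply, comul_q, h.comul hφ hm, map_add, map_add, TensorProduct.map_tmul,
    TensorProduct.map_tmul, q_one, TensorProduct.tmul_zero, TensorProduct.zero_tmul, zero_add,
    zero_add, TensorProduct.map_comp]
  rfl

end Red

end cofree

/-! ### Elements of the convolution algebra -/

section convVal
variable {k : Type u} [Field k] [CharZero k] {C D : DGCoalg k} {g h : DGLie k}

/-- The linear map underlying an element of the convolution algebra. -/
noncomputable def convVal (C : DGCoalg k) (g : DGLie k) :
    (conv C g).carrier →ₗ[k] (C.carrier →ₗ[k] g.carrier) :=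
  (GrMod.homTotal C.toGrMod g.toGrMod).subtype

/-- The element of the convolution algebra given by a linear map. -/
noncomputable def convMk (f : C.carrier →ₗ[k] g.carrier)
    (hf : f ∈ GrMod.homTotal C.toGrMod g.toGrMod) : (conv C g).carrier := ⟨f, hf⟩

theorem convVal_injective : Function.Injective (convVal C g) := Subtype.val_injective

theorem mem_conv_gr {x : (conv C g).carrier} {p : ℤ} :
    x ∈ (conv C g).gr p ↔ GrMod.IsHom C.toGrMod g.toGrMod p (convVal C g x) := Iff.rfl

theorem convVal_bracket (x y : (conv C g).carrier) : convVal C g ((conv C g).bracket x y) =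
    convBracket C.toGrCoalg g.toGrLie (convVal C g x) (convVal C g y) := rfl

theorem convVal_d (x : (conv C g).carrier) :
    convVal C g ((conv C g).d x) = convD C g (convVal C g x) := rfl

end convVal

/-! ### Maurer-Cartan elements -/

section mc
variable {k : Type u} [Field k] [CharZero k] {L M : DGLie k}

/-- The morphism from a free graded Lie algebra with differential given by its values on the
generators. -/
noncomputable def freeDGLieLift {V : GrMod k} {δ : V →ₗ[k] (freeLie V).carrier}
    {hδ : GrMod.IsHom V (freeLie V).toGrMod (-1) δ} {h : ∀ v, FreeLie.der δ hδ (δ v) = 0}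
    (φ : V →ₗ[k] L.carrier) (hφ : GrMod.IsHom V L.toGrMod 0 φ)
    (hd : ∀ v, FreeLie.lift (M := L.toGrLie) φ hφ (δ v) = L.d (φ v)) :
    freeDGLie δ hδ h ⟶ L where
  map := FreeLie.lift (M := L.toGrLie) φ hφ
  map_mem := FreeLie.lift_mem hφ
  map_bracket := FreeLie.lift_bracket hφ
  map_d a := by
    -- Both composites obey the Leibniz rule along the lift, so agreement on the generators
    -- suffices.
    have : FreeLie.lift (M := L.toGrLie) φ hφ ∘ₗ FreeLie.der δ hδ =
        L.d ∘ₗ FreeLie.lift (M := L.toGrLie) φ hφ := by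
      refine FreeLie.ext_mon (fun v => ?_) fun x y hx hy => ?_
      · rw [LinearMap.comp_apply, LinearMap.comp_apply, FreeLie.der_inc, FreeLie.lift_inc, hd]
      · have hm := FreeLie.lift_mem (M := L.toGrLie) hφ (FreeLie.gmon_mem x)
        simp only [LinearMap.comp_apply] at hx hy ⊢
        rw [FreeLie.der_leibniz hδ (FreeLie.gmon_mem x), map_add, map_smul, FreeLie.lift_bracket,
          FreeLie.lift_bracket, FreeLie.lift_bracket, L.leibniz hm, hx, hy]
    exact LinearMap.congr_fun this a

theorem freeDGLie_hom_ext {V : GrMod k} {δ : V →ₗ[k] (freeLie V).carrier}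
    {hδ : GrMod.IsHom V (freeLie V).toGrMod (-1) δ} {h : ∀ v, FreeLie.der δ hδ (δ v) = 0}
    {α β : freeDGLie δ hδ h ⟶ L} (e : ∀ v, α.map (FreeLie.inc V v) = β.map (FreeLie.inc V v)) :
    α = β := by
  refine DGLie.Hom.ext (FreeLie.ext_mon e fun x y hx hy => ?_)
  exact (α.map_bracket _ _).trans ((congrArg₂ (fun a b => L.bracket a b) hx hy).trans
    (β.map_bracket _ _).symm)

/-- Maurer-Cartan elements. -/
def IsMC (L : DGLie k) (x : L.carrier) : Prop :=
  x ∈ L.gr (-1) ∧ L.d x = -((1 / 2 : k) • L.bracket x x)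

theorem IsMC.map {x : L.carrier} (hx : IsMC L x) (χ : L ⟶ M) : IsMC M (χ.map x) := by
  refine ⟨χ.map_mem hx.1, ?_⟩
  rw [← χ.map_d, hx.2, map_neg, map_smul, χ.map_bracket]

/-- The generator of the universal Maurer-Cartan Lie algebra. -/
noncomputable def mcElt (k : Type u) [Field k] [CharZero k] : (mcLie k).carrier := mcGen k

theorem mcElt_isMC : IsMC (mcLie k) (mcElt k) :=
  ⟨mcGen_mem, (FreeLie.der_inc mcDelta_mem (GrMod.lineGen k (-1))).trans
    ((mcDelta_apply (1 : k)).trans (one_smul k _))⟩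

theorem line_ext {N : Type*} [AddCommGroup N] [Module k N] {p : ℤ} {f g : GrMod.line k p →ₗ[k] N}
    (h : f (GrMod.lineGen k p) = g (GrMod.lineGen k p)) : f = g := by
  refine LinearMap.ext fun v => ?_
  -- The line has carrier `k` and basis vector `1`; `id v` only reads `v` as a scalar.
  have hv : v = (id v : k) • GrMod.lineGen k p := (mul_one (id v : k)).symm
  rw [hv, map_smul, map_smul, h]

/-- Together with `mcLift` this identifies morphisms out of `mcLie k` with Maurer-Cartan elements,
and reduces every later equation between such morphisms to one about cochains. -/
theorem mc_hom_ext {α β : mcLie k ⟶ L} (h : α.map (mcElt k) = β.map (mcElt k)) : α = β :=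
  freeDGLie_hom_ext fun v =>
    LinearMap.congr_fun (line_ext (f := α.map ∘ₗ FreeLie.inc (GrMod.line k (-1)))
      (g := β.map ∘ₗ FreeLie.inc (GrMod.line k (-1))) h) v

theorem mc_line_isHom {x : L.carrier} (hx : IsMC L x) :
    GrMod.IsHom (GrMod.line k (-1)) L.toGrMod 0
      (show (GrMod.line k (-1)).carrier →ₗ[k] L.carrier from
        LinearMap.toSpanSingleton k L.carrier x) := by
  intro n v hv
  by_cases hn : n = -1
  · subst hn
    exact Submodule.smul_mem _ _ hx.1
  · rw [GrMod.line_eq_zero hn hv, map_zero]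
    exact Submodule.zero_mem _

/-- The morphism from the universal Maurer-Cartan Lie algebra given by a Maurer-Cartan element. -/
noncomputable def mcLift {x : L.carrier} (hx : IsMC L x) : mcLie k ⟶ L :=
  freeDGLieLift (show (GrMod.line k (-1)).carrier →ₗ[k] L.carrier from
    LinearMap.toSpanSingleton k L.carrier x) (mc_line_isHom hx) fun v => by
    have e : FreeLie.lift (M := L.toGrLie) _ (mc_line_isHom hx) (mcGen k) = x :=
      (FreeLie.lift_inc (mc_line_isHom hx) (GrMod.lineGen k (-1))).trans (one_smul k x)
    have h₁ : FreeLie.lift (M := L.toGrLie) _ (mc_line_isHom hx) (mcDelta k v) =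
        (id v : k) • (-((1 / 2 : k) • L.bracket x x)) := by
      have : mcDelta k v = (id v : k) •
        (-((1 / 2 : k) • (freeLie (GrMod.line k (-1))).bracket (mcGen k) (mcGen k))) := rfl
      rw [this, map_smul, map_neg, map_smul, FreeLie.lift_bracket, e]
    rw [h₁, ← hx.2, ← map_smul]
    rfl

theorem mcLift_elt {x : L.carrier} (hx : IsMC L x) : (mcLift hx).map (mcElt k) = x :=
  (FreeLie.lift_inc (mc_line_isHom hx) (GrMod.lineGen k (-1))).trans (one_smul k x)

end mc

/-! ### The universal property of the cobar construction -/

section cobar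
variable {k : Type u} [Field k] [CharZero k]

/-- The equation for Maurer-Cartan elements of the convolution algebra. -/
theorem isMC_conv {C : DGCoalg k} {g : DGLie k} {x : (conv C g).carrier} :
    IsMC (conv C g) x ↔ GrMod.IsHom C.toGrMod g.toGrMod (-1) (convVal C g x) ∧
      ∀ c, g.d (convVal C g x c) = -(convVal C g x (C.d c)) -
        (1 / 2 : k) • convBracket C.toGrCoalg g.toGrLie (convVal C g x) (convVal C g x) c := by
  refine and_congr_right fun hx => ?_
  have hx' : GrMod.IsHom C.toGrMod g.toGrMod (-1) (convVal C g x) := hx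
  -- In degree `-1` the differential of `f` is `d f + f d`. Solved for `d f`, the equation has the
  -- shape of the cobar differential on generators.
  rw [← convVal_injective.eq_iff, convVal_d, convD_eq hx', map_neg, map_smul, convVal_bracket,
    sg_neg_one, LinearMap.ext_iff]
  refine forall_congr' fun c => ?_
  simp only [LinearMap.sub_apply, LinearMap.neg_apply, LinearMap.smul_apply, LinearMap.comp_apply]
  rw [sub_eq_iff_eq_add]
  refine Eq.congr_right ?_
  module

/-- The universal twisting cochain, as a morphism. -/
noncomputable def cobarUnit (C : DGCoalg k) : mcLie k ⟶ conv C (cobarObj C) :=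
  mcLift (x := convMk (g := cobarObj C) (cobarInc C) (cobarInc_mem C).mem_homTotal)
    (isMC_conv.2 ⟨cobarInc_mem C, fun c => cobarD_inc C c⟩)

theorem cobarUnit_elt (C : DGCoalg k) :
    convVal C (cobarObj C) ((cobarUnit C).map (mcElt k)) = cobarInc C :=
  congrArg (convVal C (cobarObj C)) (mcLift_elt _)

/-- Both morphisms correspond to the cochain `c ↦ Σφ(c)`. -/
theorem cobarUnit_natural {C D : DGCoalg k} (φ : C ⟶ D) :
    cobarUnit D ≫ convHom φ (𝟙 _) = cobarUnit C ≫ convHom (𝟙 C) (cobarMap φ) := by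
  refine mc_hom_ext (convVal_injective (LinearMap.ext fun c => ?_))
  change convVal D (cobarObj D) ((cobarUnit D).map (mcElt k)) (φ.map c) =
    cobarLift φ (convVal C (cobarObj C) ((cobarUnit C).map (mcElt k)) c)
  rw [cobarUnit_elt, cobarUnit_elt]
  exact (cobarLift_inc φ c).symm

/-- The cochain belonging to `cobarUnit C ≫ convHom (𝟙 C) ψ` is the restriction of `ψ` to the
generators of the cobar construction. -/
theorem cobar_hom_ext {C : DGCoalg k} {g : DGLie k} {ψ ψ' : cobarObj C ⟶ g}
    (h : cobarUnit C ≫ convHom (𝟙 C) ψ = cobarUnit C ≫ convHom (𝟙 C) ψ') : ψ = ψ' := by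
  refine cobarHom_ext fun c => ?_
  have := congrArg (fun α : mcLie k ⟶ conv C g => convVal C g (α.map (mcElt k)) c) h
  change ψ.map (convVal C (cobarObj C) ((cobarUnit C).map (mcElt k)) c) =
    ψ'.map (convVal C (cobarObj C) ((cobarUnit C).map (mcElt k)) c) at this
  rwa [cobarUnit_elt] at this

/-- A twisting cochain has degree `0` as a map on `ΣC`, so it extends to the free Lie algebra.
Commutation with the differentials has to be checked on generators only, where it is the
Maurer-Cartan equation. -/
theorem cobar_exists_desc {C : DGCoalg k} {g : DGLie k} (α : mcLie k ⟶ conv C g) :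
    ∃ ψ : cobarObj C ⟶ g, cobarUnit C ≫ convHom (𝟙 C) ψ = α := by
  have hα := mcElt_isMC.map α
  set f := convVal C g (α.map (mcElt k)) with hf
  obtain ⟨h₁, h₂⟩ := isMC_conv.1 hα
  rw [← hf] at h₁ h₂
  have hφ : GrMod.IsHom (C.shift 1) g.toGrMod 0 f := fun n x hx => by
    have := h₁ (n + 1) x hx
    rwa [show n + 1 + -1 = n + 0 by ring] at this
  have e (c : C.carrier) : FreeLie.lift (M := g.toGrLie) (V := C.shift 1) f hφ (cobarInc C c) =
      f c := FreeLie.lift_inc (V := C.shift 1) hφ c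
  -- The extension carries the convolution square of the inclusion of generators to the convolution
  -- square of `f`.
  have key := convBracket_natural (C := C.toGrCoalg) (D := C.toGrCoalg)
    (g := freeLie (C.shift 1)) (h := g.toGrLie) (φ := LinearMap.id) (fun h => h)
    (fun x => by simp) (ψ := FreeLie.lift (M := g.toGrLie) (V := C.shift 1) f hφ)
    (FreeLie.lift_mem hφ) (FreeLie.lift_bracket hφ) (cobarInc C) (cobarInc_mem C)
  have e' : FreeLie.lift (M := g.toGrLie) (V := C.shift 1) f hφ ∘ₗ cobarInc C ∘ₗ LinearMap.id = f :=
    LinearMap.ext e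
  rw [e'] at key
  refine ⟨freeDGLieLift (V := C.shift 1) f hφ fun c => ?_, ?_⟩
  · refine Eq.trans ?_ (h₂ c).symm
    have := LinearMap.congr_fun key c
    change FreeLie.lift (M := g.toGrLie) (V := C.shift 1) f hφ (-(cobarInc C (C.d c)) -
      (1 / 2 : k) • convBracket C.toGrCoalg (freeLie (C.shift 1)) (cobarInc C) (cobarInc C) c) = _
    rw [map_sub, map_neg, map_smul, e]
    exact congrArg (fun t => -f (C.d c) - (1 / 2 : k) • t) this
  · refine mc_hom_ext (convVal_injective (LinearMap.ext fun c => ?_))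
    change FreeLie.lift (M := g.toGrLie) (V := C.shift 1) f hφ
      (convVal C (cobarObj C) ((cobarUnit C).map (mcElt k)) c) = f c
    rw [cobarUnit_elt]
    exact e c

end cobar

/-! ### The universal property of the bar construction -/

section bar
variable {k : Type u} [Field k] [CharZero k]

/-! ### The constant and linear parts of the Chevalley-Eilenberg differential -/

namespace CE
variable {g : DGLie k}

/-- The counit. -/
noncomputable def eps (g : DGLie k) : CE g →ₗ[k] k := Sym.eps (g.shift (-1))

/-- The projection to the generators. -/
noncomputable def pr (g : DGLie k) : CE g →ₗ[k] g.carrier := Sym.pr (g.shift (-1))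

theorem eps_T (x : g.carrier) (s : CE g) : eps g (T g x s) = 0 := Sym.eps_L _ _

theorem pr_T (x : g.carrier) (s : CE g) : pr g (T g x s) = eps g s • x := Sym.pr_L _ _

theorem pr_one : pr g 1 = 0 := Sym.pr_one

theorem pr_mem {n : ℤ} {s : CE g} (hs : s ∈ gr g n) : pr g s ∈ g.gr (n - 1) := Sym.pr_mem hs

theorem eps_theta {a : ℤ} {x : g.carrier} (hx : x ∈ g.gr a) (s : CE g) :
    eps g (theta g x s) = 0 := by
  have : eps g ∘ₗ theta g x = 0 := ext (by simp [theta_one hx]) fun b y hy s _ => by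
    rw [LinearMap.comp_apply, theta_T hx hy, map_add, map_smul, map_smul, eps_T, eps_T, smul_zero,
      smul_zero, add_zero]
    rfl
  exact LinearMap.congr_fun this s

theorem pr_theta {a : ℤ} {x : g.carrier} (hx : x ∈ g.gr a) (s : CE g) :
    pr g (theta g x s) = (sg a : k) • g.bracket x (pr g s) := by
  have : pr g ∘ₗ theta g x = (sg a : k) • g.bracket x ∘ₗ pr g :=
    ext (by simp [theta_one hx, pr_one]) fun b y hy s _ => by
      simp only [LinearMap.comp_apply, LinearMap.smul_apply, theta_T hx hy, map_add, map_smul, pr_T,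
        eps_theta hx, zero_smul, smul_zero, zero_add]
  exact LinearMap.congr_fun this s

theorem eps_D (s : CE g) : eps g (D g s) = 0 := by
  have : eps g ∘ₗ D g = 0 := ext (by simp [D_one]) fun a x hx s _ => by
    rw [LinearMap.comp_apply, D_T hx, map_add, map_sub, map_neg, map_smul, eps_T, eps_T,
      eps_theta hx]
    simp
  exact LinearMap.congr_fun this s

/-- The linear part of `D` sees only the internal differential on one factor and the bracket on two,
and it never produces constants. -/
theorem pr_D_T {a : ℤ} {x : g.carrier} (hx : x ∈ g.gr a) (s : CE g) :
    pr g (D g (T g x s)) = -(eps g s • g.d x) + (sg a : k) • g.bracket x (pr g s) := by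
  rw [D_T hx, map_add, map_sub, map_neg, map_smul, pr_T, pr_T, eps_D, pr_theta hx, zero_smul,
    smul_zero, sub_zero]

end CE

/-- The projection of the bar construction of `g` to `g`. -/
noncomputable def barPr (g : DGLie k) : (barObj g).carrier →ₗ[k] g.carrier :=
  Red.pr (g.shift (-1))

theorem barPr_isHom (g : DGLie k) : GrMod.IsHom (barObj g).toGrMod g.toGrMod (-1) (barPr g) :=
  fun _ _ hx => Red.pr_mem hx

/-- The convolution square of the projection, before the comultiplication. -/
noncomputable def barPrAux (g : DGLie k) : (CE g ⊗[k] CE g) →ₗ[k] g.carrier :=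
  convAux (barObj g).toGrCoalg g.toGrLie (barPr g) (barPr g) ∘ₗ
    TensorProduct.map (Red.q (g.shift (-1))) (Red.q (g.shift (-1)))

/-- The sign is the Koszul sign for moving the second projection, of degree `-1`, past `s`. -/
theorem barPrAux_tmul {g : DGLie k} {i : ℤ} {s : CE g} (hs : s ∈ CE.gr g i) (t : CE g) :
    barPrAux g (s ⊗ₜ t) = (sg i : k) • g.bracket (CE.pr g s) (CE.pr g t) := by
  rw [sg_congr (k := k) (m := i) (n := -1 * i) (by grind)]
  exact convAux_apply (C := (barObj g).toGrCoalg) (barPr g) (barPr_isHom g) (Red.q_mem hs) _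

/-- Linear parts survive only where `x` is alone in one tensor factor, which is what the two counits
express. Graded antisymmetry moves `x` to the front of the bracket in the second case, and both
cases come out with the same sign; this equality is what the coefficient `½` compensates. -/
theorem barPrAux_rho {g : DGLie k} {a : ℤ} {x : g.carrier} (hx : x ∈ g.gr a)
    (z : CE g ⊗[k] CE g) : barPrAux g (Sym.rho (g.shift (-1)) x z) =
      -((sg a : k) • g.bracket x (CE.pr g (Sym.epsLeft (g.shift (-1)) z))) -
        (sg a : k) • g.bracket x (CE.pr g (Sym.epsRight (g.shift (-1)) z)) := by
  have : barPrAux g ∘ₗ Sym.rho (g.shift (-1)) x =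
      -((sg a : k) • g.bracket x ∘ₗ CE.pr g ∘ₗ Sym.epsLeft (g.shift (-1))) -
        (sg a : k) • g.bracket x ∘ₗ CE.pr g ∘ₗ Sym.epsRight (g.shift (-1)) := by
    refine Sym.ext_tensor fun i j s hs t ht => ?_
    have e₁ : Sym.rho (g.shift (-1)) x (s ⊗ₜ t) =
      CE.T g x s ⊗ₜ t + (sg ((a + 1) * i) : k) • (s ⊗ₜ[k] CE.T g x t) :=
      Sym.rho_tmul (CE.mem_shift hx) hs t
    have e₂ : Sym.epsLeft (g.shift (-1)) (s ⊗ₜ t) = CE.eps g s • t := rfl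
    have e₃ : Sym.epsRight (g.shift (-1)) (s ⊗ₜ t) = CE.eps g t • s := rfl
    have e₄ : (sg i : k) * CE.eps g s = CE.eps g s := by
      have := Sym.sg_smul_eps (m := 1) hs
      rwa [one_mul] at this
    have e₅ := g.bracket_anti (CE.pr_mem hs) hx
    have e₆ : (sg ((a + 1) * i) : k) * (sg i * (CE.eps g t * sg ((i - 1) * a))) =
        sg a * CE.eps g t := by
      rw [← sg_congr (k := k) (m := (a + 1) * i + i + (i - 1) * a) (n := a) (by grind), sg_add,
        sg_add]
      ring
    simp only [LinearMap.comp_apply, LinearMap.sub_apply, LinearMap.neg_apply,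
      LinearMap.smul_apply, e₁, e₂, e₃, map_add, map_smul, barPrAux_tmul hs,
      barPrAux_tmul (CE.T_mem hx hs), CE.pr_T, e₅, smul_neg, smul_smul]
    rw [show a + 1 + i = (a + 1) + i by ring, sg_add (a + 1), ← neg_sg, mul_assoc, e₄, e₆]
    module
  exact LinearMap.congr_fun this z

/-- The projection is a twisting cochain: on `Σ⁻¹x s` the bracket part of the differential and half
of the convolution square cancel, leaving `ε(s) d x`, the differential of the linear part of `Σ⁻¹x
s`. -/
theorem barPr_d {g : DGLie k} (x : (barObj g).carrier) :
    g.d (barPr g x) = -(barPr g ((barObj g).d x)) -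
      (1 / 2 : k) • convBracket (barObj g).toGrCoalg g.toGrLie (barPr g) (barPr g) x := by
  obtain ⟨s, rfl⟩ := Red.q_surjective x
  have : g.d ∘ₗ CE.pr g = -(CE.pr g ∘ₗ CE.D g) -
      (1 / 2 : k) • barPrAux g ∘ₗ Sym.comul (g.shift (-1)) := by
    refine CE.ext ?_ fun a x hx s _ => ?_
    · have : Sym.comul (g.shift (-1)) 1 = 1 ⊗ₜ 1 := Sym.comul_one
      simp [CE.pr_one, CE.D_one, this, barPrAux_tmul (g := g) Sym.one_mem]
    · have e₁ : Sym.comul (g.shift (-1)) (CE.T g x s) =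
        Sym.rho (g.shift (-1)) x (Sym.comul (g.shift (-1)) s) := Sym.comul_L _ _
      simp only [LinearMap.comp_apply, LinearMap.sub_apply, LinearMap.neg_apply,
        LinearMap.smul_apply, CE.pr_D_T hx, CE.pr_T, e₁, barPrAux_rho hx, Sym.epsLeft_comul,
        Sym.epsRight_comul, map_smul]
      module
  exact LinearMap.congr_fun this s

/-- The universal twisting cochain of the bar construction, as a morphism. -/
noncomputable def barUnit (g : DGLie k) : mcLie k ⟶ conv (barObj g) g :=
  mcLift (x := convMk (barPr g) (barPr_isHom g).mem_homTotal)
    (isMC_conv.2 ⟨barPr_isHom g, barPr_d⟩)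

theorem barUnit_elt (g : DGLie k) :
    convVal (barObj g) g ((barUnit g).map (mcElt k)) = barPr g :=
  congrArg (convVal (barObj g) g) (mcLift_elt _)

theorem barPr_barMap {g h : DGLie k} (χ : g ⟶ h) (x : (barObj g).carrier) :
    barPr h ((barMap χ).map x) = χ.map (barPr g x) := by
  obtain ⟨s, rfl⟩ := Red.q_surjective x
  have h₁ : CE.eps h ∘ₗ CE.map χ = CE.eps g := CE.ext
    (by rw [LinearMap.comp_apply, CE.map_one]; exact Sym.eps_one.trans Sym.eps_one.symm)
    fun a x _ s _ => by rw [LinearMap.comp_apply, CE.map_T, CE.eps_T, CE.eps_T]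
  have h₂ : CE.pr h ∘ₗ CE.map χ = χ.map ∘ₗ CE.pr g := CE.ext
    (by rw [LinearMap.comp_apply, LinearMap.comp_apply, CE.map_one, CE.pr_one, CE.pr_one, map_zero])
    fun a x _ s _ => by
      rw [LinearMap.comp_apply, LinearMap.comp_apply, CE.map_T, CE.pr_T, CE.pr_T, map_smul, ← h₁]
      rfl
  exact LinearMap.congr_fun h₂ s

/-- Both morphisms correspond to the cochain `χ` after the projection. -/
theorem barUnit_natural {g h : DGLie k} (χ : g ⟶ h) :
    barUnit g ≫ convHom (𝟙 _) χ = barUnit h ≫ convHom (barMap χ) (𝟙 h) := by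
  refine mc_hom_ext (convVal_injective (LinearMap.ext fun c => ?_))
  change χ.map (convVal (barObj g) g ((barUnit g).map (mcElt k)) c) =
    convVal (barObj h) h ((barUnit h).map (mcElt k)) ((barMap χ).map c)
  rw [barUnit_elt, barUnit_elt]
  exact (barPr_barMap χ c).symm

theorem bar_hom_ext' {C : DGCoalg k} {g : DGLie k} {Φ Ψ : C ⟶ barObj g}
    (h : ∀ c, barPr g (Φ.map c) = barPr g (Ψ.map c)) : Φ = Ψ :=
  DGCoalg.Hom.ext (Red.map_ext (C := C.toGrCoalg) Φ.map_comul Ψ.map_comul h)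

theorem bar_hom_ext {C : DGCoalg k} {g : DGLie k} {Φ Ψ : C ⟶ barObj g}
    (h : barUnit g ≫ convHom Φ (𝟙 g) = barUnit g ≫ convHom Ψ (𝟙 g)) : Φ = Ψ := by
  refine bar_hom_ext' fun c => ?_
  have := congrArg (fun α : mcLie k ⟶ conv C g => convVal C g (α.map (mcElt k)) c) h
  change convVal (barObj g) g ((barUnit g).map (mcElt k)) (Φ.map c) =
    convVal (barObj g) g ((barUnit g).map (mcElt k)) (Ψ.map c) at this
  rwa [barUnit_elt] at this

/-- A twisting cochain induces a morphism to the bar construction. -/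
theorem bar_exists_hom {C : DGCoalg k} {g : DGLie k} {f : C.carrier →ₗ[k] g.carrier}
    (h₁ : GrMod.IsHom C.toGrMod g.toGrMod (-1) f)
    (h₂ : ∀ c, g.d (f c) = -(f (C.d c)) -
      (1 / 2 : k) • convBracket C.toGrCoalg g.toGrLie f f c) :
    ∃ Φ : C ⟶ barObj g, ∀ c, barPr g (Φ.map c) = f c := by
  have hφ : GrMod.IsHom C.toGrMod (g.shift (-1)) 0 f := fun n x hx => by
    have := h₁ n x hx
    change f x ∈ g.gr (n + 0 + -1)
    rwa [add_zero]
  -- Cofreeness yields a graded coalgebra map with linear part `f`; what remains is compatibility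
  -- with the differentials.
  obtain ⟨Φ, hm, hc, hp⟩ := Red.exists_map (C := C.toGrCoalg) hφ
  let Φ' : C.carrier →ₗ[k] (barObj g).carrier := Φ
  have hm' (n : ℤ) (c : C.carrier) (hc : c ∈ C.gr n) : Φ' c ∈ (barObj g).gr n := hm n c hc
  have hc' (c : C.carrier) : (barObj g).comul (Φ' c) = TensorProduct.map Φ' Φ' (C.comul c) := hc c
  have hp' : barPr g ∘ₗ Φ' = f := LinearMap.ext hp
  have hσ : (barObj g).sigma ∘ₗ Φ' = Φ' ∘ₗ C.sigma := C.ext_gr fun n c hc => by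
    rw [LinearMap.comp_apply, LinearMap.comp_apply, C.sigma_apply hc,
      (barObj g).sigma_apply (hm' n c hc), map_smul]
  -- The commutator of `Φ'` with the differentials is a coderivation along `Φ'`, the Koszul sign
  -- being absorbed in `Φ' ∘ σ`. It vanishes once its linear part does, and that follows by
  -- comparing the Maurer-Cartan equations of the projection and of `f`.
  have key : (barObj g).d ∘ₗ Φ' - Φ' ∘ₗ C.d = 0 := by
    refine Red.eq_zero_of_coder (C := C.toGrCoalg) (A := Φ') (B := Φ' ∘ₗ C.sigma)
      (LinearMap.ext fun c => ?_) (LinearMap.ext fun c => ?_)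
    · have e₁ := barPr_d (Φ' c)
      have e₂ := convBracket_natural (C := (barObj g).toGrCoalg) (D := C.toGrCoalg)
        (g := g.toGrLie) (h := g.toGrLie) (φ := Φ') (fun {n x} h => hm' n x h) hc'
        (ψ := LinearMap.id) (fun h => h) (fun _ _ => rfl) (barPr g) (barPr_isHom g)
      rw [hp', LinearMap.id_comp] at e₂
      have e₃ : convBracket (barObj g).toGrCoalg g.toGrLie (barPr g) (barPr g) (Φ' c) = 
        convBracket C.toGrCoalg g.toGrLie f f c := LinearMap.congr_fun e₂ c
      have e₄ (c : C.carrier) : barPr g (Φ' c) = f c := hp c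
      rw [e₃, e₄, h₂, sub_left_inj, neg_inj] at e₁
      change barPr g ((barObj g).d (Φ' c) - Φ' (C.d c)) = 0
      rw [map_sub, ← e₁, e₄, sub_self]
    · have e₁ : (barObj g).comul ((barObj g).d (Φ' c)) =
        TensorProduct.map (barObj g).d LinearMap.id ((barObj g).comul (Φ' c)) +
          TensorProduct.map (barObj g).sigma (barObj g).d ((barObj g).comul (Φ' c)) :=
        LinearMap.congr_fun (barObj g).coder (Φ' c)
      have e₂ : C.comul (C.d c) = TensorProduct.map C.d LinearMap.id (C.comul c) +
          TensorProduct.map C.sigma C.d (C.comul c) := LinearMap.congr_fun C.coder c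
      have e₃ : (TensorProduct.map (barObj g).d LinearMap.id +
          TensorProduct.map (barObj g).sigma (barObj g).d) ∘ₗ TensorProduct.map Φ' Φ' -
          TensorProduct.map Φ' Φ' ∘ₗ (TensorProduct.map C.d LinearMap.id +
          TensorProduct.map C.sigma C.d) =
          TensorProduct.map ((barObj g).d ∘ₗ Φ' - Φ' ∘ₗ C.d) Φ' +
          TensorProduct.map (Φ' ∘ₗ C.sigma) ((barObj g).d ∘ₗ Φ' - Φ' ∘ₗ C.d) := by
        refine TensorProduct.ext' fun x y => ?_
        have := LinearMap.congr_fun hσ x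
        simp only [LinearMap.comp_apply] at this
        simp only [LinearMap.sub_apply, LinearMap.add_apply, LinearMap.comp_apply,
          TensorProduct.map_tmul, LinearMap.id_apply, map_add, TensorProduct.sub_tmul,
          TensorProduct.tmul_sub, this]
        abel
      change (barObj g).comul ((barObj g).d (Φ' c) - Φ' (C.d c)) = _
      rw [map_sub, e₁, hc', hc', e₂]
      exact LinearMap.congr_fun e₃ (C.comul c)
  refine ⟨{ map := Φ', map_mem := fun {n c} h => hm' n c h, map_comul := hc', map_d := fun c => ?_ },
    hp⟩
  exact (sub_eq_zero.1 (LinearMap.congr_fun key c)).symm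

theorem bar_exists_lift {C : DGCoalg k} {g : DGLie k} (α : mcLie k ⟶ conv C g) :
    ∃ Φ : C ⟶ barObj g, barUnit g ≫ convHom Φ (𝟙 g) = α := by
  obtain ⟨h₁, h₂⟩ := isMC_conv.1 (mcElt_isMC.map α)
  obtain ⟨Φ, hΦ⟩ := bar_exists_hom h₁ h₂
  refine ⟨Φ, mc_hom_ext (convVal_injective (LinearMap.ext fun c => ?_))⟩
  change convVal (barObj g) g ((barUnit g).map (mcElt k)) (Φ.map c) = _
  rw [barUnit_elt, hΦ]

end bar

/-! ### Quotients of dg Lie algebras -/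

section quotient
variable {k : Type u} [Field k] [CharZero k]

/-- A homogeneous ideal of a dg Lie algebra that is stable under the differential. -/
structure IsDGIdeal (L : DGLie k) (I : Submodule k L.carrier) : Prop where
  -- Homogeneity is expressed as stability under the degree operator, which then descends to the
  -- quotient and splits it into its graded parts.
  euler_mem : ∀ a ∈ I, L.scale (fun n => (n : k)) a ∈ I
  left_mem : ∀ x, ∀ a ∈ I, L.bracket x a ∈ I
  right_mem : ∀ x, ∀ a ∈ I, L.bracket a x ∈ I
  d_mem : ∀ a ∈ I, L.d a ∈ I

variable {L M : DGLie k} {I : Submodule k L.carrier}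

/-- The bracket on the quotient. -/
noncomputable def IsDGIdeal.bracket (hI : IsDGIdeal L I) :
    (L.carrier ⧸ I) →ₗ[k] (L.carrier ⧸ I) →ₗ[k] (L.carrier ⧸ I) :=
  I.liftQ ((I.liftQ (L.bracket.compr₂ I.mkQ).flip (fun a ha =>
    LinearMap.mem_ker.2 (LinearMap.ext fun x =>
      (Submodule.Quotient.mk_eq_zero _).2 (hI.left_mem x a ha)))).flip) (fun a ha =>
    LinearMap.mem_ker.2 (Submodule.linearMap_qext _ (LinearMap.ext fun x =>
      (Submodule.Quotient.mk_eq_zero _).2 (hI.right_mem x a ha))))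

theorem IsDGIdeal.bracket_mkQ (hI : IsDGIdeal L I) (x y : L.carrier) :
    hI.bracket (I.mkQ x) (I.mkQ y) = I.mkQ (L.bracket x y) := rfl

/-- The quotient of a dg Lie algebra by an ideal. -/
noncomputable def IsDGIdeal.quotient (hI : IsDGIdeal L I) : DGLie k where
  carrier := L.carrier ⧸ I
  gr n := (L.gr n).map I.mkQ
  isInternal := by
    refine GrMod.isInternal_of_euler (I.mapQ I (L.scale fun n => (n : k)) hI.euler_mem) ?_ ?_
    · rintro n _ ⟨s, hs, rfl⟩
      exact (congrArg I.mkQ (L.scale_apply _ hs)).trans (map_smul _ _ _)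
    · rw [← Submodule.map_iSup, L.iSup_gr, Submodule.map_top, LinearMap.range_eq_top]
      exact I.mkQ_surjective
  bracket := hI.bracket
  bracket_mem := by
    rintro m n _ _ ⟨x, hx, rfl⟩ ⟨y, hy, rfl⟩
    exact ⟨_, L.bracket_mem hx hy, rfl⟩
  bracket_anti := by
    rintro m n _ _ ⟨x, hx, rfl⟩ ⟨y, hy, rfl⟩
    rw [hI.bracket_mkQ, hI.bracket_mkQ, L.bracket_anti hx hy, map_neg, map_smul]
  jacobi := by
    rintro m n p _ _ _ ⟨x, hx, rfl⟩ ⟨y, hy, rfl⟩ ⟨z, hz, rfl⟩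
    simp only [hI.bracket_mkQ]
    rw [L.jacobi hx hy hz, map_add, map_smul]
  d := I.mapQ I L.d hI.d_mem
  d_mem := by
    rintro n _ ⟨x, hx, rfl⟩
    exact ⟨_, L.d_mem hx, rfl⟩
  d_d x := by
    obtain ⟨x, rfl⟩ := I.mkQ_surjective x
    exact congrArg I.mkQ (L.d_d x) |>.trans (map_zero _)
  leibniz := by
    rintro m _ ⟨x, hx, rfl⟩ y
    obtain ⟨y, rfl⟩ := I.mkQ_surjective y
    have := congrArg I.mkQ (L.leibniz hx y)
    rw [map_add, map_smul] at this
    exact this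

/-- The projection to the quotient. -/
noncomputable def IsDGIdeal.proj (hI : IsDGIdeal L I) : L ⟶ hI.quotient where
  map := I.mkQ
  map_mem hx := ⟨_, hx, rfl⟩
  map_bracket _ _ := rfl
  map_d _ := rfl

theorem IsDGIdeal.proj_surjective (hI : IsDGIdeal L I) : Function.Surjective hI.proj.map :=
  I.mkQ_surjective

theorem IsDGIdeal.proj_eq_zero (hI : IsDGIdeal L I) {a : L.carrier} (ha : a ∈ I) :
    hI.proj.map a = 0 := (Submodule.Quotient.mk_eq_zero _).2 ha

/-- The morphism from the quotient induced by a morphism that vanishes on the ideal. -/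
noncomputable def IsDGIdeal.desc (hI : IsDGIdeal L I) (χ : L ⟶ M) (h : ∀ a ∈ I, χ.map a = 0) :
    hI.quotient ⟶ M where
  map := I.liftQ χ.map h
  map_mem := by
    rintro n _ ⟨x, hx, rfl⟩
    exact χ.map_mem hx
  map_bracket x y := by
    obtain ⟨x, rfl⟩ := I.mkQ_surjective x
    obtain ⟨y, rfl⟩ := I.mkQ_surjective y
    exact χ.map_bracket x y
  map_d x := by
    obtain ⟨x, rfl⟩ := I.mkQ_surjective x
    exact χ.map_d x

theorem DGLie.Hom.map_euler (χ : L ⟶ M) (a : L.carrier) :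
    χ.map (L.scale (fun n => (n : k)) a) = M.scale (fun n => (n : k)) (χ.map a) := by
  have : χ.map ∘ₗ L.scale (fun n => (n : k)) = M.scale (fun n => (n : k)) ∘ₗ χ.map :=
    L.ext_gr fun n x hx => by
      rw [LinearMap.comp_apply, LinearMap.comp_apply, L.scale_apply _ hx,
        M.scale_apply _ (χ.map_mem hx), map_smul]
  exact LinearMap.congr_fun this a

end quotient

/-! ### The tensoring -/

section tensoring
variable {k : Type u} [Field k] [CharZero k] (C : DGCoalg k) (g : DGLie k) {h : DGLie k}

/-- The tensor product of the underlying graded vector spaces. -/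
noncomputable def genMod : GrMod k := GrMod.tensor g.toGrMod C.toGrMod

/-- The differential of the tensor product. -/
noncomputable def genD : (genMod C g).carrier →ₗ[k] (genMod C g).carrier :=
  show (g.carrier ⊗[k] C.carrier) →ₗ[k] (g.carrier ⊗[k] C.carrier) from
    TensorProduct.map g.d LinearMap.id + TensorProduct.map g.sigma C.d

/-- A pure tensor. -/
noncomputable def genMk : g.carrier →ₗ[k] C.carrier →ₗ[k] (genMod C g).carrier :=
  TensorProduct.mk k g.carrier C.carrier

variable {C g}

theorem genMk_mem {m n : ℤ} {x : g.carrier} {c : C.carrier} (hx : x ∈ g.gr m) (hc : c ∈ C.gr n) :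
    genMk C g x c ∈ (genMod C g).gr (m + n) := GrMod.tmul_mem g.toGrMod C.toGrMod hx hc rfl

theorem genMod_gr_le {n : ℤ} {P : Submodule k (genMod C g).carrier}
    (h : ∀ i j, ∀ x ∈ g.gr i, ∀ c ∈ C.gr j, i + j = n → genMk C g x c ∈ P) :
    (genMod C g).gr n ≤ P :=
  Submodule.span_le.2 (by
    rintro _ ⟨i, j, x, y, hx, hy, hij, rfl⟩
    exact h i j x hx y hy hij)

theorem genMod_ext {M : Type*} [AddCommGroup M] [Module k M] {f f' : (genMod C g).carrier →ₗ[k] M}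
    (h : ∀ m n, ∀ x ∈ g.gr m, ∀ c ∈ C.gr n, f (genMk C g x c) = f' (genMk C g x c)) : f = f' :=
  GrMod.ext_gr₂ g.toGrMod C.toGrMod h

theorem genD_mk {m : ℤ} {x : g.carrier} (hx : x ∈ g.gr m) (c : C.carrier) :
    genD C g (genMk C g x c) = genMk C g (g.d x) c + (sg m : k) • genMk C g x (C.d c) := by
  have : genD C g (genMk C g x c) = genMk C g (g.d x) c + genMk C g (g.sigma x) (C.d c) := rfl
  rw [this, g.sigma_apply hx, map_smul, LinearMap.smul_apply]

theorem genD_isHom : GrMod.IsHom (genMod C g) (genMod C g) (-1) (genD C g) := fun n v hv => by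
  have : (genMod C g).gr n ≤ ((genMod C g).gr (n + -1)).comap (genD C g) :=
    genMod_gr_le fun i j x hx c hc hij => by
      subst hij
      rw [Submodule.mem_comap, genD_mk hx]
      have h₁ := genMk_mem (g.d_mem hx) hc
      have h₂ := genMk_mem hx (C.d_mem hc)
      rw [show i - 1 + j = i + j + -1 by ring] at h₁
      rw [show i + (j - 1) = i + j + -1 by ring] at h₂
      exact Submodule.add_mem _ h₁ (Submodule.smul_mem _ _ h₂)
  exact this hv

theorem genD_genD (v : (genMod C g).carrier) : genD C g (genD C g v) = 0 := by
  have : genD C g ∘ₗ genD C g = 0 := genMod_ext fun m n x hx c hc => by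
    rw [LinearMap.comp_apply, genD_mk hx, map_add, map_smul, genD_mk (g.d_mem hx), genD_mk hx,
      g.d_d, C.d_d, sub_eq_add_neg, sg_add, sg_neg_one]
    simp
  exact LinearMap.congr_fun this v

variable (C g)

/-- The differential of the free dg Lie algebra on the tensor product, on generators. -/
noncomputable def preDelta : (genMod C g).carrier →ₗ[k] (freeLie (genMod C g)).carrier :=
  FreeLie.inc (genMod C g) ∘ₗ genD C g

theorem preDelta_isHom :
    GrMod.IsHom (genMod C g) (freeLie (genMod C g)).toGrMod (-1) (preDelta C g) := fun n v hv => by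
  have := FreeLie.inc_isHom (V := genMod C g) _ _ (genD_isHom n v hv)
  rwa [add_zero] at this

theorem preDelta_square (v : (genMod C g).carrier) :
    FreeLie.der (preDelta C g) (preDelta_isHom C g) (preDelta C g v) = 0 := by
  refine (FreeLie.der_inc _ _).trans ?_
  rw [preDelta, LinearMap.comp_apply, genD_genD, map_zero]

/-- The free dg Lie algebra on the tensor product. -/
noncomputable def preTensor : DGLie k :=
  freeDGLie (preDelta C g) (preDelta_isHom C g) (preDelta_square C g)

/-- The generators of `preTensor C g`. -/
noncomputable def preInc : (genMod C g).carrier →ₗ[k] (preTensor C g).carrier :=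
  FreeLie.inc (genMod C g)

variable {C g}

theorem preInc_mem {n : ℤ} {v : (genMod C g).carrier} (hv : v ∈ (genMod C g).gr n) :
    preInc C g v ∈ (preTensor C g).gr n := by
  have := FreeLie.inc_isHom (V := genMod C g) _ _ hv
  rwa [add_zero] at this

theorem preTensor_d_inc (v : (genMod C g).carrier) :
    (preTensor C g).d (preInc C g v) = preInc C g (genD C g v) :=
  FreeLie.der_inc (preDelta_isHom C g) v

/-- The evaluation `x ⊗ c ↦ α(x)(c)`. -/
noncomputable def evalGen (α : g ⟶ conv C h) : (genMod C g).carrier →ₗ[k] h.carrier :=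
  TensorProduct.lift (convVal C h ∘ₗ α.map)

theorem evalGen_mk (α : g ⟶ conv C h) (x : g.carrier) (c : C.carrier) :
    evalGen α (genMk C g x c) = convVal C h (α.map x) c := rfl

theorem evalGen_isHom (α : g ⟶ conv C h) : GrMod.IsHom (genMod C g) h.toGrMod 0 (evalGen α) :=
  fun n v hv => by
    rw [add_zero]
    have : (genMod C g).gr n ≤ (h.gr n).comap (evalGen α) :=
      genMod_gr_le fun i j x hx c hc hij => by
        subst hij
        rw [Submodule.mem_comap, evalGen_mk, add_comm]
        exact mem_conv_gr.1 (α.map_mem hx) j c hc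
    exact this hv

theorem evalGen_d (α : g ⟶ conv C h) (v : (genMod C g).carrier) :
    evalGen α (genD C g v) = h.d (evalGen α v) := by
  have : evalGen α ∘ₗ genD C g = h.d ∘ₗ evalGen α := genMod_ext fun m n x hx c hc => by
    rw [LinearMap.comp_apply, LinearMap.comp_apply, genD_mk hx, map_add, map_smul, evalGen_mk,
      evalGen_mk, evalGen_mk, α.map_d, convVal_d, convD_eq (mem_conv_gr.1 (α.map_mem hx))]
    simp
  exact LinearMap.congr_fun this v

/-- The morphism from `preTensor C g` that corresponds to a morphism to the convolution algebra. -/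
noncomputable def preLift (α : g ⟶ conv C h) : preTensor C g ⟶ h :=
  freeDGLieLift (evalGen α) (evalGen_isHom α) fun v =>
    (FreeLie.lift_inc (evalGen_isHom α) _).trans (evalGen_d α v)

theorem preLift_inc (α : g ⟶ conv C h) (v : (genMod C g).carrier) :
    (preLift α).map (preInc C g v) = evalGen α v := FreeLie.lift_inc (evalGen_isHom α) v

variable (C g)

/-- The relations of `C ▷ g`: the elements of `preTensor C g` that vanish under all morphisms that
come from morphisms to convolution algebras. -/
noncomputable def tensorIdeal : Submodule k (preTensor C g).carrier :=
  ⨅ (h : DGLie k) (α : g ⟶ conv C h), LinearMap.ker (preLift α).map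

variable {C g}

theorem mem_tensorIdeal {a : (preTensor C g).carrier} :
    a ∈ tensorIdeal C g ↔ ∀ (h : DGLie k) (α : g ⟶ conv C h), (preLift α).map a = 0 := by
  simp [tensorIdeal]

variable (C g)

/-- Each kernel of a morphism is a homogeneous ideal stable under the differential, and so is their
intersection. -/
theorem tensorIdeal_isDGIdeal : IsDGIdeal (preTensor C g) (tensorIdeal C g) where
  euler_mem a ha := mem_tensorIdeal.2 fun h α => by
    rw [DGLie.Hom.map_euler, mem_tensorIdeal.1 ha, map_zero]
  left_mem x a ha := mem_tensorIdeal.2 fun h α => by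
    rw [(preLift α).map_bracket, mem_tensorIdeal.1 ha, map_zero]
  right_mem x a ha := mem_tensorIdeal.2 fun h α => by
    rw [(preLift α).map_bracket, mem_tensorIdeal.1 ha, map_zero, LinearMap.zero_apply]
  d_mem a ha := mem_tensorIdeal.2 fun h α => by
    rw [(preLift α).map_d, mem_tensorIdeal.1 ha, map_zero]

/-- The dg Lie algebra `C ▷ g`. -/
noncomputable def tensorObj : DGLie k := (tensorIdeal_isDGIdeal C g).quotient

/-- The projection to `C ▷ g`. -/
noncomputable def tensorProj : preTensor C g ⟶ tensorObj C g := (tensorIdeal_isDGIdeal C g).proj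

/-- The map `x ↦ (c ↦ x ⊗ c)` to the linear maps from `C` to `preTensor C g`. -/
noncomputable def preUnit : g.carrier →ₗ[k] C.carrier →ₗ[k] (preTensor C g).carrier :=
  (genMk C g).compr₂ (preInc C g)

variable {C g}

theorem preUnit_isHom {n : ℤ} {x : g.carrier} (hx : x ∈ g.gr n) :
    GrMod.IsHom C.toGrMod (preTensor C g).toGrMod n (preUnit C g x) := fun i c hc => by
  rw [add_comm]
  exact preInc_mem (genMk_mem hx hc)

theorem preLift_preUnit (α : g ⟶ conv C h) (x : g.carrier) :
    (preLift α).map ∘ₗ preUnit C g x = convVal C h (α.map x) :=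
  LinearMap.ext fun c => preLift_inc α (genMk C g x c)

variable (C g)

/-- The map `x ↦ (c ↦ x ⊗ c)` to the linear maps from `C` to `C ▷ g`. -/
noncomputable def tensorUnitAux : g.carrier →ₗ[k] C.carrier →ₗ[k] (tensorObj C g).carrier :=
  (preUnit C g).compr₂ (tensorProj C g).map

variable {C g}

theorem tensorUnitAux_isHom {n : ℤ} {x : g.carrier} (hx : x ∈ g.gr n) :
    GrMod.IsHom C.toGrMod (tensorObj C g).toGrMod n (tensorUnitAux C g x) :=
  fun i c hc => (tensorProj C g).map_mem (preUnit_isHom hx i c hc)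

theorem tensorUnitAux_mem (x : g.carrier) :
    tensorUnitAux C g x ∈ GrMod.homTotal C.toGrMod (tensorObj C g).toGrMod := by
  have : ⨆ n, g.gr n ≤
      (GrMod.homTotal C.toGrMod (tensorObj C g).toGrMod).comap (tensorUnitAux C g) :=
    iSup_le fun n x hx => (tensorUnitAux_isHom hx).mem_homTotal
  rw [g.iSup_gr] at this
  exact this (Submodule.mem_top (x := x))

/-- The defect `[x, y] ⊗ c - ∑ ± [x ⊗ c', y ⊗ c'']` is killed by every `preLift α`, because `α`
respects brackets. It therefore lies in the ideal of relations and vanishes in the quotient. -/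
theorem tensorUnitAux_bracket (x y : g.carrier) : tensorUnitAux C g (g.bracket x y) =
    convBracket C.toGrCoalg (tensorObj C g).toGrLie (tensorUnitAux C g x)
      (tensorUnitAux C g y) := by
  have key : tensorUnitAux C g ∘ₗ g.bracket x =
      convBracket C.toGrCoalg (tensorObj C g).toGrLie (tensorUnitAux C g x) ∘ₗ
        tensorUnitAux C g := by
    refine g.ext_gr fun n y hy => LinearMap.ext fun c => ?_
    -- Convolution brackets are compatible with any morphism out of `preTensor C g`; this is used
    -- for each `preLift α` and for the projection.
    have nat {M : DGLie k} (ψ : preTensor C g ⟶ M) :=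
      convBracket_natural (C := C.toGrCoalg) (D := C.toGrCoalg)
        (g := (preTensor C g).toGrLie) (h := M.toGrLie) (φ := LinearMap.id) (fun h => h)
        (fun x => by simp) (ψ := ψ.map) ψ.map_mem ψ.map_bracket (preUnit C g x)
        (preUnit_isHom hy)
    have hI : preUnit C g (g.bracket x y) c - convBracket C.toGrCoalg (preTensor C g).toGrLie
        (preUnit C g x) (preUnit C g y) c ∈ tensorIdeal C g := mem_tensorIdeal.2 fun h α => by
      have e₁ := LinearMap.congr_fun (preLift_preUnit α (g.bracket x y)) c
      have e₂ := LinearMap.congr_fun (nat (preLift α)) c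
      rw [LinearMap.comp_apply] at e₁
      simp only [LinearMap.comp_id, preLift_preUnit, LinearMap.comp_apply] at e₂
      rw [map_sub, e₁, e₂, α.map_bracket, convVal_bracket, sub_self]
    have e := (tensorIdeal_isDGIdeal C g).proj_eq_zero hI
    rw [map_sub, sub_eq_zero] at e
    have e₂ := LinearMap.congr_fun (nat (tensorProj C g)) c
    simp only [LinearMap.comp_id, LinearMap.comp_apply] at e₂
    exact e.trans e₂
  exact LinearMap.congr_fun key y

/-- No relation is needed here: on generators the differential is that of the complex `g ⊗ C`, whose
Leibniz rule is the convolution differential rearranged. -/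
theorem tensorUnitAux_d (x : g.carrier) :
    tensorUnitAux C g (g.d x) = convD C (tensorObj C g) (tensorUnitAux C g x) := by
  have key : tensorUnitAux C g ∘ₗ g.d = convD C (tensorObj C g) ∘ₗ tensorUnitAux C g := by
    refine g.ext_gr fun n x hx => LinearMap.ext fun c => ?_
    rw [LinearMap.comp_apply, LinearMap.comp_apply, convD_eq (tensorUnitAux_isHom hx)]
    have e : (tensorObj C g).d (tensorUnitAux C g x c) =
        tensorUnitAux C g (g.d x) c + (sg n : k) • tensorUnitAux C g x (C.d c) := by
      refine ((tensorProj C g).map_d _).symm.trans ?_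
      refine (congrArg (tensorProj C g).map ((preTensor_d_inc _).trans
        (congrArg (preInc C g) (genD_mk hx c)))).trans ?_
      rw [map_add, map_add, map_smul, map_smul]
      rfl
    rw [LinearMap.sub_apply, LinearMap.comp_apply, e, LinearMap.smul_apply, LinearMap.comp_apply,
      add_sub_cancel_right]
  exact LinearMap.congr_fun key x

variable (C g)

/-- The unit of the tensoring. -/
noncomputable def tensorUnit : g ⟶ conv C (tensorObj C g) where
  map := (tensorUnitAux C g).codRestrict _ tensorUnitAux_mem
  map_mem hx := tensorUnitAux_isHom hx
  map_bracket x y := convVal_injective (tensorUnitAux_bracket x y)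
  map_d x := convVal_injective (tensorUnitAux_d x)

variable {C g}

/-- The morphism `preLift α` kills the relations by their very definition, hence descends to the
quotient. -/
theorem tensor_exists_desc (α : g ⟶ conv C h) :
    ∃ ψ : tensorObj C g ⟶ h, tensorUnit C g ≫ convHom (𝟙 C) ψ = α := by
  refine ⟨(tensorIdeal_isDGIdeal C g).desc (preLift α) fun a ha => mem_tensorIdeal.1 ha h α, ?_⟩
  refine DGLie.Hom.ext (LinearMap.ext fun x => convVal_injective (LinearMap.ext fun c => ?_))
  exact preLift_inc α (genMk C g x c)

/-- The images of the tensors `x ⊗ c` generate the quotient, and the composite with the unit records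
the values on them. -/
theorem tensor_hom_ext {ψ ψ' : tensorObj C g ⟶ h}
    (e : tensorUnit C g ≫ convHom (𝟙 C) ψ = tensorUnit C g ≫ convHom (𝟙 C) ψ') : ψ = ψ' := by
  have key : tensorProj C g ≫ ψ = tensorProj C g ≫ ψ' := by
    refine freeDGLie_hom_ext fun v => ?_
    have : (tensorProj C g ≫ ψ).map ∘ₗ preInc C g = (tensorProj C g ≫ ψ').map ∘ₗ preInc C g :=
      genMod_ext fun m n x _ c _ =>
        congrArg (fun α : g ⟶ conv C h => convVal C h (α.map x) c) e
    exact LinearMap.congr_fun this v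
  refine DGLie.Hom.ext (LinearMap.ext fun t => ?_)
  obtain ⟨a, rfl⟩ := (tensorIdeal_isDGIdeal C g).proj_surjective t
  exact congrArg (fun χ : preTensor C g ⟶ h => χ.map a) key

end tensoring

/-! ### Subcoalgebras -/

section subcoalgebra
variable {k : Type u} [Field k]

namespace GrMod
variable {V W : GrMod k}

theorem IsHom.scale_comm {f : V →ₗ[k] W} (hf : IsHom V W 0 f) (c : ℤ → k) (x : V) :
    f (V.scale c x) = W.scale c (f x) := by
  have : f ∘ₗ V.scale c = W.scale c ∘ₗ f := V.ext_gr fun n x hx => by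
    have h := hf n x hx
    rw [add_zero] at h
    rw [LinearMap.comp_apply, LinearMap.comp_apply, V.scale_apply _ hx, W.scale_apply _ h, map_smul]
  exact LinearMap.congr_fun this x

theorem scale_single_mem (V : GrMod k) (n : ℤ) (x : V) :
    V.scale (fun m => if m = n then 1 else 0) x ∈ V.gr n := by
  have : ⨆ m, V.gr m ≤ (V.gr n).comap (V.scale fun m => if m = n then 1 else 0) :=
    iSup_le fun m x hx => by
      rw [Submodule.mem_comap, V.scale_apply _ hx]
      split_ifs with h
      · subst h
        exact Submodule.smul_mem _ _ hx
      · rw [zero_smul]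
        exact Submodule.zero_mem _
  rw [V.iSup_gr] at this
  exact this (Submodule.mem_top (x := x))

/-- The projection to the degree `n` part commutes with `f`. It fixes `f x`, hence `x` by
injectivity. -/
theorem IsHom.mem_of_injective {f : V →ₗ[k] W} (hf : IsHom V W 0 f) (hi : Function.Injective f)
    {n : ℤ} {x : V} (hx : f x ∈ W.gr n) : x ∈ V.gr n := by
  have : V.scale (fun m => if m = n then 1 else 0) x = x := hi (by
    rw [hf.scale_comm, W.scale_apply _ hx, if_pos rfl, one_smul])
  rw [← this]
  exact V.scale_single_mem n x

theorem IsHom.tensor [CharZero k] {f : V →ₗ[k] W} (hf : IsHom V W 0 f) :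
    IsHom (GrMod.tensor V V) (GrMod.tensor W W) 0
      (show (V ⊗[k] V) →ₗ[k] (W ⊗[k] W) from TensorProduct.map f f) := by
  intro n z hz
  have : tensorGr V V n ≤ (tensorGr W W (n + 0)).comap (TensorProduct.map f f) := by
    refine Submodule.span_le.2 ?_
    rintro _ ⟨i, j, x, y, hx, hy, rfl, rfl⟩
    exact tmul_mem W W (hf i x hx) (hf j y hy) (by ring)
  exact this hz

theorem IsHom.braid {f : V →ₗ[k] W} (hf : IsHom V W 0 f) (z : V ⊗[k] V) :
    TensorProduct.map f f (GrMod.braid V V z) = GrMod.braid W W (TensorProduct.map f f z) := by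
  have : TensorProduct.map f f ∘ₗ GrMod.braid V V = GrMod.braid W W ∘ₗ TensorProduct.map f f :=
    ext_gr₂ V V fun m n x hx y hy => by
      have h₁ := hf m x hx
      have h₂ := hf n y hy
      rw [add_zero] at h₁ h₂
      rw [LinearMap.comp_apply, LinearMap.comp_apply, braid_apply _ _ hx hy, map_smul,
        TensorProduct.map_tmul, TensorProduct.map_tmul, braid_apply _ _ h₁ h₂]
  exact LinearMap.congr_fun this z

end GrMod

/-- The map of tensor powers induced by a linear map. -/
noncomputable def towerMap {V W : GrMod k} (f : V →ₗ[k] W) :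
    (n : ℕ) → tensorTower V n →ₗ[k] tensorTower W n
  | 0 => f
  | n + 1 => TensorProduct.map f (towerMap f n)

/-- Over a field all modules are flat, so tensor products of injective maps are injective. This lets
conilpotence pass to subcoalgebras. -/
theorem towerMap_injective {V W : GrMod k} {f : V →ₗ[k] W} (hf : Function.Injective f) (n : ℕ) :
    Function.Injective (towerMap f n) := by
  induction n with
  | zero => exact hf
  | succ n ih => exact TensorProduct.map_injective_of_flat_flat _ _ hf ih

theorem towerMap_iterComul {V W : GrMod k} {f : V →ₗ[k] W} {Δ : V →ₗ[k] V ⊗[k] V}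
    {Δ' : W →ₗ[k] W ⊗[k] W} (h : ∀ x, TensorProduct.map f f (Δ x) = Δ' (f x)) (n : ℕ) (x : V) :
    towerMap f n (iterComul V Δ n x) = iterComul W Δ' n (f x) := by
  induction n generalizing x with
  | zero => rfl
  | succ n ih =>
    have e : TensorProduct.map f (towerMap f n) ∘ₗ LinearMap.lTensor V (iterComul V Δ n) =
        LinearMap.lTensor W (iterComul W Δ' n) ∘ₗ TensorProduct.map f f :=
      TensorProduct.ext' fun x y => congrArg (f x ⊗ₜ[k] ·) (ih y)
    have e' := LinearMap.congr_fun e (Δ x)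
    rw [LinearMap.comp_apply, LinearMap.comp_apply, h] at e'
    exact e'

/-- A graded subspace of a dg coalgebra that is stable under the differential and the
comultiplication. -/
structure IsSubcoalg (P : DGCoalg k) (E : Submodule k P.carrier) : Prop where
  graded : E ≤ ⨆ n, E ⊓ P.gr n
  d_mem : ∀ x ∈ E, P.d x ∈ E
  -- Over a field `E ⊗ E` embeds in `P ⊗ P`, so a comultiplication on `E` can be read off from this
  -- range condition.
  comul_mem : ∀ x ∈ E, P.comul x ∈ LinearMap.range (TensorProduct.map E.subtype E.subtype)

/-- A sum of images of morphisms is a subcoalgebra. -/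
theorem isSubcoalg_iSup {P : DGCoalg k} {ι : Sort*} (C : ι → DGCoalg k) (Φ : ∀ i, C i ⟶ P) :
    IsSubcoalg P (⨆ i, LinearMap.range (Φ i).map) where
  graded := iSup_le fun i => by
    rw [LinearMap.range_eq_map, ← (C i).iSup_gr, Submodule.map_iSup]
    refine iSup_mono fun n => le_inf ?_ ?_
    · exact (LinearMap.map_le_range).trans (le_iSup (fun i => LinearMap.range (Φ i).map) i)
    · rintro _ ⟨c, hc, rfl⟩
      exact (Φ i).map_mem hc
  d_mem := by
    have : ⨆ i, LinearMap.range (Φ i).map ≤ (⨆ i, LinearMap.range (Φ i).map).comap P.d := by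
      refine iSup_le fun i => ?_
      rintro _ ⟨c, rfl⟩
      rw [Submodule.mem_comap, ← (Φ i).map_d]
      exact Submodule.mem_iSup_of_mem i ⟨_, rfl⟩
    exact this
  comul_mem := by
    set E := ⨆ i, LinearMap.range (Φ i).map with hE
    have : ⨆ i, LinearMap.range (Φ i).map ≤
        (LinearMap.range (TensorProduct.map E.subtype E.subtype)).comap P.comul := by
      refine iSup_le fun i => ?_
      rintro _ ⟨c, rfl⟩
      have hi (c : (C i).carrier) : (Φ i).map c ∈ E := Submodule.mem_iSup_of_mem i ⟨c, rfl⟩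
      rw [Submodule.mem_comap, (Φ i).map_comul]
      -- The comultiplication of the image of `c` already lies in the tensor square of the single
      -- image `i`, so no mixed terms arise.
      refine ⟨TensorProduct.map ((Φ i).map.codRestrict E hi) ((Φ i).map.codRestrict E hi)
        ((C i).comul c), ?_⟩
      have e : TensorProduct.map E.subtype E.subtype ∘ₗ
          TensorProduct.map ((Φ i).map.codRestrict E hi) ((Φ i).map.codRestrict E hi) =
        TensorProduct.map (Φ i).map (Φ i).map := TensorProduct.ext' fun x y => rfl
      exact LinearMap.congr_fun e _
    exact this

/-! ### The dg coalgebra structure on a subcoalgebra -/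

namespace IsSubcoalg
variable [CharZero k] {P : DGCoalg k} {E : Submodule k P.carrier} (hE : IsSubcoalg P E)

/-- The underlying graded vector space of a subcoalgebra. -/
def mod : GrMod k where
  carrier := E
  gr n := (P.gr n).comap E.subtype
  isInternal := by
    have hs : ∀ x ∈ E, P.scale (fun n => (n : k)) x ∈ E := by
      have : ⨆ n, E ⊓ P.gr n ≤ E.comap (P.scale fun n => (n : k)) := iSup_le fun n x hx => by
        rw [Submodule.mem_comap, P.scale_apply _ hx.2]
        exact Submodule.smul_mem _ _ hx.1
      exact fun x hx => this (hE.graded hx)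
    refine GrMod.isInternal_of_euler ((P.scale fun n => (n : k)).restrict hs) ?_ ?_
    · intro n x hx
      ext1
      exact P.scale_apply _ hx
    · rw [eq_top_iff]
      rintro ⟨x, hx⟩ -
      have : (⨆ n, E ⊓ P.gr n) ≤ (⨆ n, (P.gr n).comap E.subtype).map E.subtype :=
        iSup_le fun n x hx => ⟨⟨x, hx.1⟩, Submodule.mem_iSup_of_mem n hx.2, rfl⟩
      obtain ⟨y, hy, h⟩ := this (hE.graded hx)
      have : y = ⟨x, hx⟩ := Subtype.ext h
      exact this ▸ hy

/-- The inclusion of a subcoalgebra. -/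
def inc : hE.mod.carrier →ₗ[k] P.carrier := E.subtype

theorem inc_injective : Function.Injective hE.inc := Subtype.val_injective

theorem inc_isHom : GrMod.IsHom hE.mod P.toGrMod 0 hE.inc := fun n x hx => by
  rw [add_zero]
  exact hx

theorem inc_mem (x : hE.mod.carrier) : hE.inc x ∈ E := x.2

/-- The inclusion of the tensor square. -/
noncomputable def inc₂ : (hE.mod.carrier ⊗[k] hE.mod.carrier) →ₗ[k] (P.carrier ⊗[k] P.carrier) :=
  TensorProduct.map hE.inc hE.inc

theorem inc₂_injective : Function.Injective hE.inc₂ :=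
  TensorProduct.map_injective_of_flat_flat _ _ hE.inc_injective hE.inc_injective

/-- The comultiplication of a subcoalgebra. -/
noncomputable def comul : hE.mod.carrier →ₗ[k] (hE.mod.carrier ⊗[k] hE.mod.carrier) :=
  (LinearEquiv.ofInjective hE.inc₂ hE.inc₂_injective).symm.toLinearMap ∘ₗ
    (P.comul ∘ₗ hE.inc).codRestrict (LinearMap.range hE.inc₂)
      (fun x => hE.comul_mem _ (hE.inc_mem x))

theorem inc₂_comul (x : hE.mod.carrier) : hE.inc₂ (hE.comul x) = P.comul (hE.inc x) := by
  have := (LinearEquiv.ofInjective hE.inc₂ hE.inc₂_injective).apply_symm_apply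
    ((P.comul ∘ₗ hE.inc).codRestrict (LinearMap.range hE.inc₂)
      (fun x => hE.comul_mem _ (hE.inc_mem x)) x)
  exact congrArg Subtype.val this

/-- The differential of a subcoalgebra. -/
noncomputable def d : hE.mod.carrier →ₗ[k] hE.mod.carrier :=
  (P.d ∘ₗ hE.inc).codRestrict E (fun x => hE.d_mem _ (hE.inc_mem x))

theorem inc_d (x : hE.mod.carrier) : hE.inc (hE.d x) = P.d (hE.inc x) := rfl

theorem inc_sigma (x : hE.mod.carrier) : hE.inc (hE.mod.sigma x) = P.sigma (hE.inc x) :=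
  hE.inc_isHom.scale_comm _ x

/-- The identity is checked after the injective inclusion into the triple tensor product of `P`,
where it is the axiom for `P`. The other coalgebra axioms are inherited in the same way. -/
theorem coassoc : (TensorProduct.assoc k hE.mod.carrier hE.mod.carrier hE.mod.carrier).toLinearMap ∘ₗ
    hE.comul.rTensor hE.mod.carrier ∘ₗ hE.comul = hE.comul.lTensor hE.mod.carrier ∘ₗ hE.comul := by
  refine LinearMap.ext fun x => ?_
  have hi : Function.Injective (TensorProduct.map hE.inc hE.inc₂) :=
    TensorProduct.map_injective_of_flat_flat _ _ hE.inc_injective hE.inc₂_injective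
  refine hi ?_
  have h₁ : TensorProduct.map hE.inc hE.inc₂ ∘ₗ hE.comul.lTensor hE.mod.carrier =
      P.comul.lTensor P.carrier ∘ₗ hE.inc₂ :=
    TensorProduct.ext' fun x y => congrArg (hE.inc x ⊗ₜ[k] ·) (hE.inc₂_comul y)
  have h₂ : TensorProduct.map hE.inc₂ hE.inc ∘ₗ hE.comul.rTensor hE.mod.carrier =
      P.comul.rTensor P.carrier ∘ₗ hE.inc₂ :=
    TensorProduct.ext' fun x y => congrArg (· ⊗ₜ[k] hE.inc y) (hE.inc₂_comul x)
  have h₃ : TensorProduct.map hE.inc hE.inc₂ ∘ₗ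
      (TensorProduct.assoc k hE.mod.carrier hE.mod.carrier hE.mod.carrier).toLinearMap =
      (TensorProduct.assoc k P.carrier P.carrier P.carrier).toLinearMap ∘ₗ
        TensorProduct.map hE.inc₂ hE.inc :=
    TensorProduct.ext_threefold fun x y z => rfl
  have e := LinearMap.congr_fun P.coassoc (hE.inc x)
  have e₁ := LinearMap.congr_fun h₁ (hE.comul x)
  have e₂ := LinearMap.congr_fun h₂ (hE.comul x)
  have e₃ := LinearMap.congr_fun h₃ (hE.comul.rTensor hE.mod.carrier (hE.comul x))
  simp only [LinearMap.comp_apply, inc₂_comul] at e e₁ e₂ e₃ ⊢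
  rw [e₁, e₃, e₂, e]

theorem coder : hE.comul ∘ₗ hE.d = (TensorProduct.map hE.d LinearMap.id +
    TensorProduct.map hE.mod.sigma hE.d) ∘ₗ hE.comul := by
  refine LinearMap.ext fun x => hE.inc₂_injective ?_
  have h : hE.inc₂ ∘ₗ (TensorProduct.map hE.d LinearMap.id +
      TensorProduct.map hE.mod.sigma hE.d) =
      (TensorProduct.map P.d LinearMap.id + TensorProduct.map P.sigma P.d) ∘ₗ hE.inc₂ := by
    refine TensorProduct.ext' fun x y => ?_
    have e : P.sigma (hE.inc x) = hE.inc (hE.mod.sigma x) := (hE.inc_sigma x).symm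
    rw [LinearMap.comp_apply, LinearMap.add_apply, map_add]
    exact congrArg (fun t => P.d (hE.inc x) ⊗ₜ[k] hE.inc y + t ⊗ₜ[k] P.d (hE.inc y)) e.symm
  have e := LinearMap.congr_fun h (hE.comul x)
  have e' := LinearMap.congr_fun P.coder (hE.inc x)
  simp only [LinearMap.comp_apply, inc₂_comul, inc_d] at e e' ⊢
  rw [e, e']

/-- A subcoalgebra as a dg coalgebra. -/
noncomputable def obj : DGCoalg k where
  toGrMod := hE.mod
  comul := hE.comul
  comul_mem {n x} hx := by
    -- Degrees in `E ⊗ E` are detected in `P ⊗ P`, where the comultiplication is known to be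
    -- homogeneous.
    refine hE.inc_isHom.tensor.mem_of_injective hE.inc₂_injective (n := n) ?_
    have h : P.comul (hE.inc x) ∈ GrMod.tensorGr P.toGrMod P.toGrMod n := P.comul_mem hx
    rw [← inc₂_comul] at h
    exact h
  coassoc := hE.coassoc
  cocomm := LinearMap.ext fun x => hE.inc₂_injective ((hE.inc_isHom.braid _).trans (by
    have := LinearMap.congr_fun P.cocomm (hE.inc x)
    rw [LinearMap.comp_apply, ← inc₂_comul] at this
    exact this))
  conilpotent x := by
    obtain ⟨n, hn⟩ := P.conilpotent (hE.inc x)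
    refine ⟨n, towerMap_injective hE.inc_injective n ?_⟩
    rw [towerMap_iterComul hE.inc₂_comul, hn, map_zero]
  d := hE.d
  d_mem hx := P.d_mem hx
  d_d x := hE.inc_injective (P.d_d _)
  coder := hE.coder

/-- The inclusion of a subcoalgebra as a morphism. -/
noncomputable def incHom : hE.obj ⟶ P where
  map := hE.inc
  map_mem hx := hx
  map_comul x := (hE.inc₂_comul x).symm
  map_d _ := rfl

theorem incHom_injective : Function.Injective hE.incHom.map := hE.inc_injective

/-- The factorization of a morphism through a subcoalgebra. -/
noncomputable def lift {C : DGCoalg k} (Φ : C ⟶ P) (h : ∀ c, Φ.map c ∈ E) : C ⟶ hE.obj where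
  map := Φ.map.codRestrict E h
  map_mem hx := Φ.map_mem hx
  map_comul c := hE.inc₂_injective (by
    have e : hE.inc₂ ∘ₗ TensorProduct.map (Φ.map.codRestrict E h) (Φ.map.codRestrict E h) =
      TensorProduct.map Φ.map Φ.map := TensorProduct.ext' fun x y => rfl
    exact (hE.inc₂_comul _).trans ((Φ.map_comul c).trans (LinearMap.congr_fun e (C.comul c)).symm))
  map_d c := hE.inc_injective (Φ.map_d c)

end IsSubcoalg

end subcoalgebra

/-! ### The enrichment -/

section enrichment
variable {k : Type u} [Field k] [CharZero k]

/-- The coalgebra with zero comultiplication on the complex underlying a dg Lie algebra. -/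
noncomputable def trivCo (g : DGLie k) : DGCoalg k where
  toGrMod := g.toGrMod
  comul := 0
  comul_mem _ := Submodule.zero_mem _
  coassoc := by rw [LinearMap.comp_zero, LinearMap.comp_zero, LinearMap.comp_zero]
  cocomm := LinearMap.comp_zero _
  conilpotent x := ⟨1, map_zero (LinearMap.lTensor g.carrier (iterComul g.toGrMod 0 0))⟩
  d := g.d
  d_mem := g.d_mem
  d_d := g.d_d
  coder := by rw [LinearMap.zero_comp, LinearMap.comp_zero]

/-- The suspension of the complex underlying a dg Lie algebra, with zero bracket. -/
noncomputable def abelShift (L : DGLie k) : DGLie k where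
  toGrMod := L.shift 1
  bracket := 0
  bracket_mem _ _ := Submodule.zero_mem _
  bracket_anti _ _ := by simp
  jacobi _ _ _ := by simp
  d := show L.carrier →ₗ[k] L.carrier from -L.d
  d_mem {n x} hx := by
    have : L.d x ∈ L.gr (n + 1 - 1) := L.d_mem hx
    rw [show n + 1 - 1 = n - 1 + 1 by ring] at this
    exact Submodule.neg_mem _ this
  d_d x := by
    have (y : L.carrier) : -L.d (-L.d y) = 0 := by rw [map_neg, neg_neg, L.d_d]
    exact this x
  leibniz _ _ := by
    simp only [LinearMap.zero_apply, smul_zero, add_zero]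
    exact map_zero (-L.d)

/-- The suspended complex of linear maps from `g` to `h`, as an abelian dg Lie algebra. -/
noncomputable def mapLie (g h : DGLie k) : DGLie k := abelShift (conv (trivCo g) h)

variable {C D : DGCoalg k} {g h : DGLie k}

/-- The linear map underlying an element of `mapLie g h`. -/
noncomputable def mapVal (g h : DGLie k) :
    (mapLie g h).carrier →ₗ[k] (g.carrier →ₗ[k] h.carrier) := convVal (trivCo g) h

theorem mapVal_injective : Function.Injective (mapVal g h) := convVal_injective

theorem mem_mapLie_gr {n : ℤ} {F : (mapLie g h).carrier} :
    F ∈ (mapLie g h).gr n ↔ GrMod.IsHom g.toGrMod h.toGrMod (n + 1) (mapVal g h F) := Iff.rfl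

theorem mapVal_d {p : ℤ} {F : (mapLie g h).carrier}
    (hF : GrMod.IsHom g.toGrMod h.toGrMod p (mapVal g h F)) (x : g.carrier) :
    mapVal g h ((mapLie g h).d F) x =
      -(h.d (mapVal g h F x) - (sg p : k) • mapVal g h F (g.d x)) :=
  congrArg Neg.neg (LinearMap.congr_fun (convD_eq (C := trivCo g) (g := h) hF) x)

/-! ### Classifying morphisms -/

/-- The map `c ↦ (x ↦ ± α(x)(c))`. -/
noncomputable def swapEval (α : g ⟶ conv C h) : C.carrier →ₗ[k] g.carrier →ₗ[k] h.carrier :=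
  TensorProduct.curry ((show (g.carrier ⊗[k] C.carrier) →ₗ[k] h.carrier from evalGen α) ∘ₗ
    GrMod.braid C.toGrMod g.toGrMod)

theorem swapEval_apply (α : g ⟶ conv C h) {m n : ℤ} {c : C.carrier} {x : g.carrier}
    (hc : c ∈ C.gr n) (hx : x ∈ g.gr m) :
    swapEval α c x = (sg (n * m) : k) • convVal C h (α.map x) c := by
  have : swapEval α c x = (show (g.carrier ⊗[k] C.carrier) →ₗ[k] h.carrier from evalGen α)
    (GrMod.braid C.toGrMod g.toGrMod (c ⊗ₜ x)) := rfl
  rw [this, GrMod.braid_apply _ _ hc hx, map_smul]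
  rfl

theorem swapEval_isHom (α : g ⟶ conv C h) {n : ℤ} {c : C.carrier} (hc : c ∈ C.gr n) :
    GrMod.IsHom g.toGrMod h.toGrMod n (swapEval α c) := fun m x hx => by
  rw [swapEval_apply α hc hx, add_comm]
  exact Submodule.smul_mem _ _ (mem_conv_gr.1 (α.map_mem hx) n c hc)

theorem swapEval_mem (α : g ⟶ conv C h) (c : C.carrier) :
    swapEval α c ∈ GrMod.homTotal g.toGrMod h.toGrMod := by
  have : ⨆ n, C.gr n ≤ (GrMod.homTotal g.toGrMod h.toGrMod).comap (swapEval α) :=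
    iSup_le fun n c hc => (swapEval_isHom α hc).mem_homTotal
  rw [C.iSup_gr] at this
  exact this (Submodule.mem_top (x := c))

/-- The map `c ↦ (x ↦ ± α(x)(c))` with values in `mapLie g h`. -/
noncomputable def coact (α : g ⟶ conv C h) : C.carrier →ₗ[k] (mapLie g h).carrier :=
  (swapEval α).codRestrict _ (swapEval_mem α)

theorem mapVal_coact (α : g ⟶ conv C h) (c : C.carrier) :
    mapVal g h (coact α c) = swapEval α c := rfl

/-- The suspension in `mapLie g h` turns a map of degree `n` into an element of degree `n - 1`, as a
twisting cochain requires; the desuspension in the bar construction undoes it. -/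
theorem coact_isHom (α : g ⟶ conv C h) :
    GrMod.IsHom C.toGrMod (mapLie g h).toGrMod (-1) (coact α) := fun n c hc => by
  rw [mem_mapLie_gr, mapVal_coact, neg_add_cancel_right]
  exact swapEval_isHom α hc

/-- The differentials of `h` cancel because `α` commutes with differentials; the term with the
differential of `C` remains. The overall minus sign is that of the suspended differential. -/
theorem coact_d (α : g ⟶ conv C h) (c : C.carrier) :
    (mapLie g h).d (coact α c) = -(coact α (C.d c)) := by
  have : (mapLie g h).d ∘ₗ coact α = -(coact α ∘ₗ C.d) := C.ext_gr fun n c hc => by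
    refine mapVal_injective (g.ext_gr fun m x hx => ?_)
    rw [LinearMap.comp_apply, LinearMap.neg_apply, LinearMap.comp_apply,
      mapVal_d (swapEval_isHom α hc), map_neg, LinearMap.neg_apply, mapVal_coact, mapVal_coact,
      swapEval_apply α hc hx, swapEval_apply α hc (g.d_mem hx), swapEval_apply α (C.d_mem hc) hx,
      α.map_d, convVal_d, convD_eq (mem_conv_gr.1 (α.map_mem hx)), LinearMap.sub_apply,
      LinearMap.smul_apply, LinearMap.comp_apply, LinearMap.comp_apply, map_smul, smul_smul,
      ← sg_add, sg_congr (k := k) (m := n + n * (m - 1)) (n := n * m) (by grind), smul_sub,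
      smul_smul, ← sg_add, sg_congr (k := k) (m := n * m + m) (n := (n - 1) * m) (by grind),
      sub_sub_cancel]
  exact LinearMap.congr_fun this c

/-- The bracket of `mapLie g h` is zero, so the Maurer-Cartan equation reduces to compatibility with
the differentials. -/
theorem exists_classify (α : g ⟶ conv C h) :
    ∃ Φ : C ⟶ barObj (mapLie g h), ∀ c, barPr (mapLie g h) (Φ.map c) = coact α c := by
  refine bar_exists_hom (coact_isHom α) fun c => ?_
  have : convBracket C.toGrCoalg (mapLie g h).toGrLie (coact α) (coact α) = 0 := by
    have e : TensorProduct.lift (mapLie g h).bracket = 0 := TensorProduct.ext' fun _ _ => rfl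
    rw [convBracket_eq, convAux, e, LinearMap.zero_comp, LinearMap.zero_comp]
  rw [this, LinearMap.zero_apply, smul_zero, sub_zero, coact_d]

/-- The morphism to the cofree coalgebra on the maps from `g` to `h` that classifies a morphism
from `g` to a convolution algebra. -/
noncomputable def classify (α : g ⟶ conv C h) : C ⟶ barObj (mapLie g h) :=
  (exists_classify α).choose

theorem barPr_classify (α : g ⟶ conv C h) (c : C.carrier) :
    barPr (mapLie g h) ((classify α).map c) = coact α c := (exists_classify α).choose_spec c

theorem enrich_isSubcoalg (g h : DGLie k) : IsSubcoalg (barObj (mapLie g h))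
    (⨆ i : (C : DGCoalg k) × (g ⟶ conv C h), LinearMap.range (classify i.2).map) :=
  isSubcoalg_iSup _ _

/-- The coalgebra of morphisms from `g` to `h`: the sum of the images of all classifying
morphisms. -/
noncomputable def enrichObj (g h : DGLie k) : DGCoalg k := (enrich_isSubcoalg g h).obj

/-- The inclusion in the cofree coalgebra. -/
noncomputable def enrichInc (g h : DGLie k) : enrichObj g h ⟶ barObj (mapLie g h) :=
  (enrich_isSubcoalg g h).incHom

theorem classify_mem (α : g ⟶ conv C h) (c : C.carrier) : (classify α).map c ∈
    ⨆ i : (C : DGCoalg k) × (g ⟶ conv C h), LinearMap.range (classify i.2).map :=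
  Submodule.mem_iSup_of_mem (⟨C, α⟩ : (C : DGCoalg k) × (g ⟶ conv C h)) ⟨c, rfl⟩

/-- The classifying morphism. -/
noncomputable def enrichLift (α : g ⟶ conv C h) : C ⟶ enrichObj g h :=
  (enrich_isSubcoalg g h).lift (classify α) (classify_mem α)

/-- The coalgebra `enrichObj g h` is by definition the sum of the images of the classifying
morphisms, so equality can be tested on each of them. -/
theorem enrich_ext {M : Type*} [AddCommGroup M] [Module k M]
    {f f' : (enrichObj g h).carrier →ₗ[k] M}
    (e : ∀ (C : DGCoalg k) (α : g ⟶ conv C h), f ∘ₗ (enrichLift α).map = f' ∘ₗ (enrichLift α).map) :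
    f = f' := by
  have key : (⨆ i : (C : DGCoalg k) × (g ⟶ conv C h), LinearMap.range (classify i.2).map) ≤
      (LinearMap.eqLocus f f').map (enrichInc g h).map := by
    refine iSup_le fun i => ?_
    rintro _ ⟨c, rfl⟩
    exact ⟨(enrichLift i.2).map c, LinearMap.congr_fun (e i.1 i.2) c, rfl⟩
  refine LinearMap.ext fun t => ?_
  obtain ⟨t', ht, h'⟩ := key ((enrich_isSubcoalg g h).inc_mem t)
  have : t' = t := (enrich_isSubcoalg g h).incHom_injective h'
  exact this ▸ ht

/-! ### The universal morphism to a convolution algebra -/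

/-- The universal coaction. -/
noncomputable def enrichVal (g h : DGLie k) :
    (enrichObj g h).carrier →ₗ[k] g.carrier →ₗ[k] h.carrier :=
  mapVal g h ∘ₗ barPr (mapLie g h) ∘ₗ (enrichInc g h).map

theorem enrichVal_lift (α : g ⟶ conv C h) (c : C.carrier) :
    enrichVal g h ((enrichLift α).map c) = swapEval α c :=
  congrArg (mapVal g h) (barPr_classify α c)

theorem enrichVal_isHom {n : ℤ} {e : (enrichObj g h).carrier} (he : e ∈ (enrichObj g h).gr n) :
    GrMod.IsHom g.toGrMod h.toGrMod n (enrichVal g h e) := by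
  have := mem_mapLie_gr.1 (barPr_isHom (mapLie g h) n _ ((enrichInc g h).map_mem he))
  rwa [neg_add_cancel_right] at this

/-- The map `x ↦ (e ↦ ± e(x))`. -/
noncomputable def enrichUnitAux (g h : DGLie k) :
    g.carrier →ₗ[k] (enrichObj g h).carrier →ₗ[k] h.carrier :=
  TensorProduct.curry (TensorProduct.lift (enrichVal g h) ∘ₗ
    GrMod.braid g.toGrMod (enrichObj g h).toGrMod)

theorem enrichUnitAux_apply {m n : ℤ} {x : g.carrier} {e : (enrichObj g h).carrier}
    (hx : x ∈ g.gr m) (he : e ∈ (enrichObj g h).gr n) :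
    enrichUnitAux g h x e = (sg (m * n) : k) • enrichVal g h e x := by
  have : enrichUnitAux g h x e = TensorProduct.lift (enrichVal g h)
    (GrMod.braid g.toGrMod (enrichObj g h).toGrMod (x ⊗ₜ e)) := rfl
  rw [this, GrMod.braid_apply _ _ hx he, map_smul, TensorProduct.lift.tmul]

theorem enrichUnitAux_isHom {m : ℤ} {x : g.carrier} (hx : x ∈ g.gr m) :
    GrMod.IsHom (enrichObj g h).toGrMod h.toGrMod m (enrichUnitAux g h x) := fun n e he => by
  rw [enrichUnitAux_apply hx he, add_comm]
  exact Submodule.smul_mem _ _ (enrichVal_isHom he m x hx)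

theorem enrichUnitAux_mem (x : g.carrier) :
    enrichUnitAux g h x ∈ GrMod.homTotal (enrichObj g h).toGrMod h.toGrMod := by
  have : ⨆ n, g.gr n ≤
      (GrMod.homTotal (enrichObj g h).toGrMod h.toGrMod).comap (enrichUnitAux g h) :=
    iSup_le fun n x hx => (enrichUnitAux_isHom hx).mem_homTotal
  rw [g.iSup_gr] at this
  exact this (Submodule.mem_top (x := x))

/-- Pulling the universal map back along the classifying morphism of `α` returns `α`: the sign of
`swapEval` and that of the universal map cancel, each being the braiding sign of `x` and `c`. -/
theorem enrichUnitAux_lift (α : g ⟶ conv C h) (x : g.carrier) :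
    enrichUnitAux g h x ∘ₗ (enrichLift α).map = convVal C h (α.map x) := by
  have : (LinearMap.lcomp k h.carrier (enrichLift α).map) ∘ₗ enrichUnitAux g h =
      convVal C h ∘ₗ α.map := g.ext_gr fun m x hx => C.ext_gr fun n c hc => by
    have e₁ := enrichUnitAux_apply hx ((enrichLift α).map_mem hc)
    rw [enrichVal_lift, swapEval_apply α hc hx, smul_smul, ← sg_add,
      sg_even (m := m * n + n * m) (by grind), one_smul] at e₁
    exact e₁
  exact LinearMap.congr_fun this x

/-- On the image of each classifying morphism the universal map becomes some `α`, which respects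
brackets; these images exhaust the coalgebra. Using the sum of images rather than the whole cofree
coalgebra is what makes this work. -/
theorem enrichUnitAux_bracket (x y : g.carrier) : enrichUnitAux g h (g.bracket x y) =
    convBracket (enrichObj g h).toGrCoalg h.toGrLie (enrichUnitAux g h x)
      (enrichUnitAux g h y) := by
  have key : enrichUnitAux g h ∘ₗ g.bracket x =
      convBracket (enrichObj g h).toGrCoalg h.toGrLie (enrichUnitAux g h x) ∘ₗ
        enrichUnitAux g h := by
    refine g.ext_gr fun n y hy => enrich_ext fun C α => ?_
    have nat := convBracket_natural (C := (enrichObj g h).toGrCoalg) (D := C.toGrCoalg)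
      (g := h.toGrLie) (h := h.toGrLie) (φ := (enrichLift α).map) (enrichLift α).map_mem
      (enrichLift α).map_comul (ψ := LinearMap.id) (fun h => h) (fun _ _ => rfl)
      (enrichUnitAux g h x) (enrichUnitAux_isHom hy)
    simp only [LinearMap.id_comp, enrichUnitAux_lift] at nat
    rw [LinearMap.comp_apply, LinearMap.comp_apply, nat, enrichUnitAux_lift, α.map_bracket]
    rfl
  exact LinearMap.congr_fun key y

theorem enrichUnitAux_d (x : g.carrier) :
    enrichUnitAux g h (g.d x) = convD (enrichObj g h) h (enrichUnitAux g h x) := by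
  have key : enrichUnitAux g h ∘ₗ g.d = convD (enrichObj g h) h ∘ₗ enrichUnitAux g h := by
    refine g.ext_gr fun n x hx => enrich_ext fun C α => ?_
    rw [LinearMap.comp_apply, LinearMap.comp_apply, enrichUnitAux_lift, α.map_d, convVal_d,
      convD_eq (enrichUnitAux_isHom hx), convD_eq (mem_conv_gr.1 (α.map_mem hx)),
      ← enrichUnitAux_lift]
    refine LinearMap.ext fun c => ?_
    have e : (enrichLift α).map (C.d c) = (enrichObj g h).d ((enrichLift α).map c) :=
      (enrichLift α).map_d c
    exact congrArg (fun t => h.d (enrichUnitAux g h x ((enrichLift α).map c)) -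
      (sg n : k) • enrichUnitAux g h x t) e
  exact LinearMap.congr_fun key x

/-- The counit of the enrichment. -/
noncomputable def enrichUnit (g h : DGLie k) : g ⟶ conv (enrichObj g h) h where
  map := (enrichUnitAux g h).codRestrict _ enrichUnitAux_mem
  map_mem hx := enrichUnitAux_isHom hx
  map_bracket x y := convVal_injective (enrichUnitAux_bracket x y)
  map_d x := convVal_injective (enrichUnitAux_d x)

theorem enrich_exists_lift (α : g ⟶ conv C h) :
    ∃ Φ : C ⟶ enrichObj g h, enrichUnit g h ≫ convHom Φ (𝟙 h) = α :=
  ⟨enrichLift α, DGLie.Hom.ext (LinearMap.ext fun x => convVal_injective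
    (enrichUnitAux_lift α x))⟩

/-- The composite with the unit determines, up to invertible signs, the linear map to the complex of
maps `g → h`. That is the projection of the induced morphism to the cofree coalgebra, hence
determines it, and the inclusion is injective. -/
theorem enrich_hom_ext {Φ Ψ : C ⟶ enrichObj g h}
    (e : enrichUnit g h ≫ convHom Φ (𝟙 h) = enrichUnit g h ≫ convHom Ψ (𝟙 h)) : Φ = Ψ := by
  have key : enrichVal g h ∘ₗ Φ.map = enrichVal g h ∘ₗ Ψ.map :=
    C.ext_gr fun n c hc => g.ext_gr fun m x hx => by
      have e₁ : enrichUnitAux g h x (Φ.map c) = enrichUnitAux g h x (Ψ.map c) :=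
        congrArg (fun α : g ⟶ conv C h => convVal C h (α.map x) c) e
      rw [enrichUnitAux_apply hx (Φ.map_mem hc), enrichUnitAux_apply hx (Ψ.map_mem hc)] at e₁
      have e₂ := congrArg (fun t => (sg (m * n) : k) • t) e₁
      simp only [smul_smul, sg_mul_self, one_smul] at e₂
      exact e₂
  have e' : Φ ≫ enrichInc g h = Ψ ≫ enrichInc g h :=
    bar_hom_ext' fun c => mapVal_injective (LinearMap.congr_fun key c)
  refine DGCoalg.Hom.ext (LinearMap.ext fun c => ?_)
  exact (enrich_isSubcoalg g h).incHom_injective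
    (congrArg (fun F : C ⟶ barObj (mapLie g h) => F.map c) e')

end enrichment

section universal
variable {k : Type u} [Field k] [CharZero k] {C D : DGCoalg k} {g h l : DGLie k}

/-! ### The tensoring functor -/

/-- The adjunction bijection of the tensoring. -/
noncomputable def tensorEquiv (C : DGCoalg k) (g h : DGLie k) :
    (tensorObj C g ⟶ h) ≃ (g ⟶ conv C h) :=
  Equiv.ofBijective (fun ψ => tensorUnit C g ≫ convHom (𝟙 C) ψ)
    ⟨fun _ _ e => tensor_hom_ext e, tensor_exists_desc⟩

theorem tensorEquiv_comp (ψ : tensorObj C g ⟶ h) (χ : h ⟶ l) :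
    tensorEquiv C g l (ψ ≫ χ) = tensorEquiv C g h ψ ≫ convHom (𝟙 C) χ := rfl

/-- The action of the tensoring on morphisms. -/
noncomputable def tensorMap (φ : C ⟶ D) (ψ : g ⟶ h) : tensorObj C g ⟶ tensorObj D h :=
  (tensorEquiv C g _).symm (ψ ≫ tensorUnit D h ≫ convHom φ (𝟙 _))

theorem tensorUnit_map (φ : C ⟶ D) (ψ : g ⟶ h) :
    tensorUnit C g ≫ convHom (𝟙 C) (tensorMap φ ψ) = ψ ≫ tensorUnit D h ≫ convHom φ (𝟙 _) :=
  (tensorEquiv C g _).apply_symm_apply _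

/-- Naturality in the coalgebra and in the first Lie algebra at once; setting one of the two
morphisms to an identity gives each separately. -/
theorem tensorEquiv_map_comp (φ : C ⟶ D) (ψ : g ⟶ h) (χ : tensorObj D h ⟶ l) :
    tensorEquiv C g l (tensorMap φ ψ ≫ χ) = ψ ≫ tensorEquiv D h l χ ≫ convHom φ (𝟙 l) :=
  congrArg (· ≫ convHom (𝟙 C) χ) (tensorUnit_map φ ψ)

theorem tensorMap_id (C : DGCoalg k) (g : DGLie k) : tensorMap (𝟙 C) (𝟙 g) = 𝟙 (tensorObj C g) :=
  tensor_hom_ext (tensorUnit_map _ _)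

theorem tensorMap_comp {C₁ C₂ C₃ : DGCoalg k} (φ : C₁ ⟶ C₂) (φ' : C₂ ⟶ C₃) (ψ : g ⟶ h)
    (ψ' : h ⟶ l) : tensorMap (φ ≫ φ') (ψ ≫ ψ') = tensorMap φ ψ ≫ tensorMap φ' ψ' :=
  (tensorEquiv C₁ g _).injective ((tensorUnit_map _ _).trans ((tensorEquiv_map_comp φ ψ _).trans
    (congrArg (fun α => ψ ≫ α ≫ convHom φ (𝟙 _)) (tensorUnit_map φ' ψ'))).symm)

/-- The tensoring functor. -/
noncomputable def tensorFunctor (k : Type u) [Field k] [CharZero k] :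
    DGCoalg k ⥤ DGLie k ⥤ DGLie k where
  obj C :=
    { obj := tensorObj C
      map := fun ψ => tensorMap (𝟙 C) ψ
      map_id := tensorMap_id C
      map_comp := fun ψ ψ' => tensorMap_comp (𝟙 C) (𝟙 C) ψ ψ' }
  map φ :=
    { app := fun g => tensorMap φ (𝟙 g)
      naturality := fun g h ψ => (tensorMap_comp (𝟙 _) φ ψ (𝟙 h)).symm.trans
        (tensorMap_comp φ (𝟙 _) (𝟙 g) ψ) }
  map_id C := NatTrans.ext (funext fun g => tensorMap_id C g)
  map_comp φ φ' := NatTrans.ext (funext fun g => tensorMap_comp φ φ' (𝟙 g) (𝟙 g))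

/-- The tensoring of dg Lie algebras over coalgebras. -/
noncomputable def tensoring (k : Type u) [Field k] [CharZero k] : Tensoring k where
  functor := tensorFunctor k
  homEquiv := tensorEquiv
  natural_coalgebra φ g _ α := tensorEquiv_map_comp φ (𝟙 g) α
  natural_left C _ _ ψ _ α := tensorEquiv_map_comp (𝟙 C) ψ α
  natural_right _ _ _ _ χ α := tensorEquiv_comp α χ

/-! ### The enrichment functor -/

/-- The adjunction bijection of the enrichment. -/
noncomputable def enrichEquiv (C : DGCoalg k) (g h : DGLie k) :
    (g ⟶ conv C h) ≃ (C ⟶ enrichObj g h) :=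
  (Equiv.ofBijective (fun Φ : C ⟶ enrichObj g h => enrichUnit g h ≫ convHom Φ (𝟙 h))
    ⟨fun _ _ e => enrich_hom_ext e, enrich_exists_lift⟩).symm

theorem enrichUnit_equiv (α : g ⟶ conv C h) :
    enrichUnit g h ≫ convHom (enrichEquiv C g h α) (𝟙 h) = α :=
  (enrichEquiv C g h).symm_apply_apply α

/-- The action of the enrichment on morphisms. -/
noncomputable def enrichMap {g' h' : DGLie k} (ψ : g' ⟶ g) (χ : h ⟶ h') :
    enrichObj g h ⟶ enrichObj g' h' :=
  enrichEquiv _ g' h' (ψ ≫ enrichUnit g h ≫ convHom (𝟙 _) χ)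

theorem enrichUnit_map {g' h' : DGLie k} (ψ : g' ⟶ g) (χ : h ⟶ h') :
    enrichUnit g' h' ≫ convHom (enrichMap ψ χ) (𝟙 h') =
      ψ ≫ enrichUnit g h ≫ convHom (𝟙 _) χ := enrichUnit_equiv _

/-- Naturality in both Lie algebras at once. Both sides are compared after the unit of the
enrichment, where each becomes `ψ ≫ α ≫ convHom (𝟙 C) χ`. -/
theorem enrichEquiv_comp_map {g' h' : DGLie k} (ψ : g' ⟶ g) (χ : h ⟶ h') (α : g ⟶ conv C h) :
    enrichEquiv C g' h' (ψ ≫ α ≫ convHom (𝟙 C) χ) = enrichEquiv C g h α ≫ enrichMap ψ χ := by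
  refine enrich_hom_ext ((enrichUnit_equiv _).trans ?_)
  have e := congrArg (· ≫ convHom (enrichEquiv C g h α) (𝟙 h')) (enrichUnit_map ψ χ)
  have e' := congrArg (fun β => ψ ≫ β ≫ convHom (𝟙 C) χ) (enrichUnit_equiv α)
  exact e'.symm.trans e.symm

theorem enrichEquiv_comp (φ : C ⟶ D) (α : g ⟶ conv D h) :
    enrichEquiv C g h (α ≫ convHom φ (𝟙 h)) = φ ≫ enrichEquiv D g h α :=
  enrich_hom_ext ((enrichUnit_equiv _).trans
    (congrArg (· ≫ convHom φ (𝟙 h)) (enrichUnit_equiv α)).symm)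

theorem enrichMap_id (g h : DGLie k) : enrichMap (𝟙 g) (𝟙 h) = 𝟙 (enrichObj g h) :=
  enrich_hom_ext (enrichUnit_map _ _)

theorem enrichMap_comp {g₁ g₂ g₃ h₁ h₂ h₃ : DGLie k} (ψ : g₂ ⟶ g₁) (ψ' : g₃ ⟶ g₂) (χ : h₁ ⟶ h₂)
    (χ' : h₂ ⟶ h₃) : enrichMap (ψ' ≫ ψ) (χ ≫ χ') = enrichMap ψ χ ≫ enrichMap ψ' χ' :=
  enrichEquiv_comp_map ψ' χ' (ψ ≫ enrichUnit g₁ h₁ ≫ convHom (𝟙 _) χ)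

/-- The enrichment functor. -/
noncomputable def enrichFunctor (k : Type u) [Field k] [CharZero k] :
    (DGLie k)ᵒᵖ ⥤ DGLie k ⥤ DGCoalg k where
  obj g :=
    { obj := enrichObj g.unop
      map := fun χ => enrichMap (𝟙 _) χ
      map_id := enrichMap_id g.unop
      map_comp := fun χ χ' => enrichMap_comp (𝟙 _) (𝟙 _) χ χ' }
  map ψ :=
    { app := fun h => enrichMap ψ.unop (𝟙 h)
      naturality := fun h h' χ => (enrichMap_comp (𝟙 _) ψ.unop χ (𝟙 h')).symm.trans
        (enrichMap_comp ψ.unop (𝟙 _) (𝟙 h) χ) }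
  map_id g := NatTrans.ext (funext fun h => enrichMap_id g.unop h)
  map_comp ψ ψ' := NatTrans.ext (funext fun h => enrichMap_comp ψ.unop ψ'.unop (𝟙 h) (𝟙 h))

/-- The enrichment of dg Lie algebras over coalgebras. -/
noncomputable def enrichment (k : Type u) [Field k] [CharZero k] : Enrichment k where
  functor := enrichFunctor k
  homEquiv := enrichEquiv
  natural_coalgebra φ _ _ α := enrichEquiv_comp φ α
  natural_left _ _ _ ψ h α := enrichEquiv_comp_map ψ (𝟙 h) α
  natural_right _ g _ _ χ α := enrichEquiv_comp_map (𝟙 g) χ α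

/-! ### The comparison isomorphisms -/

namespace Tensoring
variable (T : Tensoring k)

/-- The comparison morphism `C ▷ mc_Lie ⟶ Ω C`. -/
noncomputable def toCobar (C : DGCoalg k) : (T.functor.obj C).obj (mcLie k) ⟶ cobarObj C :=
  (T.homEquiv C (mcLie k) (cobarObj C)).symm (cobarUnit C)

/-- Under the adjunction, precomposing with `toCobar` becomes pulling back the universal twisting
cochain, so the universal property of the cobar construction applies to `T`. -/
theorem homEquiv_toCobar_comp (ψ : cobarObj C ⟶ h) :
    T.homEquiv C (mcLie k) h (T.toCobar C ≫ ψ) = cobarUnit C ≫ convHom (𝟙 C) ψ :=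
  (T.natural_right C (mcLie k) ψ (T.toCobar C)).trans
    (congrArg (· ≫ convHom (𝟙 C) ψ) (Equiv.apply_symm_apply _ _))

theorem exists_toCobar_inv (C : DGCoalg k) : ∃ ψ : cobarObj C ⟶ (T.functor.obj C).obj (mcLie k),
    T.toCobar C ≫ ψ = 𝟙 _ ∧ ψ ≫ T.toCobar C = 𝟙 _ := by
  obtain ⟨ψ, hψ⟩ := cobar_exists_desc (T.homEquiv C (mcLie k) _ (𝟙 _))
  have e : T.toCobar C ≫ ψ = 𝟙 _ :=
    (T.homEquiv C (mcLie k) _).injective ((T.homEquiv_toCobar_comp ψ).trans hψ)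
  -- For the other composite, the universal property makes `toCobar` cancellable on the left, so the
  -- identity already obtained suffices.
  refine ⟨ψ, e, cobar_hom_ext ?_⟩
  rw [← T.homEquiv_toCobar_comp, ← T.homEquiv_toCobar_comp, ← Category.assoc, e, Category.id_comp,
    Category.comp_id]

/-- The comparison morphism is an isomorphism. -/
noncomputable def cobarIso (C : DGCoalg k) :
    cobarObj C ≅ (T.functor.obj C).obj (mcLie k) where
  hom := (T.exists_toCobar_inv C).choose
  inv := T.toCobar C
  hom_inv_id := (T.exists_toCobar_inv C).choose_spec.2
  inv_hom_id := (T.exists_toCobar_inv C).choose_spec.1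

theorem toCobar_natural (φ : C ⟶ D) :
    (T.functor.map φ).app (mcLie k) ≫ T.toCobar D = T.toCobar C ≫ cobarMap φ := by
  refine (T.homEquiv C (mcLie k) (cobarObj D)).injective ?_
  refine (T.natural_coalgebra φ _).trans (Eq.trans ?_ (T.homEquiv_toCobar_comp _).symm)
  -- After transposing both sides, naturality of the comparison is naturality of the universal
  -- twisting cochain.
  exact (congrArg (· ≫ convHom φ (𝟙 _)) (Equiv.apply_symm_apply _ _)).trans (cobarUnit_natural φ)

theorem cobarIso_natural (φ : C ⟶ D) : (cobar k).map φ ≫ (T.cobarIso D).hom =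
    (T.cobarIso C).hom ≫ (T.functor.flip.obj (mcLie k)).map φ := by
  have e := (T.cobarIso C).inv_comp_eq.1 (T.toCobar_natural φ).symm
  exact (Iso.comp_inv_eq (T.cobarIso D).symm).2 (e.trans (Category.assoc _ _ _).symm)

end Tensoring

namespace Enrichment
variable (E : Enrichment k)

/-- The comparison morphism `B g ⟶ E(mc_Lie, g)`. -/
noncomputable def ofBar (g : DGLie k) :
    barObj g ⟶ (E.functor.obj (Opposite.op (mcLie k))).obj g :=
  E.homEquiv (barObj g) (mcLie k) g (barUnit g)

/-- Composing with the comparison morphism is the transpose of pulling back the universal twisting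
cochain of the bar construction. -/
theorem comp_ofBar (Φ : C ⟶ barObj g) :
    Φ ≫ E.ofBar g = E.homEquiv C (mcLie k) g (barUnit g ≫ convHom Φ (𝟙 g)) :=
  (E.natural_coalgebra Φ (barUnit g)).symm

theorem exists_ofBar_inv (g : DGLie k) :
    ∃ Φ : (E.functor.obj (Opposite.op (mcLie k))).obj g ⟶ barObj g,
      E.ofBar g ≫ Φ = 𝟙 _ ∧ Φ ≫ E.ofBar g = 𝟙 _ := by
  obtain ⟨Φ, hΦ⟩ := bar_exists_lift ((E.homEquiv _ (mcLie k) g).symm (𝟙 _))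
  have e : Φ ≫ E.ofBar g = 𝟙 _ := (E.comp_ofBar Φ).trans
    ((congrArg (E.homEquiv _ (mcLie k) g) hΦ).trans (Equiv.apply_symm_apply _ _))
  -- `Φ` is a one-sided inverse so far. The other identity holds after composing with `ofBar`, which
  -- can be cancelled on the right since `homEquiv` is injective and morphisms to the bar
  -- construction are determined by their cochains.
  have e' : (E.ofBar g ≫ Φ) ≫ E.ofBar g = 𝟙 _ ≫ E.ofBar g := by
    rw [Category.assoc, e, Category.id_comp, Category.comp_id]
  exact ⟨Φ, bar_hom_ext ((E.homEquiv _ (mcLie k) g).injective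
    ((E.comp_ofBar _).symm.trans (e'.trans (E.comp_ofBar _)))), e⟩

/-- The comparison morphism is an isomorphism. -/
noncomputable def barIso (g : DGLie k) :
    barObj g ≅ (E.functor.obj (Opposite.op (mcLie k))).obj g where
  hom := E.ofBar g
  inv := (E.exists_ofBar_inv g).choose
  hom_inv_id := (E.exists_ofBar_inv g).choose_spec.1
  inv_hom_id := (E.exists_ofBar_inv g).choose_spec.2

theorem barIso_natural (χ : g ⟶ h) : (bar k).map χ ≫ (E.barIso h).hom =
    (E.barIso g).hom ≫ (E.functor.obj (Opposite.op (mcLie k))).map χ :=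
  (E.comp_ofBar (barMap χ)).trans ((congrArg (E.homEquiv (barObj g) (mcLie k) h)
    (barUnit_natural χ).symm).trans (E.natural_right (barObj g) (mcLie k) χ (barUnit g)))

end Enrichment

end universal

end ComLie

/-- Over a field `k` of characteristic zero, the tensoring `▷` and the enrichment of dg Lie algebras
over conilpotent cocommutative dg coalgebras exist, and there are isomorphisms `Ω C ≅ C ▷ mc_Lie`
and `B g ≅ E(mc_Lie, g)`, natural in `C` and in `g`. -/
theorem mainTheorem12 (k : Type u) [Field k] [CharZero k] :
    Nonempty (ComLie.Tensoring k) ∧ Nonempty (ComLie.Enrichment k) ∧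
    (∀ T : ComLie.Tensoring k,
      Nonempty (ComLie.cobar k ≅ T.functor.flip.obj (ComLie.mcLie k))) ∧
    (∀ E : ComLie.Enrichment k,
      Nonempty (ComLie.bar k ≅ E.functor.obj (Opposite.op (ComLie.mcLie k)))) :=
  ⟨⟨ComLie.tensoring k⟩, ⟨ComLie.enrichment k⟩,
    fun T => ⟨NatIso.ofComponents T.cobarIso T.cobarIso_natural⟩,
    fun E => ⟨NatIso.ofComponents E.barIso E.barIso_natural⟩⟩
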